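/- Let $\#\mathrm{BIS}$ be the problem of computing, for a bipartite graph $B=(U,V,E)$, the number of independent sets of $B$. A hypergraph $H=(\mathcal V,\mathcal E)$ has a multiset $\mathcal E$ of hyperedges, each of which is a multiset of vertices; it is uniform if all hyperedges have the same positive size. For real $q>0$ and $\gamma>0$, $\mathrm{UniformHyperTutte}(q,\gamma)$ is the problem of computing, for a uniform hypergraph $H$, $$Z_{\mathrm{Tutte}}(H;q,\gamma)=\sum_{\mathcal F\subseteq\mathcal E}q^{\kappa(\mathcal V,\mathcal F)}\gamma^{|\mathcal F|},$$ where $\kappa(\mathcal V,\mathcal F)$ is the number of connected components of $(\mathcal V,\mathcal F)$. A randomised approximation scheme for a real-valued function $f$ on instances is a randomised algorithm that, on input an instance $x$ and a rational $\varepsilon>0$, outputs a rational $z$ with $\Pr[e^{-\varepsilon}f(x)\le z\le e^{\varepsilon}f(x)]\ge 3/4$; it is an FPRAS if its running time is polynomial in $|x|$ and $\varepsilon^{-1}$. A real number $z$ is efficiently approximable if there is an FPRAS for the problem that maps every input to $z$. We write $f\le_{\mathrm{AP}}g$ if there is a randomised oracle algorithm that, on input $(x,\varepsilon)$ with $0<\varepsilon<1$,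 runs in time polynomial in $|x|$ and $\varepsilon^{-1}$; makes only oracle calls $(w,\delta)$ in which $w$ is an instance of $g$, $0<\delta<1$, and $\delta^{-1}$ is bounded by a polynomial in $|x|$ and $\varepsilon^{-1}$; and meets the specification of a randomised approximation scheme for $f$ whenever the oracle meets that of a randomised approximation scheme for $g$. Corollary. Suppose that $q>1$ is efficiently approximable. Then $\#\mathrm{BIS}\le_{\mathrm{AP}}\mathrm{UniformHyperTutte}(q,q-1)$; consequently, if $\mathrm{UniformHyperTutte}(q,q-1)$ has an FPRAS, then so does $\#\mathrm{BIS}$. In particular, if there is an FPRAS for the partition function $\sum_{\sigma:\mathcal V\to\{1,2\}}\prod_{f\in\mathcal E}\bigl(1+\delta_f(\sigma)\bigr)$ of the Ising model on uniform hypergraphs in which every hyperedge has weight $1$ (where $\delta_f(\sigma)$ is $1$ if $\sigma$ is constant on $f$ and $0$ otherwise), then there is an FPRAS for $\#\mathrm{BIS}$. -/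

import Mathlib

noncomputable section

/-! ### Randomised oracle programs with bit cost

A machine has natural-number registers and one stack, called the tape, through which rational
numbers are handed to it. A program is a while-program that mentions finitely many registers.
Every operation is charged one plus the bit lengths of the numbers it works on (the logarithmic
cost criterion), so that time is polynomially related to time on a Turing machine. -/

/-- The arithmetic operations. Subtraction is truncated; division and remainder are integral. -/
inductive ArithOp where
  | add | sub | mul | div | mod

def ArithOp.apply : ArithOp → ℕ → ℕ → ℕ
  | .add, a, b => a + b
  | .sub, a, b => a - b
  | .mul, a, b => a * b
  | .div, a, b => a / b
  | .mod, a, b => a % b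

/-- Randomised oracle programs; registers are named by natural numbers. -/
inductive Prog where
  /-- do nothing -/
  | skip
  /-- `set r c`: store the constant `c` in register `r` -/
  | set (r c : ℕ)
  /-- `arith o r a b`: store the result of `o` on registers `a` and `b` in register `r` -/
  | arith (o : ArithOp) (r a b : ℕ)
  /-- store a fair coin toss (`0` or `1`) in register `r` -/
  | flip (r : ℕ)
  /-- pop the top symbol of the tape into register `r`; an empty tape yields `4` -/
  | read (r : ℕ)
  /-- push the content of register `r` onto the tape -/
  | write (r : ℕ)
  /-- empty the tape -/
  | clear
  /-- `oracle w n d`: call the oracle on the word in register `w` with error tolerance given by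
  the quotient of registers `n` and `d`; its answer replaces the content of the tape -/
  | oracle (w n d : ℕ)
  /-- sequential composition -/
  | seq (p p' : Prog)
  /-- `ite r p p'`: run `p` if register `r` is non-zero and `p'` if it is zero -/
  | ite (r : ℕ) (p p' : Prog)
  /-- `loop r p`: while register `r` is non-zero, run `p` -/
  | loop (r : ℕ) (p : Prog)

/-- Programs that never call an oracle. -/
def Prog.OracleFree : Prog → Prop
  | .oracle _ _ _ => False
  | .seq p p' => p.OracleFree ∧ p'.OracleFree
  | .ite _ p p' => p.OracleFree ∧ p'.OracleFree
  | .loop _ p => p.OracleFree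
  | _ => True

/-- The number that represents a binary word in a register: the first letter of the word is the
least significant bit, and a leading `1` marks the end. -/
def wordToNat (w : List Bool) : ℕ := w.foldr Nat.bit 1

/-- The word represented by the content of a register. -/
def natToWord (n : ℕ) : List Bool := n.bits.dropLast

theorem wordToNat_ne_zero (w : List Bool) : wordToNat w ≠ 0 := by
  induction w with
  | nil => simp [wordToNat]
  | cons b w ih =>
    have h : wordToNat (b :: w) = Nat.bit b (wordToNat w) := rfl
    rw [h]
    exact Nat.bit_ne_zero b ih

theorem natToWord_wordToNat (w : List Bool) : natToWord (wordToNat w) = w := by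
  induction w with
  | nil => simp [wordToNat, natToWord]
  | cons b w ih =>
    have h : wordToNat (b :: w) = Nat.bit b (wordToNat w) := rfl
    have hb : (Nat.bit b (wordToNat w)).bits = b :: (wordToNat w).bits :=
      Nat.bits_append_bit _ _ (fun h0 => absurd h0 (wordToNat_ne_zero w))
    have hne : (wordToNat w).bits ≠ [] := by
      intro h0
      have := Nat.size_eq_bits_len (wordToNat w)
      rw [h0] at this
      exact wordToNat_ne_zero w (Nat.size_eq_zero.1 this.symm)
    unfold natToWord at ih ⊢
    rw [h, hb, List.dropLast_cons_of_ne_nil hne, ih]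

/-- The tape content that represents a rational number `z`: first its sign (`1` for negative,
`0` otherwise), then the binary digits of its numerator and denominator in lowest terms, on two
parallel tracks, most significant digits first and aligned at the least significant digits; the
symbol `2 * x + y` stands for the digit `x` of the numerator above the digit `y` of the
denominator. -/
def ratTape (z : ℚ) : List ℕ :=
  let l := max z.num.natAbs.size z.den.size
  (if z < 0 then 1 else 0) ::
    (List.range l).map fun i =>
      2 * (z.num.natAbs.testBit (l - 1 - i)).toNat + (z.den.testBit (l - 1 - i)).toNat

/-- A machine state: registers, tape, the time used so far, and the oracle calls made so far. -/
structure MState where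
  reg : ℕ → ℕ
  tape : List ℕ
  time : ℕ
  queries : List (List Bool × ℚ)

/-- Charge `c` units of time. -/
def MState.tick (s : MState) (c : ℕ) : MState := { s with time := s.time + c }

/-- Store `v` in register `r`. -/
def MState.put (s : MState) (r v : ℕ) : MState := { s with reg := Function.update s.reg r v }

/-- A randomised oracle: on a word and an error tolerance it returns a random rational number,
independently of all other calls. -/
abbrev Oracle := List Bool → ℚ → PMF ℚ

/-- Run `m` and then `k`, where `none` stands for a computation that was cut off. -/
def andThen (m : PMF (Option MState)) (k : MState → PMF (Option MState)) :
    PMF (Option MState) :=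
  m.bind fun o => o.elim (PMF.pure none) k

/-- Iterate `body` while register `r` is non-zero, cut off after `fuel` iterations. -/
def iterLoop (r : ℕ) (body : MState → PMF (Option MState)) : ℕ → MState → PMF (Option MState)
  | 0, s =>
    if s.reg r = 0 then PMF.pure (some (s.tick (1 + (s.reg r).size))) else PMF.pure none
  | fuel + 1, s =>
    if s.reg r = 0 then PMF.pure (some (s.tick (1 + (s.reg r).size)))
    else andThen (body (s.tick (1 + (s.reg r).size))) (iterLoop r body fuel)

/-- The distribution of the final state of a program started in a given state, where every
execution of a loop is cut off after `fuel` iterations. As every iteration costs at least one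
unit of time, a computation that uses time at most `fuel` is never cut off. -/
def Prog.eval (O : Oracle) (fuel : ℕ) : Prog → MState → PMF (Option MState)
  | .skip, s => PMF.pure (some (s.tick 1))
  | .set r c, s => PMF.pure (some ((s.put r c).tick (1 + c.size)))
  | .arith o r a b, s =>
    PMF.pure (some
      ((s.put r (o.apply (s.reg a) (s.reg b))).tick (1 + (s.reg a).size + (s.reg b).size)))
  | .flip r, s =>
    (PMF.uniformOfFintype Bool).map fun b => some ((s.put r b.toNat).tick 1)
  | .read r, s =>
    let v := s.tape.headD 4
    PMF.pure (some ((({ s with tape := s.tape.tail } : MState).put r v).tick (1 + v.size)))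
  | .write r, s =>
    PMF.pure (some (({ s with tape := s.reg r :: s.tape } : MState).tick (1 + (s.reg r).size)))
  | .clear, s => PMF.pure (some (({ s with tape := [] } : MState).tick 1))
  | .oracle w n d, s =>
    let x := natToWord (s.reg w)
    let δ : ℚ := (s.reg n : ℚ) / (s.reg d : ℚ)
    (O x δ).map fun z => some
      (({ s with tape := ratTape z, queries := (x, δ) :: s.queries } : MState).tick
        (1 + (s.reg w).size + (s.reg n).size + (s.reg d).size))
  | .seq p p', s => andThen (p.eval O fuel s) (p'.eval O fuel)
  | .ite r p p', s =>
    if s.reg r = 0 then p'.eval O fuel (s.tick (1 + (s.reg r).size))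
    else p.eval O fuel (s.tick (1 + (s.reg r).size))
  | .loop r p, s => iterLoop r (p.eval O fuel) fuel s

/-- The initial state on input `(x, ε)`: the word `x` is in register `0`, the error tolerance `ε`
is on the tape, and all other registers are `0`. -/
def MState.initial (x : List Bool) (ε : ℚ) : MState where
  reg := Function.update (fun _ => 0) 0 (wordToNat x)
  tape := ratTape ε
  time := 0
  queries := []

/-- The rational number that a final state represents. -/
def MState.output (s : MState) : ℚ := ((s.reg 0 : ℚ) - (s.reg 1 : ℚ)) / (s.reg 2 : ℚ)

/-- The run of `p` on input `(x, ε)` with oracle `O`, with loops cut off after `fuel`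
iterations. -/
def Prog.run (p : Prog) (O : Oracle) (fuel : ℕ) (x : List Bool) (ε : ℚ) : PMF (Option MState) :=
  p.eval O fuel (MState.initial x ε)

/-! ### Approximate counting -/

/-- A computational problem: real numbers attached to instances, which are encoded as words. -/
structure CountingProblem where
  Inst : Type
  code : Inst → List Bool
  code_injective : Function.Injective code
  value : Inst → ℝ

/-- `z` approximates `v` within a factor `e ^ (± ε)`. -/
def Approx (ε : ℚ) (v : ℝ) (z : ℚ) : Prop :=
  Real.exp (-(ε : ℝ)) * v ≤ (z : ℝ) ∧ (z : ℝ) ≤ Real.exp (ε : ℝ) * v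

/-- The oracle meets the specification of a randomised approximation scheme for `g`. -/
def Oracle.IsRAS (O : Oracle) (g : CountingProblem) : Prop :=
  ∀ (J : g.Inst) (δ : ℚ), 0 < δ →
    3 / 4 ≤ (O (g.code J) δ).toOuterMeasure {z | Approx δ (g.value J) z}

/-- The event that a run is completed and its output approximates `v` within `e ^ (± ε)`. -/
def goodRuns (ε : ℚ) (v : ℝ) : Set (Option MState) :=
  {o | ∃ s, o = some s ∧ Approx ε v s.output}

/-- `f` has a fully polynomial randomised approximation scheme: a program without oracle that,
on input `(x, ε)`, always halts within time polynomial in `|x|` and `1 / ε` and is correct with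
probability at least `3 / 4`. -/
def HasFPRAS (f : CountingProblem) : Prop :=
  ∃ (A : Prog) (P : Polynomial ℕ), A.OracleFree ∧
    ∀ (O : Oracle) (I : f.Inst) (ε : ℚ), 0 < ε →
      let T := P.eval ((f.code I).length + ⌈ε⁻¹⌉₊)
      (∀ o ∈ (A.run O T (f.code I) ε).support, ∃ s, o = some s ∧ s.time ≤ T) ∧
      3 / 4 ≤ (A.run O T (f.code I) ε).toOuterMeasure (goodRuns ε (f.value I))

/-- `f` is AP-reducible to `g`: there is a randomised program with an oracle that, on input
`(x, ε)` and for every oracle, always halts within time polynomial in `|x|` and `1 / ε`, calls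
the oracle only on instances of `g` and with tolerances `0 < δ < 1` whose inverse is polynomially
bounded in `|x|` and `1 / ε`, and that meets the specification of a randomised approximation
scheme for `f` whenever the oracle meets the one for `g`. -/
def APReducible (f g : CountingProblem) : Prop :=
  ∃ (A : Prog) (P : Polynomial ℕ),
    ∀ (O : Oracle) (I : f.Inst) (ε : ℚ), 0 < ε → ε < 1 →
      let T := P.eval ((f.code I).length + ⌈ε⁻¹⌉₊)
      (∀ o ∈ (A.run O T (f.code I) ε).support, ∃ s, o = some s ∧ s.time ≤ T ∧
        ∀ c ∈ s.queries, (∃ J : g.Inst, g.code J = c.1) ∧ 0 < c.2 ∧ c.2 < 1 ∧ c.2⁻¹ ≤ (T : ℚ)) ∧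
      (O.IsRAS g →
        3 / 4 ≤ (A.run O T (f.code I) ε).toOuterMeasure (goodRuns ε (f.value I)))

/-- The problem that maps every input word to the number `z`. -/
def constProblem (z : ℝ) : CountingProblem where
  Inst := List Bool
  code := id
  code_injective := Function.injective_id
  value := fun _ => z

def EfficientlyApproximable (z : ℝ) : Prop := HasFPRAS (constProblem z)

/-! ### Encoding of combinatorial instances -/

/-- The word that lists natural numbers in unary. -/
def unaryCode : List ℕ → List Bool
  | [] => []
  | k :: l => List.replicate k true ++ false :: unaryCode l

theorem unaryCode_injective : Function.Injective unaryCode := by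
  intro l
  induction l with
  | nil =>
    intro l' h
    cases l' with
    | nil => rfl
    | cons k l' => cases k <;> simp [unaryCode, List.replicate_succ] at h
  | cons k l ih =>
    intro l' h
    cases l' with
    | nil => cases k <;> simp [unaryCode, List.replicate_succ] at h
    | cons k' l' =>
      induction k generalizing k' with
      | zero =>
        cases k' with
        | zero =>
          simp only [unaryCode, List.replicate_zero, List.nil_append, List.cons.injEq,
            true_and] at h
          rw [ih h]
        | succ k' => simp [unaryCode, List.replicate_succ] at h
      | succ k ihk =>
        cases k' with
        | zero => simp [unaryCode, List.replicate_succ] at h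
        | succ k' =>
          have h' : unaryCode (k :: l) = unaryCode (k' :: l') := by
            simpa [unaryCode, List.replicate_succ] using h
          have := ihk k' h'
          simp only [List.cons.injEq] at this ⊢
          exact ⟨by rw [this.1], this.2⟩

/-- The entries of a matrix, row by row. -/
def rowMajor {a b : ℕ} (M : Fin a → Fin b → ℕ) : List ℕ :=
  (List.ofFn fun i => List.ofFn fun j => M i j).flatten

theorem rowMajor_injective {a b : ℕ} :
    Function.Injective (rowMajor : (Fin a → Fin b → ℕ) → List ℕ) := by
  intro M M' h
  have h2 : (List.ofFn fun i => List.ofFn fun j => M i j) =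
      (List.ofFn fun i => List.ofFn fun j => M' i j) := by
    rw [List.eq_iff_flatten_eq]
    refine ⟨h, ?_⟩
    simp [List.map_ofFn, Function.comp_def]
  have h3 := List.ofFn_injective h2
  funext i
  exact List.ofFn_injective (congrFun h3 i)

/-! ### Independent sets in bipartite graphs -/

/-- A bipartite graph `(U, V, E)` with `U = Fin left` and `V = Fin right`. -/
structure BipGraph where
  left : ℕ
  right : ℕ
  adj : Fin left → Fin right → Bool

def BipGraph.toSimpleGraph (B : BipGraph) : SimpleGraph (Fin B.left ⊕ Fin B.right) :=
  SimpleGraph.fromRel fun x y => ∃ u v, x = Sum.inl u ∧ y = Sum.inr v ∧ B.adj u v = true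

def BipGraph.code (B : BipGraph) : List Bool :=
  unaryCode (B.left :: B.right :: rowMajor fun u v => (B.adj u v).toNat)

theorem BipGraph.code_injective : Function.Injective BipGraph.code := by
  rintro ⟨a, b, M⟩ ⟨a', b', M'⟩ h
  have h1 := unaryCode_injective h
  simp only [List.cons.injEq] at h1
  obtain ⟨rfl, rfl, h2⟩ := h1
  have h3 := rowMajor_injective h2
  congr 1
  funext u v
  have h4 := congrFun (congrFun h3 u) v
  revert h4
  cases M u v <;> cases M' u v <;> simp

/-- The problem of counting the independent sets of a bipartite graph. -/
def BIS : CountingProblem where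
  Inst := BipGraph
  code := BipGraph.code
  code_injective := BipGraph.code_injective
  value := fun B =>
    (Nat.card {I : Finset (Fin B.left ⊕ Fin B.right) // B.toSimpleGraph.IsIndepSet (I : Set _)} : ℝ)

/-! ### Hypergraphs, the Tutte polynomial and the Potts partition function -/

/-- A hypergraph with vertices `V` and hyperedges indexed by `E`: parallel hyperedges are allowed,
and every hyperedge is a multiset of vertices. -/
structure MultiHypergraph (V E : Type) where
  edge : E → Multiset V

/-- The graph in which two vertices are adjacent if they lie in a common hyperedge from `F`; its
connected components are those of the subhypergraph with hyperedges `F`. -/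
def MultiHypergraph.joined {V E : Type} (H : MultiHypergraph V E) (F : Finset E) :
    SimpleGraph V :=
  SimpleGraph.fromRel fun u v => ∃ f ∈ F, u ∈ H.edge f ∧ v ∈ H.edge f

/-- The number of connected components of the subhypergraph with hyperedges `F`. -/
def MultiHypergraph.kappa {V E : Type} (H : MultiHypergraph V E) (F : Finset E) : ℕ :=
  Nat.card (H.joined F).ConnectedComponent

/-- The multivariate Tutte polynomial. -/
def MultiHypergraph.tutte {V E : Type} [Fintype E] (H : MultiHypergraph V E) (q : ℝ)
    (γ : E → ℝ) : ℝ :=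
  ∑ F : Finset E, q ^ H.kappa F * ∏ f ∈ F, γ f

/-- The `q`-state Potts partition function. -/
def MultiHypergraph.potts {V E : Type} [Fintype V] [DecidableEq V] [Fintype E]
    (H : MultiHypergraph V E) (q : ℕ) (γ : E → ℝ) : ℝ :=
  ∑ σ : V → Fin q, ∏ f : E, (1 + γ f * if ((H.edge f).map σ).toFinset.card = 1 then 1 else 0)

/-- A uniform hypergraph as an instance of a computational problem: the vertices are
`Fin numV`, the hyperedges are indexed by `Fin numE`, all of them have the same size `size`
(counted with multiplicity), and `vert f` lists the vertices of the hyperedge `f`. -/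
structure UniformHypergraph where
  numV : ℕ
  numE : ℕ
  size : ℕ
  size_pos : 0 < size
  vert : Fin numE → Fin size → Fin numV

def UniformHypergraph.toMulti (H : UniformHypergraph) :
    MultiHypergraph (Fin H.numV) (Fin H.numE) where
  edge := fun f => Finset.univ.val.map (H.vert f)

def UniformHypergraph.code (H : UniformHypergraph) : List Bool :=
  unaryCode (H.numV :: H.numE :: H.size :: rowMajor fun f i => (H.vert f i : ℕ))

theorem UniformHypergraph.code_injective : Function.Injective UniformHypergraph.code := by
  rintro ⟨n, m, t, ht, e⟩ ⟨n', m', t', ht', e'⟩ h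
  have h1 := unaryCode_injective h
  simp only [List.cons.injEq] at h1
  obtain ⟨rfl, rfl, rfl, h2⟩ := h1
  have h3 := rowMajor_injective h2
  congr 1
  funext f i
  exact Fin.ext (congrFun (congrFun h3 f) i)

/-- Computing the Tutte polynomial of a uniform hypergraph with all weights equal to `γ`. -/
def UniformHyperTutte (q γ : ℝ) : CountingProblem where
  Inst := UniformHypergraph
  code := UniformHypergraph.code
  code_injective := UniformHypergraph.code_injective
  value := fun H => H.toMulti.tutte q fun _ => γ

/-- Computing the partition function of the Ising model (the two-state Potts model) on a uniform
hypergraph with all weights equal to `γ`. -/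
def UniformHyperIsing (γ : ℝ) : CountingProblem where
  Inst := UniformHypergraph
  code := UniformHypergraph.code
  code_injective := UniformHypergraph.code_injective
  value := fun H => H.toMulti.potts 2 fun _ => γ

end

noncomputable section

open scoped NNReal ENNReal

/-! ### The semantics of programs -/

/-! The core is an exact identity. Let B have n vertices. Replace every vertex of B by m vertices
and m hyperedges, and add one special vertex. A hyperedge of x contains the special vertex, all
copies of x and, if x ∈ U, all copies of the neighbours of x; repeating the special vertex makes all
hyperedges equally large. Since all hyperedges share the special vertex, a set F of hyperedges has
one component besides the isolated vertices that F misses (`BipGraph.gadget_kappa`). Hence κ depends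
only on the set A of those x that have a hyperedge in F. Summing over all F with the same A gives
the weight ((1+γ)^m - 1)^|A| (`sum_image_pow`), which for γ = q - 1 is x^|A| with x = q^m - 1.

So Z = q · Σ_A x^|A| (x+1)^{d(A)}, where d(A) counts the vertices y ∉ A that are not in V with a
neighbour in A ∩ U. For fixed A ∩ U, a vertex v ∈ V contributes 2x+1 if it has no neighbour in A and
x+1 otherwise. It contributes the same to the sum of x^|I| (x+1)^{n-|I|} over independent sets I
(`sum_undominated`). Therefore Z = q^{mn+1} Σ_I (1 - q^{-m})^|I| (`BipGraph.gadgetMulti_tutte`).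
With m = CKn and C(q-1) ≥ 4, Bernoulli's inequality puts Z / q^{mn+1} between e^{-1/(2K)} times the
number of independent sets and that number (`BipGraph.gadget_tutte_bounds`). The normalising power
q^{mn+1} is the Tutte value of mn+1 isolated vertices, so the oracle estimates it as well. The Ising
model with weight 1 is the case q = 2.

The algorithm picks K with 1/K < ε. For each of the two hypergraphs it takes the median of five
estimates with tolerance 1/(8K), and it outputs the quotient of the medians. Each median is good
with probability at least 459/512, both with probability above 3/4. An oracle may answer with
enormous numerators and denominators, so only their leading digits are read; enough of them preserve
the quotient up to another factor e^{±1/(8K)} (`approx_truncate`).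

The machine model is handled in two layers. `Run` describes deterministic code by a step count from
which time and growth of bit length follow; `Spec` adds worst-case time and a success probability
and composes by the law of total probability (`Spec.seq`). `CallSpec` abstracts one estimate, so
that `reductionProg_spec` is proved once. It is then instantiated by real oracle calls, which gives
the AP-reduction, and by a given FPRAS run on private registers, which gives the FPRAS for `BIS`. -/

theorem andThen_pure (s : MState) (k : MState → PMF (Option MState)) :
    andThen (PMF.pure (some s)) k = k s := by
  simp [andThen]

theorem mem_support_andThen {μ : PMF (Option MState)} {k : MState → PMF (Option MState)}
    {o : Option MState} :
    o ∈ (andThen μ k).support ↔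
      (none ∈ μ.support ∧ o = none) ∨ ∃ s, some s ∈ μ.support ∧ o ∈ (k s).support := by
  unfold andThen
  rw [PMF.mem_support_bind_iff]
  constructor
  · rintro ⟨o', h1, h2⟩
    cases o' with
    | none => left; exact ⟨h1, by simpa using h2⟩
    | some s => right; exact ⟨s, h1, h2⟩
  · rintro (⟨h1, rfl⟩ | ⟨s, h1, h2⟩)
    · exact ⟨none, h1, by simp⟩
    · exact ⟨some s, h1, h2⟩

/-- Two computations that agree on every state that is reached agree. -/
theorem andThen_congr {μ : PMF (Option MState)} {k k' : MState → PMF (Option MState)}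
    (h : ∀ s, some s ∈ μ.support → k s = k' s) : andThen μ k = andThen μ k' := by
  unfold andThen
  ext b
  rw [PMF.bind_apply, PMF.bind_apply]
  congr 1
  funext o
  by_cases ho : μ o = 0
  · simp [ho]
  · cases o with
    | none => rfl
    | some s => simp only [Option.elim]; rw [h s ((PMF.mem_support_iff _ _).2 ho)]

theorem andThen_map (μ : PMF (Option MState)) (e : MState → MState)
    (k : MState → PMF (Option MState)) :
    andThen (μ.map (Option.map e)) k = andThen μ (fun s => k (e s)) := by
  unfold andThen
  rw [PMF.bind_map]
  congr 1
  funext o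
  cases o <;> rfl

theorem map_andThen (μ : PMF (Option MState)) (e : MState → MState)
    (k : MState → PMF (Option MState)) :
    (andThen μ k).map (Option.map e) = andThen μ (fun s => (k s).map (Option.map e)) := by
  unfold andThen
  rw [PMF.map_bind]
  congr 1
  funext o
  cases o with
  | none => simp [PMF.pure_map]
  | some s => rfl

/-- The atomic commands of a program satisfy `C`. -/
def Prog.Atoms (C : Prog → Prop) : Prog → Prop
  | .seq p p' => p.Atoms C ∧ p'.Atoms C
  | .ite _ p p' => p.Atoms C ∧ p'.Atoms C
  | .loop _ p => p.Atoms C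
  | p => C p

/-- A preorder on states that is respected by the atomic commands of a program is respected by
the program. -/
theorem Prog.eval_rel {Rel : MState → MState → Prop}
    (htrans : ∀ s s' s'', Rel s s' → Rel s' s'' → Rel s s'')
    (htick : ∀ s r, Rel s (s.tick (1 + (s.reg r).size))) (p : Prog)
    (hp : p.Atoms fun a => ∀ O fuel s s', some s' ∈ (a.eval O fuel s).support → Rel s s') :
    ∀ O fuel s s', some s' ∈ (p.eval O fuel s).support → Rel s s' := by
  induction p with
  | seq p p' ih ih' =>
    intro O fuel s s' h
    rw [Prog.eval, mem_support_andThen] at h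
    rcases h with ⟨_, h⟩ | ⟨s1, h1, h2⟩
    · simp at h
    · exact htrans _ _ _ (ih hp.1 _ _ _ _ h1) (ih' hp.2 _ _ _ _ h2)
  | ite r p p' ih ih' =>
    intro O fuel s s' h
    rw [Prog.eval] at h
    split_ifs at h with h0
    · exact htrans _ _ _ (htick s r) (ih' hp.2 _ _ _ _ h)
    · exact htrans _ _ _ (htick s r) (ih hp.1 _ _ _ _ h)
  | loop r p ih =>
    intro O fuel s s' h
    rw [Prog.eval] at h
    have key : ∀ k s, some s' ∈ (iterLoop r (p.eval O fuel) k s).support → Rel s s' := by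
      intro k
      induction k with
      | zero =>
        intro s h
        rw [iterLoop] at h
        split_ifs at h with h0
        · simp only [PMF.support_pure, Set.mem_singleton_iff, Option.some.injEq] at h
          rw [h]; exact htick s r
        · simp at h
      | succ k ihk =>
        intro s h
        rw [iterLoop] at h
        split_ifs at h with h0
        · simp only [PMF.support_pure, Set.mem_singleton_iff, Option.some.injEq] at h
          rw [h]; exact htick s r
        · rw [mem_support_andThen] at h
          rcases h with ⟨_, h⟩ | ⟨s1, h1, h2⟩
          · simp at h
          · exact htrans _ _ _ (htick s r) (htrans _ _ _ (ih hp _ _ _ _ h1) (ihk _ h2))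
    exact key _ _ h
  | _ => exact hp

/-- All registers and all symbols on the tape have at most `S` bits. -/
def Bdd (S : ℕ) (reg : ℕ → ℕ) (tape : List ℕ) : Prop :=
  (∀ r, (reg r).size ≤ S) ∧ ∀ x ∈ tape, x.size ≤ S

theorem Bdd.mono {S S' : ℕ} {reg : ℕ → ℕ} {tape : List ℕ} (h : Bdd S reg tape) (hS : S ≤ S') :
    Bdd S' reg tape :=
  ⟨fun r => (h.1 r).trans hS, fun x hx => (h.2 x hx).trans hS⟩

theorem Bdd.update {S : ℕ} {reg : ℕ → ℕ} {tape : List ℕ} (h : Bdd S reg tape) (r : ℕ) {v : ℕ}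
    (hv : v.size ≤ S) : Bdd S (Function.update reg r v) tape := by
  refine ⟨fun r' => ?_, h.2⟩
  by_cases hr : r' = r
  · subst hr; simpa using hv
  · simpa [Function.update_of_ne hr] using h.1 r'

theorem Bdd.nil {S : ℕ} {reg : ℕ → ℕ} {tape : List ℕ} (h : Bdd S reg tape) : Bdd S reg [] :=
  ⟨h.1, by simp⟩

/-! ### Bit lengths of numbers and of machine contents -/

theorem size_add_le (a b : ℕ) : (a + b).size ≤ max a.size b.size + 1 := by
  rw [Nat.size_le, pow_succ]
  have h1 : a < 2 ^ max a.size b.size := Nat.size_le.1 (le_max_left _ _)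
  have h2 : b < 2 ^ max a.size b.size := Nat.size_le.1 (le_max_right _ _)
  omega

theorem size_mul_le (a b : ℕ) : (a * b).size ≤ a.size + b.size := by
  rw [Nat.size_le, pow_add]
  exact Nat.mul_lt_mul'' (Nat.lt_size_self a) (Nat.lt_size_self b)

theorem ArithOp.size_apply_le (o : ArithOp) (a b : ℕ) :
    (o.apply a b).size ≤ 1 + a.size + b.size := by
  cases o with
  | add => exact (size_add_le a b).trans (by omega)
  | sub => exact (Nat.size_le_size (Nat.sub_le a b)).trans (by omega)
  | mul => exact (size_mul_le a b).trans (by omega)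
  | div => exact (Nat.size_le_size (Nat.div_le_self a b)).trans (by omega)
  | mod => exact (Nat.size_le_size (Nat.mod_le a b)).trans (by omega)

theorem ratTape_le {z : ℚ} {x : ℕ} (hx : x ∈ ratTape z) : x ≤ 3 := by
  unfold ratTape at hx
  simp only [List.mem_cons, List.mem_map] at hx
  rcases hx with rfl | ⟨i, -, rfl⟩
  · split_ifs <;> simp
  · have h1 := Bool.toNat_le (z.num.natAbs.testBit (max z.num.natAbs.size z.den.size - 1 - i))
    have h2 := Bool.toNat_le (z.den.testBit (max z.num.natAbs.size z.den.size - 1 - i))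
    omega

theorem size_le_two_of_mem_ratTape {z : ℚ} {x : ℕ} (hx : x ∈ ratTape z) : x.size ≤ 2 :=
  Nat.size_le.2 (lt_of_le_of_lt (ratTape_le hx) (by norm_num))

/-- In time `t` the contents of registers and tape grow by at most `t` bits. -/
theorem Prog.eval_size (p : Prog) {O : Oracle} {fuel : ℕ} {s s' : MState}
    (h : some s' ∈ (p.eval O fuel s).support) :
    s.time ≤ s'.time ∧ ∀ S, 2 ≤ S → Bdd S s.reg s.tape →
      Bdd (S + (s'.time - s.time)) s'.reg s'.tape := by
  refine Prog.eval_rel (Rel := fun s s' => s.time ≤ s'.time ∧ ∀ S, 2 ≤ S → Bdd S s.reg s.tape →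
      Bdd (S + (s'.time - s.time)) s'.reg s'.tape)
    ?_ (fun s r => ⟨by simp [MState.tick], fun S _ h => h.mono (by omega)⟩) p ?_ O fuel s s' h
  · rintro s s' s'' ⟨h1, h2⟩ ⟨h3, h4⟩
    refine ⟨h1.trans h3, fun S hS h => (h4 _ (by omega) (h2 S hS h)).mono (by omega)⟩
  clear h
  induction p with
  | seq p p' ih ih' => exact ⟨ih, ih'⟩
  | ite r p p' ih ih' => exact ⟨ih, ih'⟩
  | loop r p ih => exact ih
  | flip r =>
    intro O fuel s s' h
    simp only [Prog.eval, PMF.support_map, Set.mem_image] at h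
    obtain ⟨b, -, h⟩ := h
    simp only [Option.some.injEq] at h
    rw [← h]
    refine ⟨by simp [MState.tick, MState.put], fun S hS h => ?_⟩
    refine Bdd.update (h.mono (by omega)) _ ?_
    cases b <;> simp; omega
  | oracle w n d =>
    intro O fuel s s' h
    simp only [Prog.eval, PMF.support_map, Set.mem_image] at h
    obtain ⟨b, -, h⟩ := h
    simp only [Option.some.injEq] at h
    rw [← h]
    refine ⟨by simp [MState.tick], fun S hS h => ?_⟩
    exact ⟨fun r => (h.1 r).trans (by omega),
      fun x hx => (size_le_two_of_mem_ratTape hx).trans (by omega)⟩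
  | skip =>
    intro O fuel s s' h
    simp only [Prog.eval, PMF.support_pure, Set.mem_singleton_iff, Option.some.injEq] at h
    rw [h]
    exact ⟨by simp [MState.tick], fun S hS h => h.mono (by omega)⟩
  | set r c =>
    intro O fuel s s' h
    simp only [Prog.eval, PMF.support_pure, Set.mem_singleton_iff, Option.some.injEq] at h
    rw [h]
    refine ⟨by simp [MState.tick, MState.put], fun S hS h => ?_⟩
    exact Bdd.update (h.mono (by omega)) _ (by simp [MState.tick, MState.put]; omega)
  | arith o r a b =>
    intro O fuel s s' h
    simp only [Prog.eval, PMF.support_pure, Set.mem_singleton_iff, Option.some.injEq] at h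
    rw [h]
    refine ⟨by simp only [MState.tick, MState.put]; omega, fun S hS h => ?_⟩
    refine Bdd.update (h.mono (by omega)) _ ?_
    have := o.size_apply_le (s.reg a) (s.reg b)
    simp [MState.tick, MState.put]; omega
  | read r =>
    intro O fuel s s' h
    simp only [Prog.eval, PMF.support_pure, Set.mem_singleton_iff, Option.some.injEq] at h
    rw [h]
    refine ⟨by simp [MState.tick, MState.put], fun S hS h => ?_⟩
    refine Bdd.update ⟨fun r => (h.1 r).trans (by omega),
      fun x hx => (h.2 x (List.mem_of_mem_tail hx)).trans (by omega)⟩ _ ?_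
    simp [MState.tick, MState.put]; omega
  | write r =>
    intro O fuel s s' h
    simp only [Prog.eval, PMF.support_pure, Set.mem_singleton_iff, Option.some.injEq] at h
    rw [h]
    refine ⟨by simp [MState.tick], fun S hS h => ⟨fun r => (h.1 r).trans (by omega), ?_⟩⟩
    intro x hx
    simp only [MState.tick, List.mem_cons] at hx
    rcases hx with rfl | hx
    · exact (h.1 r).trans (by omega)
    · exact (h.2 x hx).trans (by omega)
  | clear =>
    intro O fuel s s' h
    simp only [Prog.eval, PMF.support_pure, Set.mem_singleton_iff, Option.some.injEq] at h
    rw [h]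
    exact ⟨by simp [MState.tick], fun S hS h => (h.mono (by omega)).nil⟩

/-- A computation that is not cut off does not change with more fuel. -/
theorem Prog.eval_fuel_mono (O : Oracle) {fuel fuel' : ℕ} (hf : fuel ≤ fuel') (p : Prog) :
    ∀ s, none ∉ (p.eval O fuel s).support → p.eval O fuel' s = p.eval O fuel s := by
  induction p with
  | seq p p' ih ih' =>
    intro s h
    rw [Prog.eval, mem_support_andThen] at h
    push Not at h
    rw [Prog.eval, Prog.eval, ih s (fun hn => h.1 hn rfl)]
    exact andThen_congr fun s1 h1 => ih' s1 (h.2 s1 h1)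
  | ite r p p' ih ih' =>
    intro s h
    rw [Prog.eval] at h ⊢
    rw [Prog.eval]
    split_ifs at h ⊢ with h0
    · exact ih' _ h
    · exact ih _ h
  | loop r p ih =>
    intro s h
    rw [Prog.eval] at h ⊢
    rw [Prog.eval]
    have key : ∀ k k', k ≤ k' → ∀ s, none ∉ (iterLoop r (p.eval O fuel) k s).support →
        iterLoop r (p.eval O fuel') k' s = iterLoop r (p.eval O fuel) k s := by
      intro k
      induction k with
      | zero =>
        intro k' hk s h
        rw [iterLoop] at h ⊢
        split_ifs at h ⊢ with h0
        · cases k' <;> simp [iterLoop, h0]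
        · simp at h
      | succ k ihk =>
        intro k' hk s h
        obtain ⟨k', rfl⟩ : ∃ j, k' = j + 1 := ⟨k' - 1, by omega⟩
        rw [iterLoop] at h ⊢
        rw [iterLoop]
        split_ifs at h ⊢ with h0
        · rfl
        · rw [mem_support_andThen] at h
          push Not at h
          rw [ih _ (fun hn => h.1 hn rfl)]
          exact andThen_congr fun s1 h1 => ihk k' (by omega) s1 (h.2 s1 h1)
    exact key _ _ hf s h
  | _ => intro s h; rfl

/-! ### Renaming registers -/

/-- The program with all registers renamed. -/
def Prog.rename (ρ : ℕ → ℕ) : Prog → Prog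
  | .skip => .skip
  | .set r c => .set (ρ r) c
  | .arith o r a b => .arith o (ρ r) (ρ a) (ρ b)
  | .flip r => .flip (ρ r)
  | .read r => .read (ρ r)
  | .write r => .write (ρ r)
  | .clear => .clear
  | .oracle w n d => .oracle (ρ w) (ρ n) (ρ d)
  | .seq p p' => .seq (p.rename ρ) (p'.rename ρ)
  | .ite r p p' => .ite (ρ r) (p.rename ρ) (p'.rename ρ)
  | .loop r p => .loop (ρ r) (p.rename ρ)

/-- The state `t` of a subroutine that works on the renamed registers, within the state `s` of
the caller. -/
def MState.embed (ρ : ℕ → ℕ) (s t : MState) : MState where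
  reg := Function.extend ρ t.reg s.reg
  tape := t.tape
  time := s.time + t.time
  queries := t.queries ++ s.queries

theorem MState.embed_reg {ρ : ℕ → ℕ} (hρ : Function.Injective ρ) (s t : MState) (r : ℕ) :
    (s.embed ρ t).reg (ρ r) = t.reg r := hρ.extend_apply _ _ _

theorem MState.embed_tick (ρ : ℕ → ℕ) (s t : MState) (c : ℕ) :
    (s.embed ρ t).tick c = s.embed ρ (t.tick c) := by
  simp [MState.embed, MState.tick, Nat.add_assoc]

theorem extend_update {ρ : ℕ → ℕ} (hρ : Function.Injective ρ) (f g : ℕ → ℕ) (r v : ℕ) :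
    Function.update (Function.extend ρ f g) (ρ r) v =
      Function.extend ρ (Function.update f r v) g := by
  funext x
  by_cases hx : ∃ y, ρ y = x
  · obtain ⟨y, rfl⟩ := hx
    rw [hρ.extend_apply]
    by_cases hy : y = r
    · subst hy; simp
    · rw [Function.update_of_ne hy, Function.update_of_ne (fun h => hy (hρ h)), hρ.extend_apply]
  · rw [Function.extend_apply' _ _ _ hx, Function.update_of_ne, Function.extend_apply' _ _ _ hx]
    exact fun h => hx ⟨r, h.symm⟩

theorem MState.embed_put {ρ : ℕ → ℕ} (hρ : Function.Injective ρ) (s t : MState) (r v : ℕ) :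
    (s.embed ρ t).put (ρ r) v = s.embed ρ (t.put r v) := by
  simp [MState.embed, MState.put, extend_update hρ]

/-- Injectivity means that distinct registers stay distinct, so every command sees the same values
as before. This lets an unknown program run as a subroutine without touching the registers of its
caller. -/
theorem Prog.eval_rename {ρ : ℕ → ℕ} (hρ : Function.Injective ρ) (O : Oracle) (fuel : ℕ)
    (s : MState) (p : Prog) : ∀ t,
    (p.rename ρ).eval O fuel (s.embed ρ t) =
      (p.eval O fuel t).map (Option.map (s.embed ρ)) := by
  induction p with
  | seq p p' ih ih' =>
    intro t
    rw [Prog.rename, Prog.eval, Prog.eval, map_andThen, ih, andThen_map]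
    exact andThen_congr fun s1 _ => ih' s1
  | ite r p p' ih ih' =>
    intro t
    rw [Prog.rename, Prog.eval, Prog.eval, MState.embed_reg hρ]
    split_ifs with h0
    · rw [MState.embed_tick, ih']
    · rw [MState.embed_tick, ih]
  | loop r p ih =>
    intro t
    rw [Prog.rename, Prog.eval, Prog.eval]
    have key : ∀ k t, iterLoop (ρ r) ((p.rename ρ).eval O fuel) k (s.embed ρ t) =
        (iterLoop r (p.eval O fuel) k t).map (Option.map (s.embed ρ)) := by
      intro k
      induction k with
      | zero =>
        intro t
        rw [iterLoop, iterLoop, MState.embed_reg hρ]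
        split_ifs with h0
        · simp [PMF.pure_map, MState.embed_tick]
        · simp [PMF.pure_map]
      | succ k ihk =>
        intro t
        rw [iterLoop, iterLoop, MState.embed_reg hρ]
        split_ifs with h0
        · simp [PMF.pure_map, MState.embed_tick]
        · rw [map_andThen, MState.embed_tick, ih, andThen_map]
          exact andThen_congr fun s1 _ => ihk s1
    exact key _ _
  | flip r =>
    intro t
    rw [Prog.rename, Prog.eval, Prog.eval, PMF.map_comp]
    congr 1
    funext b
    simp [MState.embed_put hρ, MState.embed_tick]
  | oracle w n d =>
    intro t
    rw [Prog.rename, Prog.eval, Prog.eval]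
    simp only [MState.embed_reg hρ]
    rw [PMF.map_comp]
    congr 1
    funext z
    simp [MState.embed, MState.tick, Nat.add_assoc]
  | arith o r a b =>
    intro t
    simp [Prog.rename, Prog.eval, PMF.pure_map, MState.embed_reg hρ, MState.embed_put hρ,
      MState.embed_tick]
  | read r =>
    intro t
    simp only [Prog.rename, Prog.eval, PMF.pure_map, Option.map]
    rw [show ({ s.embed ρ t with tape := (s.embed ρ t).tape.tail } : MState) =
      s.embed ρ { t with tape := t.tape.tail } from rfl, MState.embed_put hρ, MState.embed_tick]
    rfl
  | write r =>
    intro t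
    simp only [Prog.rename, Prog.eval, PMF.pure_map, Option.map, MState.embed_reg hρ]
    rw [← MState.embed_tick]
    rfl
  | clear =>
    intro t
    simp only [Prog.rename, Prog.eval, PMF.pure_map, Option.map]
    rw [← MState.embed_tick]
    rfl
  | set r c =>
    intro t
    simp [Prog.rename, Prog.eval, PMF.pure_map, MState.embed_put hρ, MState.embed_tick]
  | skip =>
    intro t
    simp [Prog.rename, Prog.eval, PMF.pure_map, MState.embed_tick]

/-! ### Deterministic computations -/

/-- From the given registers and tape, `p` deterministically reaches registers and a tape that
satisfy `Q`, without changing the list of oracle calls, in `k` steps: on numbers of `S` bits it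
takes time at most `k * (1 + 2 * (S + k))` and produces numbers of at most `S + k` bits. -/
def Run (p : Prog) (reg : ℕ → ℕ) (tape : List ℕ) (k : ℕ) (Q : (ℕ → ℕ) → List ℕ → Prop) : Prop :=
  ∃ reg' tape', Q reg' tape' ∧ ∀ t q, ∃ t',
    (∀ O fuel, k ≤ fuel → p.eval O fuel ⟨reg, tape, t, q⟩ =
      PMF.pure (some ⟨reg', tape', t', q⟩)) ∧
    ∀ S, 3 ≤ S → Bdd S reg tape → Bdd (S + k) reg' tape' ∧ t' ≤ t + k * (1 + 2 * (S + k))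

namespace Run

variable {p p' : Prog} {reg : ℕ → ℕ} {tape : List ℕ} {k k' : ℕ} {Q Q' : (ℕ → ℕ) → List ℕ → Prop}

theorem imp (h : Run p reg tape k Q) (hQ : ∀ reg' tape', Q reg' tape' → Q' reg' tape') :
    Run p reg tape k Q' := by
  obtain ⟨r, t, h1, h2⟩ := h
  exact ⟨r, t, hQ _ _ h1, h2⟩

theorem mono (h : Run p reg tape k Q) (hk : k ≤ k') : Run p reg tape k' Q := by
  obtain ⟨r, t, h1, h2⟩ := h
  refine ⟨r, t, h1, fun t0 q => ?_⟩
  obtain ⟨t', h3, h4⟩ := h2 t0 q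
  refine ⟨t', fun O fuel hf => h3 O fuel (hk.trans hf), fun S hS hb => ?_⟩
  obtain ⟨h5, h6⟩ := h4 S hS hb
  refine ⟨h5.mono (by omega), h6.trans ?_⟩
  gcongr

theorem seq (h : Run p reg tape k fun reg' tape' => Run p' reg' tape' k' Q) :
    Run (.seq p p') reg tape (k + k') Q := by
  obtain ⟨r, t, ⟨r', t', h1, h2⟩, h3⟩ := h
  refine ⟨r', t', h1, fun t0 q => ?_⟩
  obtain ⟨t1, h4, h5⟩ := h3 t0 q
  obtain ⟨t2, h6, h7⟩ := h2 t1 q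
  refine ⟨t2, fun O fuel hf => ?_, fun S hS hb => ?_⟩
  · rw [Prog.eval, h4 O fuel (by omega), andThen_pure, h6 O fuel (by omega)]
  · obtain ⟨h8, h9⟩ := h5 S hS hb
    obtain ⟨h10, h11⟩ := h7 (S + k) (by omega) h8
    refine ⟨h10.mono (by omega), h11.trans ((Nat.add_le_add_right h9 _).trans ?_)⟩
    have e1 : k * (1 + 2 * (S + k)) ≤ k * (1 + 2 * (S + (k + k'))) := by gcongr; omega
    have e2 : k' * (1 + 2 * (S + k + k')) = k' * (1 + 2 * (S + (k + k'))) := by ring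
    rw [add_mul]
    omega

theorem skip (h : Q reg tape) : Run .skip reg tape 1 Q := by
  refine ⟨reg, tape, h, fun t q => ⟨t + 1, fun O fuel _ => rfl, fun S hS hb => ⟨hb.mono (by omega), ?_⟩⟩⟩
  omega

theorem set {r c : ℕ} (h : Q (Function.update reg r c) tape) :
    Run (.set r c) reg tape (1 + c.size) Q := by
  refine ⟨_, _, h, fun t q => ⟨_, fun O fuel _ => rfl, fun S hS hb => ⟨?_, ?_⟩⟩⟩
  · exact (hb.mono (by omega)).update _ (by omega)
  · simp only [MState.put]
    nlinarith

/-- Without multiplication a result is at most one bit longer than the operands, so a single step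
pays for it. -/
theorem arith {o : ArithOp} {r a b : ℕ} (ho : o ≠ .mul)
    (h : Q (Function.update reg r (o.apply (reg a) (reg b))) tape) :
    Run (.arith o r a b) reg tape 1 Q := by
  refine ⟨_, _, h, fun t q => ⟨_, fun O fuel _ => rfl, fun S hS hb => ⟨?_, ?_⟩⟩⟩
  · refine (hb.mono (by omega)).update _ ?_
    have h1 := hb.1 a
    have h2 := hb.1 b
    cases o with
    | add => exact (size_add_le _ _).trans (by omega)
    | sub => exact (Nat.size_le_size (Nat.sub_le _ _)).trans (by omega)
    | mul => exact absurd rfl ho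
    | div => exact (Nat.size_le_size (Nat.div_le_self _ _)).trans (by omega)
    | mod => exact (Nat.size_le_size (Nat.mod_le _ _)).trans (by omega)
  · have h1 := hb.1 a
    have h2 := hb.1 b
    simp only [MState.put]
    omega

/-- A product can double the bit length, which would break the additive growth `S + k`; charging the
length of the product restores it. -/
theorem mul {r a b : ℕ} (h : Q (Function.update reg r (reg a * reg b)) tape) :
    Run (.arith .mul r a b) reg tape (1 + (reg a * reg b).size) Q := by
  refine ⟨_, _, h, fun t q => ⟨_, fun O fuel _ => rfl, fun S hS hb => ⟨?_, ?_⟩⟩⟩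
  · exact (hb.mono (by omega)).update _ (by omega)
  · have h1 := hb.1 a
    have h2 := hb.1 b
    simp only [MState.put]
    nlinarith

theorem read {r : ℕ} (h : Q (Function.update reg r (tape.headD 4)) tape.tail) :
    Run (.read r) reg tape 1 Q := by
  refine ⟨_, _, h, fun t q => ⟨_, fun O fuel _ => rfl, fun S hS hb => ?_⟩⟩
  have h1 : (tape.headD 4).size ≤ S := by
    cases tape with
    | nil => simp only [List.headD_nil]; exact le_trans (by decide) hS
    | cons x l => exact hb.2 x (by simp)
  refine ⟨?_, ?_⟩
  · refine Bdd.update ⟨fun r => (hb.1 r).trans (by omega),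
      fun x hx => (hb.2 x (List.mem_of_mem_tail hx)).trans (by omega)⟩ _ (by omega)
  · simp only [MState.put]
    omega

theorem write {r : ℕ} (h : Q reg (reg r :: tape)) : Run (.write r) reg tape 1 Q := by
  refine ⟨_, _, h, fun t q => ⟨_, fun O fuel _ => rfl, fun S hS hb => ?_⟩⟩
  have h1 := hb.1 r
  refine ⟨⟨fun r => (hb.1 r).trans (by omega), fun x hx => ?_⟩, by simp only; omega⟩
  simp only [List.mem_cons] at hx
  rcases hx with rfl | hx
  · omega
  · exact (hb.2 x hx).trans (by omega)

theorem clear (h : Q reg []) : Run .clear reg tape 1 Q := by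
  refine ⟨_, _, h, fun t q => ⟨_, fun O fuel _ => rfl, fun S hS hb => ⟨(hb.mono (by omega)).nil, ?_⟩⟩⟩
  simp only
  omega

theorem ite {r : ℕ} (h1 : reg r ≠ 0 → Run p reg tape k Q) (h2 : reg r = 0 → Run p' reg tape k Q) :
    Run (.ite r p p') reg tape (k + 1) Q := by
  have key : ∀ p'' : Prog, (∀ O fuel t q, (Prog.ite r p p').eval O fuel ⟨reg, tape, t, q⟩ =
      p''.eval O fuel ⟨reg, tape, t + (1 + (reg r).size), q⟩) → Run p'' reg tape k Q →
      Run (.ite r p p') reg tape (k + 1) Q := by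
    rintro p'' he ⟨r', t', h3, h4⟩
    refine ⟨r', t', h3, fun t q => ?_⟩
    obtain ⟨t2, h5, h6⟩ := h4 (t + (1 + (reg r).size)) q
    refine ⟨t2, fun O fuel hf => ?_, fun S hS hb => ?_⟩
    · rw [he, h5 O fuel (by omega)]
    · obtain ⟨h7, h8⟩ := h6 S hS hb
      have h9 := hb.1 r
      refine ⟨h7.mono (by omega), h8.trans ?_⟩
      have e1 : k * (1 + 2 * (S + k)) ≤ k * (1 + 2 * (S + (k + 1))) := by gcongr; omega
      rw [add_mul]
      omega
  by_cases h0 : reg r = 0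
  · exact key p' (fun O fuel t q => by simp [Prog.eval, h0, MState.tick]) (h2 h0)
  · exact key p (fun O fuel t q => by simp [Prog.eval, h0, MState.tick]) (h1 h0)

/-- The first argument of `Inv` is the number of iterations still to come. The final registers and
tape are found by induction before the time, the oracle calls, the oracle and the fuel are
introduced, as they must not depend on these. -/
theorem loop {r n : ℕ} (Inv : ℕ → (ℕ → ℕ) → List ℕ → Prop)
    (hstep : ∀ j reg tape, j < n → Inv (j + 1) reg tape → reg r ≠ 0 ∧ Run p reg tape k (Inv j))
    (hend : ∀ reg tape, Inv 0 reg tape → reg r = 0 ∧ Q reg tape) (h0 : Inv n reg tape) :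
    Run (.loop r p) reg tape (n * (k + 1) + 1) Q := by
  have key : ∀ n' ≤ n, ∀ reg tape, Inv n' reg tape → ∃ reg' tape', Q reg' tape' ∧ ∀ t q, ∃ t',
      (∀ O fuel f, k ≤ fuel → n' ≤ f → iterLoop r (p.eval O fuel) f ⟨reg, tape, t, q⟩ =
        PMF.pure (some ⟨reg', tape', t', q⟩)) ∧
      ∀ S, 3 ≤ S → Bdd S reg tape → Bdd (S + (n' * (k + 1) + 1)) reg' tape' ∧
        t' ≤ t + (n' * (k + 1) + 1) * (1 + 2 * (S + (n' * (k + 1) + 1))) := by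
    intro n'
    induction n' with
    | zero =>
      intro _ reg tape hI
      obtain ⟨h1, h2⟩ := hend _ _ hI
      refine ⟨reg, tape, h2, fun t q => ⟨t + (1 + (reg r).size), fun O fuel f _ _ => ?_,
        fun S hS hb => ⟨hb.mono (by omega), ?_⟩⟩⟩
      · cases f <;> simp [iterLoop, h1, MState.tick]
      · have := hb.1 r
        omega
    | succ j ih =>
      intro hj reg tape hI
      obtain ⟨h1, r1, t1, h2, h3⟩ := hstep j _ _ (by omega) hI
      obtain ⟨r2, t2, h4, h5⟩ := ih (by omega) _ _ h2
      refine ⟨r2, t2, h4, fun t q => ?_⟩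
      obtain ⟨t3, h6, h7⟩ := h3 (t + (1 + (reg r).size)) q
      obtain ⟨t4, h8, h9⟩ := h5 t3 q
      refine ⟨t4, fun O fuel f hf hf' => ?_, fun S hS hb => ?_⟩
      · obtain ⟨f, rfl⟩ : ∃ f', f = f' + 1 := ⟨f - 1, by omega⟩
        rw [iterLoop, if_neg h1]
        simp only [MState.tick]
        rw [h6 O fuel hf, andThen_pure, h8 O fuel f hf (by omega)]
      · obtain ⟨h10, h11⟩ := h7 S hS hb
        obtain ⟨h12, h13⟩ := h9 (S + k) (by omega) h10
        have h14 := hb.1 r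
        have e0 : (j + 1) * (k + 1) + 1 = (j * (k + 1) + 1) + k + 1 := by ring
        rw [e0]
        generalize j * (k + 1) + 1 = m at *
        refine ⟨h12.mono (by omega), h13.trans ?_⟩
        have e1 : k * (1 + 2 * (S + k)) ≤ k * (1 + 2 * (S + (m + k + 1))) := by gcongr; omega
        have e2 : m * (1 + 2 * (S + k + m)) ≤ m * (1 + 2 * (S + (m + k + 1))) := by
          gcongr 2; omega
        rw [add_mul, add_mul]
        omega
  obtain ⟨r', t', h1, h2⟩ := key n le_rfl reg tape h0
  refine ⟨r', t', h1, fun t q => ?_⟩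
  obtain ⟨t2, h3, h4⟩ := h2 t q
  refine ⟨t2, fun O fuel hf => ?_, h4⟩
  rw [Prog.eval]
  -- Without iterations the fuel may be smaller than `k`, but then the body is never run and its
  -- fuel is irrelevant.
  rcases Nat.eq_zero_or_pos n with hn | hn
  · subst hn
    obtain ⟨h5, -⟩ := hend _ _ h0
    have h6 := h3 O (k + fuel) fuel (by omega) (by omega)
    rw [← h6]
    cases fuel <;> simp [iterLoop, h5]
  · refine h3 O fuel fuel ?_ ?_
    · nlinarith
    · nlinarith

theorem seq_arith {o : ArithOp} {r a b : ℕ} (ho : o ≠ .mul)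
    (h : Run p (Function.update reg r (o.apply (reg a) (reg b))) tape k Q) :
    Run (.seq (.arith o r a b) p) reg tape (k + 1) Q := by
  rw [add_comm]; exact seq (arith ho h)

theorem seq_add {r a b : ℕ} (h : Run p (Function.update reg r (reg a + reg b)) tape k Q) :
    Run (.seq (.arith .add r a b) p) reg tape (k + 1) Q := seq_arith (by simp) h

theorem seq_sub {r a b : ℕ} (h : Run p (Function.update reg r (reg a - reg b)) tape k Q) :
    Run (.seq (.arith .sub r a b) p) reg tape (k + 1) Q := seq_arith (by simp) h

theorem seq_div {r a b : ℕ} (h : Run p (Function.update reg r (reg a / reg b)) tape k Q) :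
    Run (.seq (.arith .div r a b) p) reg tape (k + 1) Q := seq_arith (by simp) h

theorem seq_mod {r a b : ℕ} (h : Run p (Function.update reg r (reg a % reg b)) tape k Q) :
    Run (.seq (.arith .mod r a b) p) reg tape (k + 1) Q := seq_arith (by simp) h

theorem seq_mul {r a b m : ℕ} (hm : (reg a * reg b).size ≤ m)
    (h : Run p (Function.update reg r (reg a * reg b)) tape k Q) :
    Run (.seq (.arith .mul r a b) p) reg tape (k + (1 + m)) Q := by
  rw [add_comm]; exact seq ((mul h).mono (by omega))

theorem seq_set {r c : ℕ} (h : Run p (Function.update reg r c) tape k Q) :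
    Run (.seq (.set r c) p) reg tape (k + (1 + c.size)) Q := by
  rw [add_comm]; exact seq (set h)

/-- Constants below 16 have at most four bits, so the cost 5 is uniform. -/
theorem seq_set_small {r c : ℕ} (hc : c < 16) (h : Run p (Function.update reg r c) tape k Q) :
    Run (.seq (.set r c) p) reg tape (k + 5) Q :=
  (seq_set h).mono (by have := Nat.size_le.2 (show c < 2 ^ 4 from hc); omega)

theorem seq_read {r : ℕ} (h : Run p (Function.update reg r (tape.headD 4)) tape.tail k Q) :
    Run (.seq (.read r) p) reg tape (k + 1) Q := by
  rw [add_comm]; exact seq (read h)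

theorem seq_write {r : ℕ} (h : Run p reg (reg r :: tape) k Q) :
    Run (.seq (.write r) p) reg tape (k + 1) Q := by
  rw [add_comm]; exact seq (write h)

theorem seq_clear (h : Run p reg [] k Q) : Run (.seq .clear p) reg tape (k + 1) Q := by
  rw [add_comm]; exact seq (clear h)

end Run

/-! ### Randomised computations -/

/-- Started in state `s`, the program `p` always halts within time `t` in a state that satisfies
`R`, and provided that `good` holds it reaches a state with `G` with probability at least `c`. -/
def Spec (O : Oracle) (good : Prop) (p : Prog) (s : MState) (t : ℕ) (R G : MState → Prop)
    (c : ℝ≥0) : Prop :=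
  ∀ fuel, t ≤ fuel →
    (∀ o ∈ (p.eval O fuel s).support, ∃ s', o = some s' ∧ s'.time ≤ s.time + t ∧ R s') ∧
    (good → (c : ℝ≥0∞) ≤ (p.eval O fuel s).toOuterMeasure {o | ∃ s', o = some s' ∧ G s'})

namespace Spec

variable {O : Oracle} {good : Prop} {p p' : Prog} {s : MState} {t t' : ℕ}
  {R R' G G' : MState → Prop} {c c' : ℝ≥0}

/-- The conclusion `R` holds on the whole support, so it may be used when the good event is
weakened. -/
theorem mono (h : Spec O good p s t R G c) (ht : t ≤ t') (hR : ∀ s', R s' → R' s')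
    (hG : ∀ s', R s' → G s' → G' s') (hc : c' ≤ c) : Spec O good p s t' R' G' c' := by
  intro fuel hf
  obtain ⟨h1, h2⟩ := h fuel (ht.trans hf)
  refine ⟨fun o ho => ?_, fun hg => ?_⟩
  · obtain ⟨s', e, e1, e2⟩ := h1 o ho
    exact ⟨s', e, e1.trans (by omega), hR _ e2⟩
  · refine le_trans (le_trans (by exact_mod_cast hc) (h2 hg)) ?_
    refine PMF.toOuterMeasure_mono _ ?_
    rintro o ⟨⟨s', rfl, h3⟩, ho⟩
    obtain ⟨s'', e, -, e2⟩ := h1 _ ho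
    cases e
    exact ⟨s', rfl, hG _ e2 h3⟩

/-- Law of total probability: from every intermediate state the second program succeeds with
probability at least `cb`, and after a success of the first one with probability at least `cg`. The
choice `cb = 0` multiplies probabilities; other choices count successes. -/
theorem seq {R₁ G₁ : MState → Prop} {c₁ cb cg : ℝ≥0} (h₁ : Spec O good p s t R₁ G₁ c₁)
    (hb : ∀ s', R₁ s' → Spec O good p' s' t' R G cb)
    (hg : ∀ s', R₁ s' → G₁ s' → Spec O good p' s' t' R G cg) (hc : cb ≤ cg) :
    Spec O good (.seq p p') s (t + t') R G (cb + (cg - cb) * c₁) := by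
  intro fuel hf
  obtain ⟨h1, h2⟩ := h₁ fuel (by omega)
  constructor
  · intro o ho
    rw [Prog.eval, mem_support_andThen] at ho
    rcases ho with ⟨hn, -⟩ | ⟨s1, hs1, ho⟩
    · obtain ⟨s', e, -⟩ := h1 _ hn
      cases e
    · obtain ⟨s', e, e1, e2⟩ := h1 _ hs1
      cases e
      obtain ⟨s'', e3, e4, e5⟩ := (hb s1 e2 fuel (by omega)).1 o ho
      exact ⟨s'', e3, by omega, e5⟩
  · intro hgood
    rw [Prog.eval, andThen, PMF.toOuterMeasure_bind_apply]
    set μ := p.eval O fuel s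
    set A : Set (Option MState) := {o | ∃ s', o = some s' ∧ G₁ s'}
    -- The bound is checked pointwise, for one intermediate outcome at a time, and then summed.
    have key : ∀ o, (cb : ℝ≥0∞) * μ o + ((cg - cb : ℝ≥0) : ℝ≥0∞) * A.indicator μ o ≤
        μ o * (o.elim (PMF.pure none) (p'.eval O fuel)).toOuterMeasure
          {o | ∃ s', o = some s' ∧ G s'} := by
      intro o
      by_cases hμ : μ o = 0
      · have : A.indicator μ o = 0 := by
          by_cases hA : o ∈ A <;> simp [hA, hμ]
        simp [hμ, this]
      obtain ⟨s', rfl, -, e2⟩ := h1 o ((PMF.mem_support_iff _ _).2 hμ)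
      by_cases hA : some s' ∈ A
      · rw [Set.indicator_of_mem hA]
        obtain ⟨s'', e, hG⟩ := hA
        cases e
        have := (hg s' e2 hG fuel (by omega)).2 hgood
        rw [← add_mul, mul_comm]
        refine mul_le_mul_right ?_ _
        rw [← ENNReal.coe_add, add_tsub_cancel_of_le hc]
        exact this
      · rw [Set.indicator_of_notMem hA, mul_zero, add_zero, mul_comm]
        exact mul_le_mul_right ((hb s' e2 fuel (by omega)).2 hgood) _
    refine le_trans ?_ (ENNReal.tsum_le_tsum key)
    rw [ENNReal.tsum_add, ENNReal.tsum_mul_left, ENNReal.tsum_mul_left, μ.tsum_coe, mul_one,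
      ← PMF.toOuterMeasure_apply, ENNReal.coe_add, ENNReal.coe_mul]
    gcongr
    exact h2 hgood

/-- Correctness is demanded only for `c ≠ 0`. With `c = 0` the same lemma covers runs after a
failure, where only time and size bounds matter. -/
theorem of_run {k S : ℕ} {Q : (ℕ → ℕ) → List ℕ → Prop} (h : Run p s.reg s.tape k Q) (hS : 3 ≤ S)
    (hB : Bdd S s.reg s.tape)
    (hR : ∀ s' : MState, s'.queries = s.queries → Bdd (S + k) s'.reg s'.tape →
      Q s'.reg s'.tape → R s') (hc : c ≤ 1)
    (hG : ∀ s', R s' → Q s'.reg s'.tape → c ≠ 0 → G s') :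
    Spec O good p s (k * (1 + 2 * (S + k))) R G c := by
  intro fuel hf
  obtain ⟨r', t', h1, h2⟩ := h
  obtain ⟨T, h3, h4⟩ := h2 s.time s.queries
  have h5 := h3 O fuel (by nlinarith)
  obtain ⟨h6, h7⟩ := h4 S hS hB
  have h8 := hR ⟨r', t', T, s.queries⟩ rfl h6 h1
  have h9 : p.eval O fuel s = PMF.pure (some ⟨r', t', T, s.queries⟩) := h5
  rw [h9]
  constructor
  · intro o ho
    rw [PMF.mem_support_pure_iff] at ho
    exact ⟨_, ho, h7, h8⟩
  · intro _
    by_cases h0 : c = 0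
    · simp [h0]
    · rw [PMF.toOuterMeasure_pure_apply, if_pos ⟨_, rfl, hG _ h8 h1 h0⟩]
      exact_mod_cast hc

theorem run_seq {k S : ℕ} {Q : (ℕ → ℕ) → List ℕ → Prop} (h : Run p s.reg s.tape k Q) (hS : 3 ≤ S)
    (hB : Bdd S s.reg s.tape)
    (hp : ∀ s' : MState, s'.queries = s.queries → Bdd (S + k) s'.reg s'.tape →
      Q s'.reg s'.tape → Spec O good p' s' t R G c) :
    Spec O good (.seq p p') s (k * (1 + 2 * (S + k)) + t) R G c := by
  have h1 : Spec O good p s (k * (1 + 2 * (S + k))) (fun s' => s'.queries = s.queries ∧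
      Bdd (S + k) s'.reg s'.tape ∧ Q s'.reg s'.tape) (fun _ => True) 1 :=
    of_run h hS hB (fun s' a b d => ⟨a, b, d⟩) le_rfl fun _ _ _ _ => trivial
  have h2 := h1.seq (fun s' h => hp s' h.1 h.2.1 h.2.2) (fun s' h _ => hp s' h.1 h.2.1 h.2.2) le_rfl
  simpa using h2

end Spec

/-! ### Tutte polynomials of hypergraphs -/

theorem MultiHypergraph.joined_adj {V E : Type} (H : MultiHypergraph V E) (F : Finset E) (u v : V) :
    (H.joined F).Adj u v ↔ u ≠ v ∧ ∃ f ∈ F, u ∈ H.edge f ∧ v ∈ H.edge f := by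
  unfold MultiHypergraph.joined
  rw [SimpleGraph.fromRel_adj]
  constructor
  · rintro ⟨h, ⟨f, h1, h2, h3⟩ | ⟨f, h1, h2, h3⟩⟩
    · exact ⟨h, f, h1, h2, h3⟩
    · exact ⟨h, f, h1, h3, h2⟩
  · rintro ⟨h, h1⟩
    exact ⟨h, Or.inl h1⟩

/-- If all hyperedges contain the vertex `s`, then the components are that of `s` and the isolated
vertices. -/
theorem MultiHypergraph.kappa_of_forall_mem {V E : Type} [Fintype V] (H : MultiHypergraph V E)
    (F : Finset E) (s : V) (hs : ∀ f ∈ F, s ∈ H.edge f) :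
    H.kappa F = Nat.card {v // v ≠ s ∧ ∀ f ∈ F, v ∉ H.edge f} + 1 := by
  classical
  unfold MultiHypergraph.kappa
  rw [← Finite.card_option]
  refine (Nat.card_eq_of_bijective (fun o : Option {v // v ≠ s ∧ ∀ f ∈ F, v ∉ H.edge f} =>
    (H.joined F).connectedComponentMk (o.elim s Subtype.val)) ⟨?_, ?_⟩).symm
  · have key : ∀ (v : {v // v ≠ s ∧ ∀ f ∈ F, v ∉ H.edge f}) (w : V),
        (H.joined F).Reachable v.1 w → v.1 = w := by
      rintro v w ⟨p⟩
      cases p with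
      | nil => rfl
      | cons h _ =>
        rw [MultiHypergraph.joined_adj] at h
        obtain ⟨-, f, h1, h2, -⟩ := h
        exact absurd h2 (v.2.2 f h1)
    intro o o' h
    simp only [SimpleGraph.ConnectedComponent.eq] at h
    cases o with
    | none =>
      cases o' with
      | none => rfl
      | some v => exact absurd (key v _ h.symm) v.2.1
    | some w =>
      cases o' with
      | none => exact absurd (key w _ h) w.2.1
      | some v => exact congrArg some (Subtype.ext (key w _ h))
  · intro c
    induction c using SimpleGraph.ConnectedComponent.ind with
    | h v =>
      by_cases h1 : v ≠ s ∧ ∀ f ∈ F, v ∉ H.edge f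
      · exact ⟨some ⟨v, h1⟩, rfl⟩
      · refine ⟨none, ?_⟩
        simp only [SimpleGraph.ConnectedComponent.eq, Option.elim]
        by_cases hv : v = s
        · rw [hv]
        · push Not at h1
          obtain ⟨f, hf, hvf⟩ := h1 hv
          refine SimpleGraph.Adj.reachable ?_
          rw [MultiHypergraph.joined_adj]
          exact ⟨fun h => hv h.symm, f, hf, hs f hf, hvf⟩

/-- The two-state Potts model is the Tutte polynomial at `q = 2`. -/
theorem MultiHypergraph.potts_two {V E : Type} [Fintype V] [DecidableEq V] [Fintype E]
    (H : MultiHypergraph V E) (hne : ∀ f, H.edge f ≠ 0) (γ : E → ℝ) :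
    H.potts 2 γ = H.tutte 2 γ := by
  classical
  unfold MultiHypergraph.potts MultiHypergraph.tutte
  have h1 : ∀ σ : V → Fin 2, (∏ f : E, (1 + γ f *
      if ((H.edge f).map σ).toFinset.card = 1 then (1 : ℝ) else 0)) =
      ∑ F : Finset E, (if ∀ f ∈ F, ((H.edge f).map σ).toFinset.card = 1 then (1 : ℝ) else 0) *
        ∏ f ∈ F, γ f := by
    intro σ
    rw [Finset.prod_one_add, Finset.powerset_univ]
    refine Finset.sum_congr rfl fun F _ => ?_
    rw [Finset.prod_mul_distrib, mul_comm]
    congr 1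
    rw [Finset.prod_ite_zero]
    simp
  simp_rw [h1]
  rw [Finset.sum_comm]
  refine Finset.sum_congr rfl fun F _ => ?_
  rw [← Finset.sum_mul]
  congr 1
  rw [Finset.sum_boole]
  -- Nonemptiness of the hyperedges enters in the converse: an empty hyperedge has no colour at all
  -- and would violate `card = 1`.
  have h2 : ∀ σ : V → Fin 2, (∀ f ∈ F, ((H.edge f).map σ).toFinset.card = 1) ↔
      ∀ u v, (H.joined F).Adj u v → σ u = σ v := by
    intro σ
    constructor
    · intro h u v huv
      rw [MultiHypergraph.joined_adj] at huv
      obtain ⟨-, f, hf, hu, hv⟩ := huv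
      obtain ⟨c, hc⟩ := Finset.card_eq_one.1 (h f hf)
      have e : ∀ w ∈ H.edge f, σ w = c := by
        intro w hw
        have : σ w ∈ ((H.edge f).map σ).toFinset := by
          rw [Multiset.mem_toFinset]; exact Multiset.mem_map_of_mem _ hw
        rw [hc] at this
        exact Finset.mem_singleton.1 this
      rw [e u hu, e v hv]
    · intro h f hf
      obtain ⟨w, hw⟩ := Multiset.exists_mem_of_ne_zero (hne f)
      rw [Finset.card_eq_one]
      refine ⟨σ w, ?_⟩
      ext c
      simp only [Multiset.mem_toFinset, Multiset.mem_map, Finset.mem_singleton]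
      constructor
      · rintro ⟨u, hu, rfl⟩
        by_cases huw : u = w
        · rw [huw]
        · exact h u w ((MultiHypergraph.joined_adj _ _ _ _).2 ⟨huw, f, hf, hu, hw⟩)
      · rintro rfl
        exact ⟨w, hw, rfl⟩
  simp_rw [h2]
  have h3 : ∀ σ : V → Fin 2, (∀ u v, (H.joined F).Adj u v → σ u = σ v) →
      ∀ u v, (H.joined F).Reachable u v → σ u = σ v := by
    rintro σ h u v ⟨p⟩
    induction p with
    | nil => rfl
    | cons h' _ ih => rw [h _ _ h', ih]
  -- The colourings that are constant on each hyperedge of `F` are the functions on the components,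
  -- so there are 2^κ of them.
  have e : {σ : V → Fin 2 // ∀ u v, (H.joined F).Adj u v → σ u = σ v} ≃
      ((H.joined F).ConnectedComponent → Fin 2) :=
    { toFun := fun σ c => c.lift σ.1 fun u v p _ => h3 σ.1 σ.2 u v ⟨p⟩
      invFun := fun τ => ⟨fun v => τ ((H.joined F).connectedComponentMk v), fun u v h => by
        have : (H.joined F).connectedComponentMk u = (H.joined F).connectedComponentMk v :=
          SimpleGraph.ConnectedComponent.eq.2 h.reachable
        exact congrArg τ this⟩
      left_inv := fun σ => by ext v; rfl
      right_inv := fun τ => by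
        funext c
        induction c using SimpleGraph.ConnectedComponent.ind with
        | h v => rfl }
  have h4 := Nat.card_congr e
  rw [Nat.card_fun, Nat.card_eq_fintype_card, Fintype.card_subtype] at h4
  rw [h4]
  simp [MultiHypergraph.kappa]

theorem UniformHyperIsing_one : UniformHyperIsing 1 = UniformHyperTutte 2 (2 - 1) := by
  unfold UniformHyperIsing UniformHyperTutte
  congr 1
  funext H
  rw [show (2 - 1 : ℝ) = 1 by norm_num]
  refine MultiHypergraph.potts_two _ (fun f => ?_) _
  intro h
  have h1 : (H.toMulti.edge f).card = H.size := by simp [UniformHypergraph.toMulti]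
  rw [h] at h1
  have := H.size_pos
  simp at h1
  omega

/-! ### Sums over sets of vertices -/

/-- Grouping the subsets of `E` according to their images under a map with fibres of size `m`. -/
theorem sum_image_pow {E X : Type} [Fintype E] [Fintype X] [DecidableEq E] [DecidableEq X]
    (π : E → X) (m : ℕ) (hπ : ∀ x, (Finset.univ.filter fun e => π e = x).card = m)
    (g : Finset X → ℝ) (γ : ℝ) :
    ∑ F : Finset E, g (F.image π) * γ ^ F.card =
      ∑ A : Finset X, g A * ((1 + γ) ^ m - 1) ^ A.card := by
  have h1 : ∀ A : Finset X, (Finset.univ.filter fun e => π e ∈ A).card = m * A.card := by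
    intro A
    rw [Finset.card_eq_sum_card_fiberwise (f := π) (t := A) (fun e he => by simpa using he)]
    rw [Finset.sum_const_nat (m := m), mul_comm]
    intro x hx
    rw [← hπ x, Finset.filter_filter]
    congr 1
    ext e
    simp only [Finset.mem_filter, Finset.mem_univ, true_and]
    exact ⟨fun h => h.2, fun h => ⟨h ▸ hx, h⟩⟩
  set c : Finset X → ℝ := fun A => ∑ F : Finset E with F.image π = A, γ ^ F.card with hc
  -- The sets `F` whose image lies in `A` are the subsets of the preimage of `A`, which has `m *
  -- A.card` elements; the binomial theorem sums them.
  have h2 : ∀ A : Finset X, ∑ B ∈ A.powerset, c B = ((1 + γ) ^ m) ^ A.card := by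
    intro A
    rw [hc, ← pow_mul, ← h1 A, add_comm 1 γ]
    have := Finset.sum_pow_mul_eq_add_pow γ 1 (Finset.univ.filter fun e => π e ∈ A)
    simp only [one_pow, mul_one] at this
    rw [← this]
    rw [← Finset.sum_fiberwise_of_maps_to (s := (Finset.univ.filter fun e => π e ∈ A).powerset)
      (t := A.powerset) (g := fun F => F.image π)]
    · refine Finset.sum_congr rfl fun B hB => Finset.sum_congr ?_ fun _ _ => rfl
      ext F
      simp only [Finset.mem_filter, Finset.mem_univ, true_and, Finset.mem_powerset] at hB ⊢
      constructor
      · rintro rfl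
        refine ⟨fun e he => ?_, rfl⟩
        simpa using hB (Finset.mem_image_of_mem π he)
      · exact fun h => h.2
    · intro F hF
      simp only [Finset.mem_powerset] at hF ⊢
      intro x hx
      obtain ⟨e, he, rfl⟩ := Finset.mem_image.1 hx
      simpa using hF he
  -- Both sides have the same sums over all subsets of any `A`, hence agree by induction on `A`;
  -- this is Möbius inversion on the subset lattice.
  have h3 : ∀ A : Finset X, c A = ((1 + γ) ^ m - 1) ^ A.card := by
    intro A
    induction A using Finset.strongInduction with
    | H A ih =>
      have e1 := h2 A
      have e2 := Finset.sum_pow_mul_eq_add_pow ((1 + γ) ^ m - 1) 1 A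
      simp only [one_pow, mul_one, sub_add_cancel] at e2
      rw [← e2, ← Finset.add_sum_erase _ _ (Finset.mem_powerset_self A),
        ← Finset.add_sum_erase _ _ (Finset.mem_powerset_self A)] at e1
      have e3 : ∑ B ∈ A.powerset.erase A, c B =
          ∑ B ∈ A.powerset.erase A, ((1 + γ) ^ m - 1) ^ B.card := by
        refine Finset.sum_congr rfl fun B hB => ih B ?_
        simp only [Finset.mem_erase, Finset.mem_powerset] at hB
        exact hB.2.ssubset_of_ne hB.1
      rw [e3] at e1
      exact add_right_cancel e1
  rw [← Finset.sum_fiberwise (g := fun F : Finset E => F.image π)]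
  refine Finset.sum_congr rfl fun A _ => ?_
  rw [← h3, hc, Finset.mul_sum]
  refine Finset.sum_congr rfl fun F hF => ?_
  simp only [Finset.mem_filter, Finset.mem_univ, true_and] at hF
  rw [hF]

theorem sum_finset_prod {V : Type} [Fintype V] [DecidableEq V] (f g : V → ℝ) :
    ∑ A : Finset V, (∏ v, if v ∈ A then f v else g v) = ∏ v, (f v + g v) := by
  rw [Finset.prod_add, Finset.powerset_univ]
  refine Finset.sum_congr rfl fun A _ => ?_
  rw [Finset.prod_ite]
  congr 1
  · congr 1; ext v; simp
  · congr 1; ext v; simp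

open Classical in
/-- A pair of weighted sums over sets of vertices of a bipartite graph. -/
theorem sum_undominated {U V : Type} [Fintype U] [Fintype V] (adj : U → V → Prop)
    [∀ A : Finset (U ⊕ V), DecidablePred fun y : U ⊕ V =>
      y ∉ A ∧ ∀ u v, Sum.inl u ∈ A → y = Sum.inr v → ¬ adj u v]
    [∀ I : Finset (U ⊕ V), DecidablePred fun y : U ⊕ V => y ∉ I]
    [∀ I : Finset (U ⊕ V), Decidable (∀ u v, Sum.inl u ∈ I → Sum.inr v ∈ I → ¬ adj u v)] (x : ℝ) :
    ∑ A : Finset (U ⊕ V), x ^ A.card * (x + 1) ^ (Finset.univ.filter fun y : U ⊕ V =>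
        y ∉ A ∧ ∀ u v, Sum.inl u ∈ A → y = Sum.inr v → ¬ adj u v).card =
      ∑ I : Finset (U ⊕ V), if ∀ u v, Sum.inl u ∈ I → Sum.inr v ∈ I → ¬ adj u v then
        x ^ I.card * (x + 1) ^ (Finset.univ.filter fun y => y ∉ I).card else 0 := by
  rw [← Finset.sumEquiv.symm.toEquiv.sum_comp, ← Finset.sumEquiv.symm.toEquiv.sum_comp,
    Fintype.sum_prod_type, Fintype.sum_prod_type]
  -- From here on `A` is the part in `U`. On both sides it contributes `x` per element and `x + 1`
  -- per missing vertex of `U`, and the rest factors over `V`. A vertex `v` with a neighbour in `A`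
  -- gives `x + 1` on the left and `0 + (x + 1)` on the right; without such a neighbour it gives `x
  -- + (x + 1)` on both sides.
  refine Finset.sum_congr rfl fun A _ => ?_
  have hpow : ∀ (P : U ⊕ V → Prop) [DecidablePred P], (x + 1) ^ (Finset.univ.filter P).card =
      (∏ u : U, if P (Sum.inl u) then x + 1 else 1) *
        ∏ v : V, if P (Sum.inr v) then x + 1 else 1 := by
    intro P _
    rw [← Finset.prod_const, Finset.prod_filter, Fintype.prod_sum_type]
  have hx : ∀ C : Finset V, x ^ C.card = ∏ v, if v ∈ C then x else 1 := by
    intro C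
    rw [← Finset.prod_const, ← Finset.prod_filter]
    congr 1; ext v; simp
  have h1 : ∀ C : Finset V, x ^ (A.disjSum C).card * (x + 1) ^ (Finset.univ.filter
        fun y : U ⊕ V => y ∉ A.disjSum C ∧
          ∀ u v, Sum.inl u ∈ A.disjSum C → y = Sum.inr v → ¬ adj u v).card =
      (x ^ A.card * ∏ u : U, if u ∉ A then x + 1 else 1) * ∏ v : V, if v ∈ C then x else
        if ∀ u ∈ A, ¬ adj u v then x + 1 else 1 := by
    intro C
    rw [hpow, Finset.card_disjSum, pow_add, hx]
    simp only [Finset.inl_mem_disjSum, Finset.inr_mem_disjSum, reduceCtorEq, false_imp_iff,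
      implies_true, and_true, Sum.inr.injEq]
    rw [mul_mul_mul_comm, ← Finset.prod_mul_distrib]
    congr 1
    refine Finset.prod_congr rfl fun v _ => ?_
    by_cases hv : v ∈ C
    · simp [hv]
    · simp only [hv, if_false, not_false_iff, true_and, one_mul]
      congr 1
      simp
  have h2 : ∀ C : Finset V, (if ∀ u v, Sum.inl u ∈ A.disjSum C → Sum.inr v ∈ A.disjSum C →
        ¬ adj u v then x ^ (A.disjSum C).card *
          (x + 1) ^ (Finset.univ.filter fun y => y ∉ A.disjSum C).card else 0) =
      (x ^ A.card * ∏ u : U, if u ∉ A then x + 1 else 1) * ∏ v : V, if v ∈ C then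
        (if ∀ u ∈ A, ¬ adj u v then x else 0) else x + 1 := by
    intro C
    rw [hpow, Finset.card_disjSum, pow_add, hx]
    simp only [Finset.inl_mem_disjSum, Finset.inr_mem_disjSum]
    by_cases hI : ∀ u v, u ∈ A → v ∈ C → ¬ adj u v
    · rw [if_pos hI, mul_mul_mul_comm, ← Finset.prod_mul_distrib]
      congr 1
      refine Finset.prod_congr rfl fun v _ => ?_
      by_cases hv : v ∈ C
      · rw [if_pos hv, if_pos hv, if_pos fun u hu => hI u v hu hv]
        simp [hv]
      · simp [hv]
    · rw [if_neg hI]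
      push Not at hI
      obtain ⟨u, v, hu, hv, huv⟩ := hI
      rw [Finset.prod_eq_zero (Finset.mem_univ v), mul_zero]
      rw [if_pos hv, if_neg]
      exact fun h => h u hu huv
  have e1 : ∀ C : Finset V, Finset.sumEquiv.symm.toEquiv (A, C) = A.disjSum C := fun _ => rfl
  simp_rw [e1, h1, h2]
  rw [← Finset.mul_sum, ← Finset.mul_sum, sum_finset_prod, sum_finset_prod]
  congr 1
  refine Finset.prod_congr rfl fun v _ => ?_
  split_ifs <;> ring

/-! ### The hypergraph attached to a bipartite graph -/

/-- Whether the hyperedges that belong to the vertex `x` contain the vertices that belong to the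
vertex `y`; the vertices of the bipartite graph are numbered from the left to the right. -/
def BipGraph.link (B : BipGraph) (x y : ℕ) : ℕ :=
  if x = y then 1
  else if h : x < B.left ∧ B.left ≤ y ∧ y < B.left + B.right then
    (B.adj ⟨x, h.1⟩ ⟨y - B.left, by omega⟩).toNat
  else 0

theorem BipGraph.link_le_one (B : BipGraph) (x y : ℕ) : B.link x y ≤ 1 := by
  unfold BipGraph.link
  split_ifs
  · exact le_rfl
  · exact Bool.toNat_le _
  · exact zero_le_one

/-- The number of vertices of a bipartite graph. -/
abbrev BipGraph.order (B : BipGraph) : ℕ := B.left + B.right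

/-- The uniform hypergraph with a special vertex `0`, with `m` further vertices and `m` hyperedges
for every vertex of the bipartite graph; the special vertex is used for padding. -/
def BipGraph.gadget (B : BipGraph) (m : ℕ) : UniformHypergraph where
  numV := m * B.order + 1
  numE := m * B.order
  size := m * B.order + 1
  size_pos := Nat.succ_pos _
  vert := fun f i => ⟨i * B.link (f % B.order) ((i - 1) % B.order),
    lt_of_le_of_lt (Nat.mul_le_mul_left _ (B.link_le_one _ _)) (by rw [mul_one]; exact i.2)⟩

/-- Each residue modulo `n` occurs `m` times below `m * n`: the residue names the vertex of the
bipartite graph, the quotient names the copy. -/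
theorem card_modNat_fiber (m n : ℕ) (P : Fin n → Prop) [DecidablePred P] :
    (Finset.univ.filter fun e : Fin (m * n) => P e.modNat).card =
      m * (Finset.univ.filter P).card := by
  have h1 : (Finset.univ.filter fun e : Fin (m * n) => P e.modNat).card =
      (Finset.univ.filter fun e : Fin m × Fin n => P e.2).card := by
    refine Finset.card_equiv finProdFinEquiv.symm fun e => ?_
    simp [finProdFinEquiv]
  rw [h1]
  have h2 : (Finset.univ.filter fun e : Fin m × Fin n => P e.2) =
      (Finset.univ : Finset (Fin m)) ×ˢ (Finset.univ.filter P) := by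
    ext e; simp
  rw [h2, Finset.card_product, Finset.card_univ, Fintype.card_fin]

/-- The hypergraph `B.gadget m`. -/
def BipGraph.gadgetMulti (B : BipGraph) (m : ℕ) :
    MultiHypergraph (Fin (m * B.order + 1)) (Fin (m * B.order)) where
  edge := fun f => (Finset.univ : Finset (Fin (m * B.order + 1))).val.map
    fun i : Fin (m * B.order + 1) => ⟨i * B.link (f % B.order) ((i - 1) % B.order),
      lt_of_le_of_lt (Nat.mul_le_mul_left _ (B.link_le_one _ _)) (by rw [mul_one]; exact i.2)⟩

/-- Position `i` of a hyperedge carries the vertex `i` itself or the padding vertex 0, so a vertex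
`v ≠ 0` can occur only at position `v`. -/
theorem BipGraph.mem_gadget_edge (B : BipGraph) (m : ℕ) (f : Fin (m * B.order))
    (v : Fin (m * B.order + 1)) (hv : v ≠ 0) :
    v ∈ (B.gadgetMulti m).edge f ↔ B.link (f % B.order) ((v - 1) % B.order) ≠ 0 := by
  have h0 : (v : ℕ) ≠ 0 := fun h => hv (Fin.ext h)
  simp only [BipGraph.gadgetMulti, Multiset.mem_map, Finset.mem_val,
    Finset.mem_univ, true_and]
  constructor
  · rintro ⟨i, rfl⟩
    simp only at h0 ⊢
    have h1 := right_ne_zero_of_mul h0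
    have h2 := B.link_le_one (f % B.order) ((i - 1) % B.order)
    have h3 : B.link (f % B.order) ((i - 1) % B.order) = 1 := by omega
    rw [h3, mul_one, h3]
    exact one_ne_zero
  · intro h
    have h2 := B.link_le_one (f % B.order) ((v - 1) % B.order)
    have h3 : B.link (f % B.order) ((v - 1) % B.order) = 1 := by omega
    refine ⟨v, Fin.ext ?_⟩
    simp [h3]

/-- Position 0 of each hyperedge carries the vertex 0, so `kappa_of_forall_mem` applies and isolated
vertices remain to be counted. The other vertices are successors `e.succ`, and whether one is
isolated depends only on the residue of `e`; hence the factor `m`. -/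
theorem BipGraph.gadget_kappa (B : BipGraph) (m : ℕ) (F : Finset (Fin (m * B.order))) :
    (B.gadgetMulti m).kappa F = m * (Finset.univ.filter fun y : Fin B.order =>
      ∀ x ∈ F.image Fin.modNat, B.link x y = 0).card + 1 := by
  classical
  rw [MultiHypergraph.kappa_of_forall_mem _ F (0 : Fin (m * B.order + 1))]
  · congr 1
    rw [← card_modNat_fiber, ← Fintype.card_subtype, ← Nat.card_eq_fintype_card]
    have key : ∀ v : Fin (m * B.order + 1), v ≠ 0 →
        ((∀ f ∈ F, v ∉ (B.gadgetMulti m).edge f) ↔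
          ∀ x ∈ F.image Fin.modNat, B.link x ((v - 1 : ℕ) % B.order) = 0) := by
      intro v hv
      constructor
      · intro h x hx
        obtain ⟨f, hf, rfl⟩ := Finset.mem_image.1 hx
        have := h f hf
        rw [B.mem_gadget_edge m f v hv, not_not] at this
        simpa [Fin.coe_modNat] using this
      · intro h f hf
        rw [B.mem_gadget_edge m f v hv, not_not]
        simpa [Fin.coe_modNat] using h _ (Finset.mem_image_of_mem _ hf)
    refine (Nat.card_eq_of_bijective (fun e : {e : Fin (m * B.order) //
      ∀ x ∈ F.image Fin.modNat, B.link x e.modNat = 0} =>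
        (⟨e.1.succ, Fin.succ_ne_zero _, by
          rw [key _ (Fin.succ_ne_zero _)]
          simpa [Fin.coe_modNat] using e.2⟩ : {v : Fin (m * B.order + 1) // v ≠ 0 ∧ ∀ f ∈ F,
            v ∉ (B.gadgetMulti m).edge f})) ⟨?_, ?_⟩).symm
    · intro e e' h
      simp only [Subtype.mk.injEq, Fin.succ_inj] at h
      exact Subtype.ext h
    · rintro ⟨v, hv, h⟩
      rw [key v hv] at h
      obtain ⟨e, rfl⟩ := Fin.exists_succ_eq.2 hv
      exact ⟨⟨e, by simpa [Fin.coe_modNat] using h⟩, rfl⟩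
  · intro f _
    simp only [BipGraph.gadgetMulti, Multiset.mem_map, Finset.mem_val,
      Finset.mem_univ, true_and]
    exact ⟨0, by simp⟩

open Classical in
-- Grouping the hyperedge sets by the vertices they belong to replaces the weight `q - 1` by `q ^ m
-- - 1`. The resulting sum over dominating patterns is then exchanged for one over independent sets
-- by `sum_undominated`.
theorem BipGraph.gadgetMulti_tutte (B : BipGraph) (m : ℕ) (q : ℝ) (hq : 1 < q) :
    (B.gadgetMulti m).tutte q (fun _ => q - 1) = q ^ (m * B.order + 1) *
      ∑ I : Finset (Fin B.left ⊕ Fin B.right),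
        if ∀ u v, Sum.inl u ∈ I → Sum.inr v ∈ I → ¬ B.adj u v = true then
          (1 - (q ^ m)⁻¹) ^ I.card else 0 := by
  have hQ : q ^ m ≠ 0 := by positivity
  unfold MultiHypergraph.tutte
  have h1 : ∀ F : Finset (Fin (m * B.order)),
      q ^ (B.gadgetMulti m).kappa F * ∏ f ∈ F, (q - 1) =
        (fun A : Finset (Fin B.order) => q ^ (m * (Finset.univ.filter fun y : Fin B.order =>
          ∀ x ∈ A, B.link x y = 0).card + 1)) (F.image Fin.modNat) * (q - 1) ^ F.card := by
    intro F
    rw [B.gadget_kappa, Finset.prod_const]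
  refine (Finset.sum_congr rfl fun F _ => h1 F).trans ?_
  refine (sum_image_pow (Fin.modNat : Fin (m * B.order) → Fin B.order) m
    (fun x => (card_modNat_fiber m B.order (fun y => y = x)).trans (by
      rw [Finset.card_eq_one.2 ⟨x, by ext; simp⟩, mul_one]))
    (fun A => q ^ (m * (Finset.univ.filter fun y : Fin B.order =>
      ∀ x ∈ A, B.link x y = 0).card + 1)) (q - 1)).trans ?_
  rw [← (finSumFinEquiv (m := B.left) (n := B.right)).finsetCongr.sum_comp]
  have h2 : ∀ (A : Finset (Fin B.left ⊕ Fin B.right))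
      [DecidablePred fun y : Fin B.left ⊕ Fin B.right =>
        y ∉ A ∧ ∀ u v, Sum.inl u ∈ A → y = Sum.inr v → ¬ B.adj u v = true],
      (Finset.univ.filter fun y : Fin B.order => ∀ x ∈ finSumFinEquiv.finsetCongr A,
        B.link (x : Fin (B.left + B.right)) y = 0).card =
      (Finset.univ.filter fun y : Fin B.left ⊕ Fin B.right => y ∉ A ∧
        ∀ u v, Sum.inl u ∈ A → y = Sum.inr v → ¬ B.adj u v = true).card := by
    intro A _
    symm
    refine Finset.card_equiv finSumFinEquiv fun y => ?_
    simp only [Finset.mem_filter, Finset.mem_univ, true_and, Equiv.finsetCongr_apply,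
      Finset.mem_map_equiv]
    -- `link` is directed, from left to right only. This asymmetry is what makes the domination sum
    -- match independent sets.
    have h3 : ∀ x y : Fin B.left ⊕ Fin B.right,
        B.link (finSumFinEquiv x : Fin (B.left + B.right)) (finSumFinEquiv y : Fin _) = 0 ↔
          x ≠ y ∧ ∀ u v, x = Sum.inl u → y = Sum.inr v → ¬ B.adj u v = true := by
      intro x y
      unfold BipGraph.link
      rcases x with u | v <;> rcases y with u' | v'
      · have := u'.2
        by_cases h : u = u'
        · simp [h]
        · have h' : (u : ℕ) ≠ u' := fun e => h (Fin.ext e)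
          simp [h, h']
      · have := u.2
        have h' : (u : ℕ) ≠ B.left + v' := by omega
        simp [h']
      · have := u'.2
        have h' : B.left + v ≠ (u' : ℕ) := by omega
        simp [h']
      · by_cases h : v = v'
        · simp [h]
        · have h' : (v : ℕ) ≠ v' := fun e => h (Fin.ext e)
          simp [h, h']
    constructor
    · rintro ⟨h4, h5⟩ x hx
      obtain ⟨x, rfl⟩ := finSumFinEquiv.surjective x
      rw [Equiv.symm_apply_apply] at hx
      refine (h3 x y).2 ⟨fun h => h4 (h ▸ hx), ?_⟩
      rintro u v rfl rfl
      exact h5 u v hx rfl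
    · intro h
      have h6 : ∀ x ∈ A, x ≠ y ∧ ∀ u v, x = Sum.inl u → y = Sum.inr v → ¬ B.adj u v = true :=
        fun x hx => (h3 x y).1 (h _ (by simpa using hx))
      exact ⟨fun hy => (h6 y hy).1 rfl, fun u v hu hy => (h6 _ hu).2 u v rfl hy⟩
  have h7 := sum_undominated (fun u v => B.adj u v = true) (q ^ m - 1)
  rw [sub_add_cancel] at h7
  have h8 : ∀ (I : Finset (Fin B.left ⊕ Fin B.right)) [DecidablePred fun y => y ∉ I],
      (q ^ m - 1) ^ I.card * (q ^ m) ^ (Finset.univ.filter fun y => y ∉ I).card =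
        (q ^ m) ^ B.order * (1 - (q ^ m)⁻¹) ^ I.card := by
    intro I _
    have h9 : I.card + (Finset.univ.filter fun y => y ∉ I).card = B.order := by
      have := Finset.card_filter_add_card_filter_not (s := Finset.univ) (fun y => y ∈ I)
      simpa [BipGraph.order] using this
    rw [← h9, pow_add, mul_right_comm, ← mul_pow, mul_sub, mul_inv_cancel₀ hQ, mul_one]
  simp_rw [h8] at h7
  have h10 : ∀ (A : Finset (Fin B.left ⊕ Fin B.right))
      [DecidablePred fun y : Fin B.left ⊕ Fin B.right =>
        y ∉ A ∧ ∀ u v, Sum.inl u ∈ A → y = Sum.inr v → ¬ B.adj u v = true],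
      q ^ (m * (Finset.univ.filter fun y : Fin B.order => ∀ x ∈ finSumFinEquiv.finsetCongr A,
        B.link (x : Fin (B.left + B.right)) y = 0).card + 1) *
        ((1 + (q - 1)) ^ m - 1) ^ (finSumFinEquiv.finsetCongr A).card =
      q * ((q ^ m - 1) ^ A.card * (q ^ m) ^ (Finset.univ.filter fun y : Fin B.left ⊕ Fin B.right =>
        y ∉ A ∧ ∀ u v, Sum.inl u ∈ A → y = Sum.inr v → ¬ B.adj u v = true).card) := by
    intro A _
    rw [h2 A, pow_succ, pow_mul, add_sub_cancel, Equiv.finsetCongr_apply, Finset.card_map]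
    ring
  refine (Finset.sum_congr rfl fun A _ => h10 A).trans ?_
  rw [← Finset.mul_sum, h7, pow_succ, pow_mul, Finset.mul_sum, Finset.mul_sum]
  refine Finset.sum_congr rfl fun I _ => ?_
  split_ifs
  · ring
  · simp

open Classical in
-- The two hypergraphs agree by definition; `gadgetMulti` merely has its vertex and edge types in
-- unfolded form, where `0` and `Fin.succ` make sense.
theorem BipGraph.gadget_tutte (B : BipGraph) (m : ℕ) (q : ℝ) (hq : 1 < q) :
    (B.gadget m).toMulti.tutte q (fun _ => q - 1) = q ^ (m * B.order + 1) *
      ∑ I : Finset (Fin B.left ⊕ Fin B.right),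
        if ∀ u v, Sum.inl u ∈ I → Sum.inr v ∈ I → ¬ B.adj u v = true then
          (1 - (q ^ m)⁻¹) ^ I.card else 0 :=
  B.gadgetMulti_tutte m q hq

/-! ### From the weighted sum to the number of independent sets -/

theorem BipGraph.isIndepSet_iff (B : BipGraph) (I : Finset (Fin B.left ⊕ Fin B.right)) :
    B.toSimpleGraph.IsIndepSet (I : Set _) ↔
      ∀ u v, Sum.inl u ∈ I → Sum.inr v ∈ I → ¬ B.adj u v = true := by
  constructor
  · intro h u v hu hv huv
    refine h hu hv (by simp) ?_
    unfold BipGraph.toSimpleGraph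
    rw [SimpleGraph.fromRel_adj]
    exact ⟨by simp, Or.inl ⟨u, v, rfl, rfl, huv⟩⟩
  · intro h x hx y hy _ hxy
    unfold BipGraph.toSimpleGraph at hxy
    rw [SimpleGraph.fromRel_adj] at hxy
    rcases hxy with ⟨-, ⟨u, v, rfl, rfl, h1⟩ | ⟨u, v, rfl, rfl, h1⟩⟩
    · exact h u v hx hy h1
    · exact h u v hy hx h1

open Classical in
theorem BIS_value (B : BipGraph) : BIS.value B = ∑ I : Finset (Fin B.left ⊕ Fin B.right),
    if ∀ u v, Sum.inl u ∈ I → Sum.inr v ∈ I → ¬ B.adj u v = true then (1 : ℝ) else 0 := by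
  rw [Finset.sum_boole]
  unfold BIS
  simp only
  rw [Nat.card_eq_fintype_card, Fintype.card_subtype]
  simp_rw [B.isIndepSet_iff]

/-- This crude bound enters the number of digits that must be read from an answer. -/
theorem BIS_value_le (B : BipGraph) : BIS.value B ≤ 2 ^ B.order := by
  rw [BIS_value]
  calc _ ≤ ∑ I : Finset (Fin B.left ⊕ Fin B.right), (1 : ℝ) := by
        refine Finset.sum_le_sum fun I _ => ?_
        split_ifs <;> norm_num
    _ = _ := by simp [BipGraph.order]

/-- The normalised partition function of the gadget is close to the number of independent sets. -/
theorem BipGraph.gadget_tutte_bounds (B : BipGraph) (q : ℝ) (hq : 1 < q) (C K : ℕ)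
    (hC : 4 ≤ C * (q - 1)) (hK : 1 ≤ K) :
    Real.exp (-(1 / (2 * K))) * BIS.value B * q ^ ((C * K * B.order) * B.order + 1) ≤
        (B.gadget (C * K * B.order)).toMulti.tutte q (fun _ => q - 1) ∧
      (B.gadget (C * K * B.order)).toMulti.tutte q (fun _ => q - 1) ≤
        BIS.value B * q ^ ((C * K * B.order) * B.order + 1) := by
  classical
  set m := C * K * B.order with hm
  have hq0 : 0 < q := by linarith
  have hQ : 1 ≤ q ^ m := one_le_pow₀ hq.le
  have hi : (q ^ m)⁻¹ ≤ 1 := inv_le_one_of_one_le₀ hQ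
  have hi0 : 0 < (q ^ m)⁻¹ := by positivity
  have hK' : (1 : ℝ) ≤ K := by exact_mod_cast hK
  rw [B.gadget_tutte m q hq, BIS_value]
  constructor
  · rw [mul_comm]
    refine mul_le_mul_of_nonneg_left ?_ (by positivity)
    rw [Finset.mul_sum]
    refine Finset.sum_le_sum fun I _ => ?_
    split_ifs with hI
    · rw [mul_one]
      have hc : I.card ≤ B.order := by
        have := I.card_le_univ
        simpa [BipGraph.order] using this
      refine le_trans ?_ (pow_le_pow_of_le_one (by linarith) (by linarith) hc)
      rcases Nat.eq_zero_or_pos B.order with h0 | h0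
      · rw [h0, pow_zero]
        exact Real.exp_le_one_iff.2 (by simp)
      have h0' : (1 : ℝ) ≤ B.order := by exact_mod_cast h0
      -- Bernoulli's inequality is used twice: here for (1 - q^{-m})^n ≥ 1 - n q^{-m}, and below for
      -- q^m ≥ 1 + m(q-1) ≥ 4Kn. The loss is at most 1/(4K), and 1 - 1/(4K) ≥ e^{-1/(2K)}.
      have hb := one_add_mul_le_pow (a := -(q ^ m)⁻¹) (by linarith) B.order
      refine le_trans ?_ ((le_of_eq (by ring)).trans (hb.trans (le_of_eq (by ring))) :
        1 - B.order * (q ^ m)⁻¹ ≤ (1 - (q ^ m)⁻¹) ^ B.order)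
      have h1 : 4 * K * (B.order : ℝ) ≤ q ^ m := by
        have h2 := one_add_mul_le_pow (a := q - 1) (by linarith) m
        rw [add_sub_cancel] at h2
        refine le_trans ?_ h2
        rw [hm]
        push_cast
        nlinarith [mul_le_mul_of_nonneg_right hC (show (0 : ℝ) ≤ K * B.order by positivity)]
      have h3 : B.order * (q ^ m)⁻¹ ≤ 1 / (4 * K) := by
        rw [← div_eq_mul_inv, div_le_div_iff₀ (by positivity) (by positivity)]
        linarith
      set x : ℝ := 1 / (2 * K) with hx
      have hx0 : 0 ≤ x := by positivity
      have hx1 : x ≤ 1 := by rw [hx, div_le_one (by positivity)]; linarith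
      have h4 : (1 : ℝ) / (4 * K) = x / 2 := by rw [hx]; field_simp; norm_num
      have h5 : Real.exp (-x) ≤ 1 - x / 2 := by
        rw [Real.exp_neg]
        have h6 := Real.add_one_le_exp x
        rw [inv_le_comm₀ (Real.exp_pos _) (by linarith)]
        refine le_trans ?_ h6
        rw [inv_le_comm₀ (by linarith) (by linarith), ← one_div, div_le_iff₀ (by linarith)]
        nlinarith
      linarith
    · simp
  · rw [mul_comm]
    refine mul_le_mul_of_nonneg_right ?_ (by positivity)
    refine Finset.sum_le_sum fun I _ => ?_
    split_ifs with hI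
    · exact pow_le_one₀ (by linarith) (by linarith)
    · exact le_rfl

/-! ### Powers of `q` as values of the Tutte polynomial -/

/-- The hypergraph with `N + 1` vertices and without hyperedges. -/
def UniformHypergraph.isolated (N : ℕ) : UniformHypergraph where
  numV := N + 1
  numE := 0
  size := 1
  size_pos := one_pos
  vert := fun f => f.elim0

theorem MultiHypergraph.tutte_of_isEmpty {E : Type} [Fintype E] [IsEmpty E] (N : ℕ)
    (H : MultiHypergraph (Fin (N + 1)) E) (q : ℝ) (γ : E → ℝ) : H.tutte q γ = q ^ (N + 1) := by
  unfold MultiHypergraph.tutte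
  rw [Fintype.sum_eq_single ∅ (fun F hF => absurd (Subsingleton.elim F ∅) hF),
    Finset.prod_empty, mul_one, H.kappa_of_forall_mem ∅ 0 (by simp)]
  congr 2
  simp only [Finset.notMem_empty, false_imp_iff, implies_true, and_true]
  rw [Nat.card_eq_fintype_card, Fintype.card_subtype_compl]
  simp

theorem UniformHypergraph.isolated_tutte (N : ℕ) (q γ : ℝ) :
    (isolated N).toMulti.tutte q (fun _ => γ) = q ^ (N + 1) :=
  MultiHypergraph.tutte_of_isEmpty (E := Fin 0) N _ q _

/-- The value of the Tutte polynomial is at least one. -/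
theorem one_le_tutte (H : UniformHypergraph) (q : ℝ) (hq : 1 < q) :
    1 ≤ (UniformHyperTutte q (q - 1)).value H := by
  unfold UniformHyperTutte MultiHypergraph.tutte
  simp only
  have h := Finset.single_le_sum (f := fun F : Finset (Fin H.numE) =>
    q ^ H.toMulti.kappa F * ∏ f ∈ F, (q - 1)) (s := Finset.univ) (fun F _ => by
      rw [Finset.prod_const]
      have : 0 < q - 1 := by linarith
      positivity) (Finset.mem_univ ∅)
  refine le_trans ?_ h
  simp only [Finset.prod_empty, mul_one]
  exact one_le_pow₀ hq.le

/-! ### Reading and writing unary words -/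

theorem wordToNat_cons (b : Bool) (w : List Bool) :
    wordToNat (b :: w) = 2 * wordToNat w + b.toNat := by
  have : wordToNat (b :: w) = Nat.bit b (wordToNat w) := rfl
  rw [this, Nat.bit_val]

theorem size_wordToNat (w : List Bool) : (wordToNat w).size = w.length + 1 := by
  induction w with
  | nil => simp [wordToNat]
  | cons b w ih =>
    have : wordToNat (b :: w) = Nat.bit b (wordToNat w) := rfl
    rw [this, Nat.size_bit (Nat.bit_ne_zero b (wordToNat_ne_zero w)), ih]
    simp

/-- Move the number at the front of the unary word in register `15` to register `14`. -/
def readUnary : Prog :=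
  .seq (.set 14 0) <| .seq (.arith .mod 13 15 8) <| .seq (.arith .div 15 15 8) <|
    .loop 13 <| .seq (.arith .add 14 14 9) <| .seq (.arith .mod 13 15 8) <|
      .seq (.arith .div 15 15 8) .skip

/-- The loop tests the letter popped last, so the invariant describes the word after that letter:
with `j > 0` iterations to come, `j - 1` letters `true` are still in front of it. -/
theorem readUnary_run {reg : ℕ → ℕ} {tape : List ℕ} {k : ℕ} {l : List ℕ} (h8 : reg 8 = 2)
    (h9 : reg 9 = 1) (h15 : reg 15 = wordToNat (unaryCode (k :: l))) :
    Run readUnary reg tape (5 * k + 8) fun reg' _ => reg' 14 = k ∧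
      reg' 15 = wordToNat (unaryCode l) ∧ ∀ x, x < 13 ∨ 15 < x → reg' x = reg x := by
  have hdiv : ∀ b w, wordToNat (b :: w) / 2 = wordToNat w := by
    intro b w; rw [wordToNat_cons]; cases b <;> simp only [Bool.toNat_true, Bool.toNat_false] <;> omega
  have hmod : ∀ b w, wordToNat (b :: w) % 2 = b.toNat := by
    intro b w; rw [wordToNat_cons]; cases b <;> simp
  unfold readUnary
  refine Run.mono (k := k * (4 + 1) + 1 + 7) ?run ?le
  case run =>
    refine Run.seq_set_small (by norm_num) (Run.seq_mod (Run.seq_div ?_))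
    refine Run.loop (n := k) (k := 4) (fun j r _ => r 8 = 2 ∧ r 9 = 1 ∧ r 14 + j = k ∧
      r 13 = (if j = 0 then 0 else 1) ∧
      r 15 = wordToNat (if j = 0 then unaryCode l else unaryCode ((j - 1) :: l)) ∧
      ∀ x, x < 13 ∨ 15 < x → r x = reg x) ?_ ?_ ?_
    · rintro j r t - ⟨i8, i9, i14, i13, i15, i⟩
      refine ⟨by simp [i13], ?_⟩
      refine Run.seq_add (Run.seq_mod (Run.seq_div (Run.skip ?_)))
      simp only [Nat.add_eq_zero_iff, one_ne_zero, and_false, if_false,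
        Nat.add_sub_cancel] at i13 i15 ⊢
      have e : unaryCode (j :: l) = if j = 0 then false :: unaryCode l else
          true :: unaryCode ((j - 1) :: l) := by
        cases j <;> simp [unaryCode, List.replicate_succ]
      rw [e] at i15
      refine ⟨by simpa using i8, by simpa using i9, by simp [i9]; omega, ?_, ?_, ?_⟩
      · simp [i8, i15]; split_ifs <;> simp [hmod]
      · simp [i8, i15]; split_ifs <;> simp [hdiv]
      · intro x hx
        rw [← i x hx]
        simp [show x ≠ 13 by omega, show x ≠ 14 by omega,
          show x ≠ 15 by omega]
    · rintro r t ⟨-, -, h1, h2, h3, h4⟩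
      exact ⟨h2, h1, h3, h4⟩
    · have e : unaryCode (k :: l) = if k = 0 then false :: unaryCode l else
          true :: unaryCode ((k - 1) :: l) := by
        cases k <;> simp [unaryCode, List.replicate_succ]
      rw [e] at h15
      refine ⟨by simpa using h8, by simpa using h9, by simp, ?_, ?_, ?_⟩
      · simp [h8, h15]; split_ifs <;> simp [hmod]
      · simp [h8, h15]; split_ifs <;> simp [hdiv]
      · intro x hx
        simp [show x ≠ 13 by omega, show x ≠ 14 by omega,
          show x ≠ 15 by omega]
  case le => omega

/-- Put the number in register `14` in front of the unary word in register `16`. -/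
def emitUnary : Prog :=
  .seq (.arith .add 16 16 16) <| .loop 14 <| .seq (.arith .add 16 16 16) <|
    .seq (.arith .add 16 16 9) <| .seq (.arith .sub 14 14 9) .skip

/-- Doubling prepends the letter `false`, and doubling plus one prepends `true`. Words therefore
grow at the front, and the terminating `false` is written first. -/
theorem emitUnary_run {reg : ℕ → ℕ} {tape : List ℕ} {k : ℕ} {l : List ℕ}
    (h9 : reg 9 = 1) (h14 : reg 14 = k) (h16 : reg 16 = wordToNat (unaryCode l)) :
    Run emitUnary reg tape (5 * k + 2) fun reg' _ => reg' 16 = wordToNat (unaryCode (k :: l)) ∧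
      ∀ x, x ≠ 14 → x ≠ 16 → reg' x = reg x := by
  unfold emitUnary
  refine Run.mono (k := k * (4 + 1) + 1 + 1) ?run ?le
  case run =>
    refine Run.seq_add ?_
    refine Run.loop (n := k) (k := 4) (fun j r _ => r 9 = 1 ∧ r 14 = j ∧
      r 16 = wordToNat (List.replicate (k - j) true ++ false :: unaryCode l) ∧
      ∀ x, x ≠ 14 → x ≠ 16 → r x = reg x) ?_ ?_ ?_
    · rintro j r t hj ⟨i9, i14, i16, i⟩
      refine ⟨by omega, ?_⟩
      refine Run.seq_add (Run.seq_add (Run.seq_sub (Run.skip ?_)))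
      refine ⟨by simpa using i9, by simp [i9, i14], ?_, ?_⟩
      · rw [show k - j = (k - (j + 1)) + 1 by omega, List.replicate_succ, List.cons_append,
          wordToNat_cons]
        simp [i9, i16]; omega
      · intro x h1 h2
        rw [← i x h1 h2]
        simp [h1, h2]
    · rintro r t ⟨-, h1, h2, h3⟩
      exact ⟨h1, h2, h3⟩
    · refine ⟨by simpa using h9, by simpa using h14, ?_, ?_⟩
      · simp [h16, wordToNat_cons]; omega
      · intro x h1 h2
        simp [h2]
  case le => omega

/-! ### Building the gadget -/

/-- The adjacency matrix of a bipartite graph, row by row. -/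
def BipGraph.adjList (B : BipGraph) : List ℕ := rowMajor fun u v => (B.adj u v).toNat

theorem BipGraph.adjList_eq (B : BipGraph) : B.adjList =
    List.ofFn fun k : Fin (B.left * B.right) => (B.adj k.divNat k.modNat).toNat := by
  unfold BipGraph.adjList rowMajor
  rw [List.ofFn_mul]
  congr 2
  funext i
  congr 1
  funext j
  have hj := j.2
  have e1 : (⟨i * B.right + j, by nlinarith [i.2, j.2]⟩ : Fin (B.left * B.right)).divNat = i := by
    apply Fin.ext
    simp only [Fin.coe_divNat]
    rw [mul_comm, Nat.mul_add_div (by omega), Nat.div_eq_of_lt hj, add_zero]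
  have e2 : (⟨i * B.right + j, by nlinarith [i.2, j.2]⟩ : Fin (B.left * B.right)).modNat = j := by
    apply Fin.ext
    simp only [Fin.coe_modNat]
    rw [mul_comm, Nat.mul_add_mod, Nat.mod_eq_of_lt hj]
  rw [e1, e2]

theorem BipGraph.length_adjList (B : BipGraph) : B.adjList.length = B.left * B.right := by
  rw [B.adjList_eq, List.length_ofFn]

theorem BipGraph.adjList_le_one (B : BipGraph) {k : ℕ} (hk : k < B.adjList.length) :
    B.adjList[k] ≤ 1 := by
  simp only [B.adjList_eq, List.getElem_ofFn]
  exact Bool.toNat_le _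

theorem BipGraph.adjList_getElem (B : BipGraph) (u : Fin B.left) (v : Fin B.right)
    (h : u * B.right + v < B.adjList.length) :
    B.adjList[u * B.right + v] = (B.adj u v).toNat := by
  have hv := v.2
  simp only [B.adjList_eq, List.getElem_ofFn]
  have e1 : (⟨u * B.right + v, by nlinarith [u.2, v.2]⟩ : Fin (B.left * B.right)).divNat = u := by
    apply Fin.ext
    simp only [Fin.coe_divNat]
    rw [mul_comm, Nat.mul_add_div (by omega), Nat.div_eq_of_lt hv, add_zero]
  have e2 : (⟨u * B.right + v, by nlinarith [u.2, v.2]⟩ : Fin (B.left * B.right)).modNat = v := by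
    apply Fin.ext
    simp only [Fin.coe_modNat]
    rw [mul_comm, Nat.mul_add_mod, Nat.mod_eq_of_lt hv]
  rw [e1, e2]

/-- Store the entry of the adjacency matrix in row `19`, column `22` in register `14`. -/
def lookup : Prog :=
  .seq (.arith .mul 21 19 5) <| .seq (.arith .add 21 21 22) <| .seq (.arith .add 15 0 3) <|
    .seq (.loop 21 <| .seq readUnary <| .seq (.arith .sub 21 21 9) .skip) readUnary

/-- The matrix is scanned from its first entry on a copy of the word. Entries are 0 or 1, so
skipping one takes a bounded number of steps, and at most `B.left * B.right` of them are passed. -/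
theorem lookup_run {B : BipGraph} {reg : ℕ → ℕ} {tape : List ℕ} (h3 : reg 3 = 0) (h8 : reg 8 = 2)
    (h9 : reg 9 = 1) (h0 : reg 0 = wordToNat (unaryCode B.adjList)) (h5 : reg 5 = B.right)
    (u : Fin B.left) (v : Fin B.right) (h19 : reg 19 = u) (h22 : reg 22 = v) :
    Run lookup reg tape (17 * (B.left * B.right) + 20) fun reg' _ =>
      reg' 14 = (B.adj u v).toNat ∧ ∀ x, x < 13 ∨ 15 < x → x ≠ 21 → reg' x = reg x := by
  have hlt : u * B.right + v < B.adjList.length := by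
    rw [B.length_adjList]; nlinarith [u.2, v.2]
  have hlt' : u * B.right + v < B.left * B.right := by rwa [B.length_adjList] at hlt
  have hm : u * B.right ≤ B.left * B.right := by omega
  set i : ℕ := u * B.right + v with hi
  unfold lookup
  refine Run.mono (k := (i * (15 + 1) + 1 + 13) + 1 + 1 + (1 + B.left * B.right)) ?_ (by omega)
  refine Run.seq_mul ((Nat.size_le.2 (Nat.lt_two_pow_self)).trans
    (by rw [h19, h5]; exact hm)) (Run.seq_add (Run.seq_add
    (Run.seq (k := i * (15 + 1) + 1) (k' := 13) ?_)))
  refine Run.loop (n := i) (k := 15) (fun j r _ => r 8 = 2 ∧ r 9 = 1 ∧ r 21 = j ∧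
      r 15 = wordToNat (unaryCode (B.adjList.drop (i - j))) ∧
      ∀ x, x < 13 ∨ 15 < x → x ≠ 21 → r x = reg x) ?_ ?_ ?_
  · rintro j r t hj ⟨i8, i9, i21, i15, i'⟩
    refine ⟨by omega, ?_⟩
    have hlen : i - (j + 1) < B.adjList.length := by omega
    rw [List.drop_eq_getElem_cons hlen] at i15
    refine Run.mono (k := (5 * B.adjList[i - (j + 1)] + 8) + (1 + 1)) (Run.seq ?_)
      (by have := B.adjList_le_one hlen; omega)
    refine (readUnary_run i8 i9 i15).imp ?_
    rintro r' t' ⟨-, a15, a⟩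
    refine Run.seq_sub (Run.skip ?_)
    refine ⟨?_, ?_, ?_, ?_, ?_⟩
    · simp [a 8, i8]
    · simp [a 9, i9]
    · simp [a 9, i9, a 21, i21]
    · simp [a15, show i - (j + 1) + 1 = i - j by omega]
    · intro x hx hx'
      rw [← i' x hx hx', ← a x hx, Function.update_of_ne hx']
  · rintro r t ⟨i8, i9, i21, i15, i'⟩
    refine ⟨i21, ?_⟩
    rw [Nat.sub_zero, List.drop_eq_getElem_cons hlt, B.adjList_getElem] at i15
    refine ((readUnary_run i8 i9 i15).mono ?_).imp ?_
    · have := Bool.toNat_le (B.adj u v)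
      omega
    · rintro r' t' ⟨a14, -, a⟩
      exact ⟨a14, fun x hx hx' => (a x hx).trans (i' x hx hx')⟩
  · refine ⟨by simpa using h8, by simpa using h9, by simp [h19, h5, h22, hi], by simp [h0, h3], ?_⟩
    intro x hx hx'
    simp [hx', show x ≠ 15 by omega]

/-- Store the number `link x y` in register `14`, where `x` and `y` are in `19` and `20`. -/
def linkProg : Prog :=
  .seq (.arith .sub 21 19 20) <| .seq (.arith .sub 22 20 19) <| .seq (.arith .add 21 21 22) <|
    .ite 21
      (.seq (.arith .sub 21 4 19) <| .ite 21
        (.seq (.arith .add 22 20 9) <| .seq (.arith .sub 22 22 4) <| .ite 22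
          (.seq (.arith .sub 22 22 9) lookup)
          (.seq (.set 14 0) .skip))
        (.seq (.set 14 0) .skip))
      (.seq (.set 14 1) .skip)

/-- Comparisons are made by truncated subtraction: (x - y) + (y - x) vanishes iff x = y, `left - x`
is positive iff x < left, and `y + 1 - left` is positive iff left ≤ y. In the last case it exceeds
the column index by one. -/
theorem linkProg_run {B : BipGraph} {reg : ℕ → ℕ} {tape : List ℕ} (h3 : reg 3 = 0) (h8 : reg 8 = 2)
    (h9 : reg 9 = 1) (h0 : reg 0 = wordToNat (unaryCode B.adjList)) (h4 : reg 4 = B.left)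
    (h5 : reg 5 = B.right) (hy : reg 20 < B.order) :
    Run linkProg reg tape (17 * (B.left * B.right) + 31) fun reg' _ =>
      reg' 14 = B.link (reg 19) (reg 20) ∧
        ∀ x, x < 13 ∨ 15 < x → x ≠ 21 → x ≠ 22 → reg' x = reg x := by
  unfold linkProg
  have hset : ∀ (r : ℕ → ℕ) (c : ℕ), c < 16 → c = B.link (reg 19) (reg 20) →
      (∀ x, x < 13 ∨ 15 < x → x ≠ 21 → x ≠ 22 → r x = reg x) →
      Run (.seq (.set 14 c) .skip) r tape 6 fun reg' _ =>
      reg' 14 = B.link (reg 19) (reg 20) ∧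
        ∀ x, x < 13 ∨ 15 < x → x ≠ 21 → x ≠ 22 → reg' x = reg x := by
    intro r c hc h h'
    refine Run.seq_set_small (k := 1) hc (Run.skip ⟨by simpa using h, fun x h1 h2 h3 => ?_⟩)
    rw [Function.update_of_ne (by omega), h' x h1 h2 h3]
  refine Run.mono (k := (17 * (B.left * B.right) + 20 + 1 + 1 + 2 + 1 + 1) + 1 + 3) ?_ (by omega)
  refine Run.seq_sub (Run.seq_sub (Run.seq_add (Run.ite ?_ ?_)))
  · intro h1
    simp at h1
    refine Run.seq_sub (Run.ite ?_ ?_)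
    · intro h2
      simp [h4] at h2
      refine Run.seq_add (Run.seq_sub (Run.ite ?_ ?_))
      · intro h22
        simp [h9, h4] at h22
        refine Run.seq_sub ?_
        have hyl : B.left ≤ reg 20 := by omega
        have hyr : reg 20 - B.left < B.right := by unfold BipGraph.order at hy; omega
        refine ((lookup_run (B := B) (u := ⟨reg 19, by omega⟩) (v := ⟨reg 20 - B.left, hyr⟩)
          ?_ ?_ ?_ ?_ ?_ ?_ ?_).mono (by omega)).imp ?_
        · simpa using h3
        · simpa using h8
        · simpa using h9
        · simpa using h0
        · simpa using h5
        · simp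
        · simp [h9, h4]; omega
        · rintro r t ⟨a14, a⟩
          refine ⟨?_, fun x hx hx' hx'' => ?_⟩
          · rw [a14]
            unfold BipGraph.link
            rw [if_neg (by omega), dif_pos ⟨by omega, hyl, hy⟩]
          · rw [a x hx hx']
            simp [hx', hx'']
      · intro h22
        simp [h9, h4] at h22
        refine (hset _ 0 (by norm_num) ?_ ?_).mono (by omega)
        · unfold BipGraph.link
          rw [if_neg (by omega), dif_neg (by omega)]
        · intro x _ hx' hx''
          simp [hx', hx'']
    · intro h2
      simp [h4] at h2
      refine (hset _ 0 (by norm_num) ?_ ?_).mono (by omega)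
      · unfold BipGraph.link
        rw [if_neg (by omega), dif_neg (by omega)]
      · intro x _ hx' hx''
        simp [hx', hx'']
  · intro h1
    simp at h1
    refine (hset _ 1 (by norm_num) ?_ ?_).mono (by omega)
    · unfold BipGraph.link
      rw [if_pos (by omega)]
    · intro x _ hx' hx''
      simp [hx', hx'']

theorem List.ofFn_val_eq_map_range {α : Type} (n : ℕ) (g : ℕ → α) :
    List.ofFn (fun i : Fin n => g i) = (List.range n).map g := by
  apply List.ext_getElem <;> simp

/-- The row of the incidence list of the gadget that belongs to the vertex `x`. -/
def BipGraph.gadgetRow (B : BipGraph) (m x : ℕ) (i : ℕ) : List ℕ :=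
  ((List.range (m * B.order + 1)).drop i).map fun i => i * B.link x ((i - 1) % B.order)

/-- The rows of the incidence list of the gadget, from the row `f` on. -/
def BipGraph.gadgetRows (B : BipGraph) (m : ℕ) (f : ℕ) : List ℕ :=
  ((List.range (m * B.order)).drop f).flatMap fun f => B.gadgetRow m (f % B.order) 0

theorem BipGraph.gadget_code (B : BipGraph) (m : ℕ) : (B.gadget m).code =
    unaryCode ((m * B.order + 1) :: (m * B.order) :: (m * B.order + 1) :: B.gadgetRows m 0) := by
  have h : rowMajor (fun f i => ((B.gadget m).vert f i : ℕ)) = B.gadgetRows m 0 := by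
    unfold rowMajor BipGraph.gadgetRows
    rw [List.drop_zero, List.flatMap_def, ← List.ofFn_val_eq_map_range]
    congr 1
    refine congrArg List.ofFn (funext fun f => ?_)
    unfold BipGraph.gadgetRow
    rw [List.drop_zero, ← List.ofFn_val_eq_map_range]
    rfl
  unfold UniformHypergraph.code
  rw [h]
  rfl

theorem BipGraph.gadgetRow_of_le (B : BipGraph) (m x : ℕ) {i : ℕ} (hi : m * B.order < i) :
    B.gadgetRow m x i = [] := by
  unfold BipGraph.gadgetRow
  rw [List.drop_eq_nil_of_le (by simp; omega), List.map_nil]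

theorem BipGraph.gadgetRow_eq_cons (B : BipGraph) (m x : ℕ) {i : ℕ} (hi : i ≤ m * B.order) :
    B.gadgetRow m x i = (i * B.link x ((i - 1) % B.order)) :: B.gadgetRow m x (i + 1) := by
  unfold BipGraph.gadgetRow
  rw [List.drop_eq_getElem_cons (by simp; omega), List.map_cons, List.getElem_range]

theorem BipGraph.gadgetRows_of_le (B : BipGraph) (m : ℕ) {f : ℕ} (hf : m * B.order ≤ f) :
    B.gadgetRows m f = [] := by
  unfold BipGraph.gadgetRows
  rw [List.drop_eq_nil_of_le (by simpa using hf), List.flatMap_nil]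

theorem BipGraph.gadgetRows_eq_append (B : BipGraph) (m : ℕ) {f : ℕ} (hf : f < m * B.order) :
    B.gadgetRows m f = B.gadgetRow m (f % B.order) 0 ++ B.gadgetRows m (f + 1) := by
  unfold BipGraph.gadgetRows
  rw [List.drop_eq_getElem_cons (by simpa using hf), List.flatMap_cons, List.getElem_range]

/-- Put one entry of the incidence list of the gadget in front of the word in register `16`. -/
def gadgetEntry : Prog :=
  .seq (.arith .sub 18 18 9) <| .seq (.arith .sub 20 18 9) <| .seq (.arith .mod 20 20 6) <|
    .seq linkProg <| .seq (.ite 14 (.seq (.arith .add 14 18 3) .skip) .skip) emitUnary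

/-- Put one row of the incidence list of the gadget in front of the word in register `16`. -/
def gadgetRowProg : Prog :=
  .seq (.arith .sub 17 17 9) <| .seq (.arith .mod 19 17 6) <| .seq (.arith .add 18 7 9) <|
    .loop 18 gadgetEntry

/-- Store the code of the gadget in register `16`. -/
def gadgetProg : Prog :=
  .seq (.set 16 1) <| .seq (.arith .add 17 7 3) <| .seq (.loop 17 gadgetRowProg) <|
    .seq (.arith .add 14 7 9) <| .seq emitUnary <| .seq (.arith .add 14 7 3) <| .seq emitUnary <|
      .seq (.arith .add 14 7 9) emitUnary

/-- The registers contain the constants and a bipartite graph. -/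
structure HoldsGraph (B : BipGraph) (m : ℕ) (reg : ℕ → ℕ) : Prop where
  h3 : reg 3 = 0
  h8 : reg 8 = 2
  h9 : reg 9 = 1
  h0 : reg 0 = wordToNat (unaryCode B.adjList)
  h4 : reg 4 = B.left
  h5 : reg 5 = B.right
  h6 : reg 6 = B.order
  h7 : reg 7 = m * B.order

theorem HoldsGraph.congr {B : BipGraph} {m : ℕ} {reg reg' : ℕ → ℕ} (h : HoldsGraph B m reg)
    (h' : ∀ x, x < 10 → reg' x = reg x) : HoldsGraph B m reg' := by
  constructor
  · rw [h' _ (by norm_num), h.h3]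
  · rw [h' _ (by norm_num), h.h8]
  · rw [h' _ (by norm_num), h.h9]
  · rw [h' _ (by norm_num), h.h0]
  · rw [h' _ (by norm_num), h.h4]
  · rw [h' _ (by norm_num), h.h5]
  · rw [h' _ (by norm_num), h.h6]
  · rw [h' _ (by norm_num), h.h7]

/-- Since `link` is 0 or 1, the product with `i` is formed by a branch: register `14` is overwritten
by `i` or already holds 0. For `i = 0` the truncated `i - 1` is 0, exactly as in `vert`, and the
entry is 0 anyway. -/
theorem gadgetEntry_run {B : BipGraph} {m : ℕ} {reg : ℕ → ℕ} {tape : List ℕ}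
    (hB : HoldsGraph B m reg) (hn : 0 < B.order) {i x : ℕ} {l : List ℕ} (hi : i ≤ m * B.order)
    (h18 : reg 18 = i + 1) (h19 : reg 19 = x)
    (h16 : reg 16 = wordToNat (unaryCode (B.gadgetRow m x (i + 1) ++ l))) :
    Run gadgetEntry reg tape (17 * (B.left * B.right) + 5 * (m * B.order) + 40) fun reg' _ =>
      reg' 16 = wordToNat (unaryCode (B.gadgetRow m x i ++ l)) ∧ reg' 18 = i ∧
        ∀ y, y < 13 ∨ y = 17 ∨ y = 19 ∨ 22 < y → reg' y = reg y := by
  unfold gadgetEntry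
  refine Run.mono (k := (17 * (B.left * B.right) + 31) + (3 + (5 * (m * B.order) + 2)) + 3) ?_
    (by omega)
  refine Run.seq_sub (Run.seq_sub (Run.seq_mod (Run.seq ?_)))
  refine (linkProg_run (B := B) ?_ ?_ ?_ ?_ ?_ ?_ ?_).imp ?_
  · simpa using hB.h3
  · simpa using hB.h8
  · simpa using hB.h9
  · simpa using hB.h0
  · simpa using hB.h4
  · simpa using hB.h5
  · simp [hB.h6, Nat.mod_lt _ hn]
  · rintro r t ⟨a14, a⟩
    simp [hB.h9, hB.h6, h18, h19] at a14
    have hle := B.link_le_one x ((i - 1) % B.order)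
    have hr : ∀ y, y < 13 ∨ y = 17 ∨ y = 19 ∨ 22 < y → r y = reg y := by
      intro y hy
      rw [a y (by omega) (by omega) (by omega)]
      simp [show y ≠ 18 by omega, show y ≠ 20 by omega]
    have hr18 : r 18 = i := by
      rw [a 18 (by norm_num) (by norm_num) (by norm_num)]
      simp [h18, hB.h9]
    have hr16 : r 16 = reg 16 := by
      rw [a 16 (by norm_num) (by norm_num) (by norm_num)]
      simp
    have key : ∀ r' : ℕ → ℕ, r' 14 = i * B.link x ((i - 1) % B.order) →
        (∀ y, y ≠ 14 → r' y = r y) → ∀ t', Run emitUnary r' t' (5 * (m * B.order) + 2) fun reg' _ =>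
          reg' 16 = wordToNat (unaryCode (B.gadgetRow m x i ++ l)) ∧ reg' 18 = i ∧
          ∀ y, y < 13 ∨ y = 17 ∨ y = 19 ∨ 22 < y → reg' y = reg y := by
      intro r' h14 h' t'
      refine ((emitUnary_run (l := B.gadgetRow m x (i + 1) ++ l) ?_ h14 ?_).mono ?_).imp ?_
      · rw [h' 9 (by norm_num), hr 9 (by norm_num), hB.h9]
      · rw [h' 16 (by norm_num), hr16, h16]
      · have : i * B.link x ((i - 1) % B.order) ≤ i * 1 := Nat.mul_le_mul_left _ hle
        omega
      · rintro r'' t'' ⟨b16, b⟩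
        refine ⟨?_, ?_, ?_⟩
        · rw [b16, B.gadgetRow_eq_cons m x hi, List.cons_append]
        · rw [b 18 (by norm_num) (by norm_num), h' 18 (by norm_num), hr18]
        · intro y hy
          rw [b y (by omega) (by omega), h' y (by omega), hr y hy]
    refine Run.seq (k := 3) (Run.ite (k := 2) ?_ ?_)
    · intro h1
      rw [a14] at h1
      refine Run.seq_add (Run.skip ?_)
      refine key _ ?_ (fun y hy => by simp [hy]) _
      have h2 : B.link x ((i - 1) % B.order) = 1 := by omega
      simp [hr18, hr 3, hB.h3, h2]
    · intro h1
      refine (Run.skip ?_).mono (by norm_num)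
      refine key _ ?_ (fun y hy => rfl) _
      rw [h1, a14.symm.trans h1, mul_zero]

/-- As words grow at the front, the positions of a row are visited from the last down to 0. The
counter in register `18` starts one above the last position and is decremented before use. -/
theorem gadgetRowProg_run {B : BipGraph} {m : ℕ} {reg : ℕ → ℕ} {tape : List ℕ}
    (hB : HoldsGraph B m reg) {f : ℕ} (hf : f < m * B.order) (h17 : reg 17 = f + 1)
    (h16 : reg 16 = wordToNat (unaryCode (B.gadgetRows m (f + 1)))) :
    Run gadgetRowProg reg tape
      ((m * B.order + 1) * (17 * (B.left * B.right) + 5 * (m * B.order) + 40 + 1) + 1 + 3)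
      fun reg' _ => reg' 16 = wordToNat (unaryCode (B.gadgetRows m f)) ∧ reg' 17 = f ∧
        ∀ y, y < 13 ∨ 22 < y → reg' y = reg y := by
  have hn : 0 < B.order := Nat.pos_of_ne_zero fun h => by simp [h] at hf
  unfold gadgetRowProg
  refine Run.seq_sub (Run.seq_mod (Run.seq_add ?_))
  refine Run.loop (fun i r _ => r 18 = i ∧ r 17 = f ∧ r 19 = f % B.order ∧
    r 16 = wordToNat (unaryCode (B.gadgetRow m (f % B.order) i ++ B.gadgetRows m (f + 1))) ∧
    ∀ y, y < 13 ∨ 22 < y → r y = reg y) ?_ ?_ ?_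
  · rintro i r t hi ⟨i18, i17, i19, i16, i'⟩
    refine ⟨by omega, ?_⟩
    refine (gadgetEntry_run (hB.congr fun x hx => i' x (by omega)) hn (by omega) i18 i19 i16).imp ?_
    rintro r' t' ⟨b16, b18, b⟩
    refine ⟨b18, ?_, ?_, b16, fun y hy => ?_⟩
    · rw [b 17 (by norm_num), i17]
    · rw [b 19 (by norm_num), i19]
    · rw [b y (by omega), i' y hy]
  · rintro r t ⟨i18, i17, -, i16, i'⟩
    refine ⟨i18, ?_, i17, i'⟩
    rw [i16, B.gadgetRows_eq_append m hf]
  · refine ⟨?_, ?_, ?_, ?_, ?_⟩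
    · simp [hB.h7, hB.h9]
    · simp [hB.h9, h17]
    · simp [hB.h9, h17, hB.h6]
    · rw [B.gadgetRow_of_le m _ (by omega), List.nil_append]
      simp [h16]
    · intro y hy
      simp [show y ≠ 17 by omega, show y ≠ 18 by omega, show y ≠ 19 by omega]

theorem gadgetProg_run {B : BipGraph} {m : ℕ} {reg : ℕ → ℕ} {tape : List ℕ}
    (hB : HoldsGraph B m reg) :
    Run gadgetProg reg tape
      (m * B.order * ((m * B.order + 1) * (17 * (B.left * B.right) + 5 * (m * B.order) + 40 + 1) +
        1 + 3 + 1) + 15 * (m * B.order) + 40)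
      fun reg' _ => reg' 16 = wordToNat (B.gadget m).code ∧
        ∀ y, y < 13 ∨ 22 < y → reg' y = reg y := by
  unfold gadgetProg
  set c := (m * B.order + 1) * (17 * (B.left * B.right) + 5 * (m * B.order) + 40 + 1) + 1 + 3 with hc
  refine Run.mono (k := ((m * B.order * (c + 1) + 1) + (5 * (m * B.order + 1) + 2 + (5 * (m * B.order)
    + 2 + (5 * (m * B.order + 1) + 2 + 1) + 1) + 1)) + 6) ?_ (by omega)
  refine Run.seq_set_small (by norm_num) (Run.seq_add
    (Run.seq (k := m * B.order * (c + 1) + 1) ?_))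
  refine Run.loop (fun f r _ => r 17 = f ∧ r 16 = wordToNat (unaryCode (B.gadgetRows m f)) ∧
    ∀ y, y < 13 ∨ 22 < y → r y = reg y) ?_ ?_ ?_
  · rintro f r t hf ⟨i17, i16, i'⟩
    refine ⟨by omega, ?_⟩
    refine (gadgetRowProg_run (hB.congr fun x hx => i' x (by omega)) hf i17 i16).imp ?_
    rintro r' t' ⟨b16, b17, b⟩
    exact ⟨b17, b16, fun y hy => (b y hy).trans (i' y hy)⟩
  · rintro r t ⟨i17, i16, i'⟩
    refine ⟨i17, Run.seq_add (Run.seq ?_)⟩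
    refine (emitUnary_run (k := m * B.order + 1) (l := B.gadgetRows m 0) ?_ ?_ ?_).imp ?_
    · simp [i' 9, hB.h9]
    · simp [i' 9, hB.h9, i' 7, hB.h7]
    · simp [i16]
    rintro r1 t1 ⟨b16, b⟩
    have hb : ∀ y, y < 13 ∨ 22 < y → r1 y = reg y := fun y hy => by
      rw [b y (by omega) (by omega), Function.update_of_ne (by omega), i' y hy]
    refine Run.seq_add (Run.seq ?_)
    refine (emitUnary_run (k := m * B.order) ?_ ?_ (by simpa using b16)).imp ?_
    · simp [hb 9, hB.h9]
    · simp [hb 3, hB.h3, hb 7, hB.h7]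
    rintro r2 t2 ⟨d16, d⟩
    have hd : ∀ y, y < 13 ∨ 22 < y → r2 y = reg y := fun y hy => by
      rw [d y (by omega) (by omega), Function.update_of_ne (by omega), hb y hy]
    refine Run.seq_add ?_
    refine (emitUnary_run (k := m * B.order + 1) ?_ ?_ (by simpa using d16)).imp ?_
    · simp [hd 9, hB.h9]
    · simp [hd 9, hB.h9, hd 7, hB.h7]
    rintro r3 t3 ⟨e16, e⟩
    refine ⟨by rw [e16, B.gadget_code], fun y hy => ?_⟩
    rw [e y (by omega) (by omega), Function.update_of_ne (by omega), hd y hy]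
  · refine ⟨by simp [hB.h7, hB.h3], ?_, fun y hy => ?_⟩
    · rw [B.gadgetRows_of_le m le_rfl]
      simp [unaryCode, wordToNat]
    · simp [show y ≠ 17 by omega, show y ≠ 16 by omega]

/-! ### Reading rational numbers from the tape -/

/-- The two-track binary digits of a pair of natural numbers. -/
def pairDigits (a b l : ℕ) : List ℕ :=
  (List.range l).map fun i => 2 * (a.testBit (l - 1 - i)).toNat + (b.testBit (l - 1 - i)).toNat

theorem ratTape_eq (z : ℚ) : ratTape z = (if z < 0 then 1 else 0) ::
    pairDigits z.num.natAbs z.den (max z.num.natAbs.size z.den.size) := rfl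

theorem length_pairDigits (a b l : ℕ) : (pairDigits a b l).length = l := by simp [pairDigits]

theorem pairDigits_drop {a b l i : ℕ} (hi : i < l) : (pairDigits a b l).drop i =
    (2 * (a / 2 ^ (l - (i + 1)) % 2) + b / 2 ^ (l - (i + 1)) % 2) ::
      (pairDigits a b l).drop (i + 1) := by
  rw [List.drop_eq_getElem_cons (by rw [length_pairDigits]; exact hi)]
  congr 1
  simp only [pairDigits, List.getElem_map, List.getElem_range, Nat.toNat_testBit]
  rw [show l - 1 - i = l - (i + 1) by omega]

/-- One step of Horner's scheme: the number formed by the leading digits is a quotient by a power of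
two, and reading another digit doubles it and adds that digit. -/
theorem div_two_pow_step (a t : ℕ) : a / 2 ^ t = 2 * (a / 2 ^ (t + 1)) + a / 2 ^ t % 2 := by
  rw [pow_succ, ← Nat.div_div_eq_div_mul]
  omega

/-- Read the tolerance `ε` from the tape and store a number `b` with `1 / (b + 1) < ε` in
register `14`. -/
def readTol : Prog :=
  .seq (.set 14 0) <| .seq (.read 13) <| .seq (.set 16 1) <| .loop 16 <| .seq (.read 13) <|
    .seq (.arith .div 15 13 8) <| .seq (.arith .mod 13 13 8) <| .seq (.arith .add 14 14 14) <|
      .seq (.arith .add 14 14 13) <| .seq (.arith .sub 16 9 15) .skip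

/-- For ε = u / v let w be the largest power of two that is at most u, so w ≤ u < 2w, and take b = v
/ w. Then v < (b+1)w ≤ (b+1)u gives 1/(b+1) < ε, and bu ≤ 2bw ≤ 2v gives b ≤ 2/ε. The quotient by w
is just the prefix of v that stands beside the leading digit of u, so reading stops at the first 1
of the numerator. -/
theorem readTol_run {reg : ℕ → ℕ} {ε : ℚ} (hε : 0 < ε) (h8 : reg 8 = 2) (h9 : reg 9 = 1) :
    ∃ b : ℕ, 1 / ((b : ℚ) + 1) < ε ∧ b ≤ 2 * ⌈ε⁻¹⌉₊ ∧
      Run readTol reg (ratTape ε) (8 * b + 20) fun reg' _ => reg' 14 = b ∧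
        ∀ x, x < 13 ∨ 16 < x → reg' x = reg x := by
  have hnum : 0 < ε.num := Rat.num_pos.2 hε
  set u := ε.num.natAbs with hu
  have hu0 : 0 < u := by omega
  set v := ε.den with hv
  have hv0 : 0 < v := ε.den_pos
  have huv : ε = (u : ℚ) / v := by
    conv_lhs => rw [← Rat.num_div_den ε]
    rw [hu, hv]
    congr 1
    rw [Nat.cast_natAbs, abs_of_pos hnum]
  have hs : 0 < u.size := Nat.size_pos.2 hu0
  set l := max u.size v.size with hl
  have hlu : u.size ≤ l := le_max_left _ _
  have hu1 : 2 ^ (u.size - 1) ≤ u := Nat.lt_size.1 (by omega)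
  have hu2 : u < 2 * 2 ^ (u.size - 1) := by
    rw [← pow_succ', Nat.sub_add_cancel hs]; exact Nat.lt_size_self u
  set w := 2 ^ (u.size - 1) with hw
  have hw0 : 0 < w := by positivity
  set b := v / w with hb
  have hb1 : b * w ≤ v := Nat.div_mul_le_self v w
  have hb2 : v < (b + 1) * w := (Nat.div_lt_iff_lt_mul hw0).1 (Nat.lt_succ_self _)
  have hu0' : (0 : ℚ) < u := by exact_mod_cast hu0
  have hv0' : (0 : ℚ) < v := by exact_mod_cast hv0
  have hw0' : (0 : ℚ) < w := by exact_mod_cast hw0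
  refine ⟨b, ?_, ?_, ?_⟩
  · rw [huv, div_lt_div_iff₀ (by positivity) hv0', one_mul]
    have : v < u * (b + 1) := by nlinarith
    exact_mod_cast this
  · have h1 : (b : ℚ) * ε ≤ 2 := by
      rw [huv, ← mul_div_assoc, div_le_iff₀ hv0']
      have : b * u ≤ 2 * v := by nlinarith
      exact_mod_cast this
    have h2 : (b : ℚ) ≤ 2 * ε⁻¹ := by
      rw [← div_eq_mul_inv, le_div_iff₀ hε]; exact h1
    have h3 := Nat.le_ceil ε⁻¹
    have h4 : (b : ℚ) ≤ ((2 * ⌈ε⁻¹⌉₊ : ℕ) : ℚ) := by push_cast; linarith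
    exact_mod_cast h4
  · set t := l - u.size + 1 with ht
    -- If v is longer than u by d bits, then b ≥ 2^d > d; this bounds the number of symbols read.
    have htb : t ≤ b + 1 := by
      by_cases hc : v.size ≤ u.size
      · rw [ht, hl, max_eq_left hc, Nat.sub_self]; exact Nat.add_le_add_right (Nat.zero_le b) 1
      · push Not at hc
        have h1 : l = v.size := max_eq_right hc.le
        have h2 : 2 ^ (v.size - 1) ≤ v := Nat.lt_size.1 (by omega)
        have h3 : 2 ^ (v.size - u.size) ≤ b := by
          rw [hb, Nat.le_div_iff_mul_le hw0, hw, ← pow_add]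
          rwa [show v.size - u.size + (u.size - 1) = v.size - 1 by omega]
        have h4 := Nat.lt_two_pow_self (n := v.size - u.size)
        omega
    unfold readTol
    refine Run.mono (k := (t * (7 + 1) + 1) + 11) ?_ (by omega)
    rw [ratTape_eq, ← hu, ← hv, ← hl]
    refine Run.seq_set_small (by norm_num) (Run.seq_read (Run.seq_set_small (by norm_num) ?_))
    refine Run.loop (n := t) (k := 7) (fun j r tp => r 8 = 2 ∧ r 9 = 1 ∧
      r 16 = (if j = 0 then 0 else 1) ∧ r 14 = v / 2 ^ (l - (t - j)) ∧
      tp = (pairDigits u v l).drop (t - j) ∧ ∀ x, x < 13 ∨ 16 < x → r x = reg x) ?_ ?_ ?_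
    · rintro j r tp hj ⟨i8, i9, i16, i14, itp, i⟩
      refine ⟨by simp [i16], ?_⟩
      rw [pairDigits_drop (by omega), show t - (j + 1) + 1 = t - j by omega] at itp
      subst itp
      refine Run.seq_read (Run.seq_div (Run.seq_mod (Run.seq_add (Run.seq_add (Run.seq_sub
        (Run.skip ?_))))))
      -- The numerator shows zeros until the last iteration, which meets its leading 1.
      have hub : u / 2 ^ (l - (t - j)) % 2 = if j = 0 then 1 else 0 := by
        split_ifs with h0
        · have e : l - (t - j) = u.size - 1 := by omega
          rw [e, ← hw]
          have h1 : u / w = 1 := by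
            apply Nat.div_eq_of_lt_le <;> omega
          rw [h1]
        · rw [Nat.div_eq_of_lt]
          refine lt_of_lt_of_le (Nat.lt_size_self u) (Nat.pow_le_pow_right (by norm_num) ?_)
          omega
      have hvb := Nat.mod_lt (v / 2 ^ (l - (t - j))) (show 0 < 2 by norm_num)
      refine ⟨by simpa using i8, by simpa using i9, ?_, ?_, rfl, ?_⟩
      · simp only [List.headD_cons]
        simp [i8, i9]
        rw [show (2 * (u / 2 ^ (l - (t - j)) % 2) + v / 2 ^ (l - (t - j)) % 2) / 2 =
          u / 2 ^ (l - (t - j)) % 2 by omega, hub]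
        split_ifs <;> rfl
      · simp only [List.headD_cons]
        simp [i8, i14]
        rw [div_two_pow_step v (l - (t - j)), show l - (t - j) + 1 = l - (t - (j + 1)) by omega]
        omega
      · intro x hx
        rw [← i x hx]
        simp [show x ≠ 13 by omega, show x ≠ 14 by omega, show x ≠ 15 by omega,
          show x ≠ 16 by omega]
    · rintro r tp ⟨-, -, i16, i14, -, i⟩
      refine ⟨i16, ?_, i⟩
      rw [i14, show l - (t - 0) = u.size - 1 by omega]
    · refine ⟨by simpa using h8, by simpa using h9, by simp [ht], ?_, by simp, ?_⟩
      · simp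
        rw [Nat.div_eq_of_lt]
        exact lt_of_lt_of_le (Nat.lt_size_self v)
          (Nat.pow_le_pow_right (by norm_num) (le_max_right _ _))
      · intro x hx
        simp [show x ≠ 13 by omega, show x ≠ 14 by omega, show x ≠ 16 by omega]

/-! ### Preparing the oracle calls -/

theorem length_unaryCode (l : List ℕ) : (unaryCode l).length = l.sum + l.length := by
  induction l with
  | nil => rfl
  | cons k l ih => simp [unaryCode, ih]; omega

theorem BipGraph.order_le_length_code (B : BipGraph) : B.order ≤ B.code.length := by
  unfold BipGraph.code BipGraph.order
  rw [length_unaryCode]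
  simp
  omega

theorem UniformHypergraph.isolated_code (N : ℕ) :
    (isolated N).code = unaryCode [N + 1, 0, 1] := by
  unfold UniformHypergraph.code
  simp [isolated, rowMajor]

/-- Parse the graph in register `0`. -/
def parseProg : Prog :=
  .seq (.arith .add 15 0 3) <| .seq readUnary <| .seq (.arith .add 4 14 3) <| .seq readUnary <|
    .seq (.arith .add 5 14 3) <| .seq (.arith .add 0 15 3) .skip

theorem parseProg_run {B : BipGraph} {reg : ℕ → ℕ} {tape : List ℕ} (h3 : reg 3 = 0)
    (h8 : reg 8 = 2) (h9 : reg 9 = 1) (h0 : reg 0 = wordToNat B.code) :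
    Run parseProg reg tape (5 * B.order + 21) fun reg' _ =>
      reg' 0 = wordToNat (unaryCode B.adjList) ∧ reg' 4 = B.left ∧ reg' 5 = B.right ∧
        ∀ x, x ≠ 0 → x ≠ 4 → x ≠ 5 → x < 13 ∨ 15 < x → reg' x = reg x := by
  unfold parseProg BipGraph.order
  refine Run.mono (k := ((5 * B.left + 8) + ((5 * B.right + 8) + 3 + 1)) + 1) ?_ (by omega)
  refine Run.seq_add (Run.seq ?_)
  refine (readUnary_run (k := B.left) (l := B.right :: B.adjList) (by simpa using h8)
    (by simpa using h9) (by simp [h0, h3, BipGraph.code, BipGraph.adjList])).imp ?_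
  rintro r t ⟨a14, a15, a⟩
  have ha : ∀ x, x < 13 ∨ 15 < x → r x = reg x := fun x hx => by
    rw [a x hx, Function.update_of_ne (by omega)]
  refine Run.seq_add (Run.seq (k := 5 * B.right + 8) (k' := 3) ?_)
  refine (readUnary_run (k := B.right) (l := B.adjList) (by simp [ha, h8])
    (by simp [ha, h9]) (by simp [a15])).imp ?_
  rintro r' t' ⟨b14, b15, b⟩
  refine Run.seq_add (Run.seq_add (Run.skip ⟨?_, ?_, ?_, ?_⟩))
  · simp [b15, b, ha, h3]
  · simp [b, a14, ha, h3]
  · simp [b14, b, ha, h3]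
  · intro x h0 h4 h5 hx
    simp [h0, h4, h5, b x hx, ha x hx]

/-- Compute the parameters of the reduction. -/
def paramProg (C c : ℕ) : Prog :=
  .seq (.arith .add 6 4 5) <| .seq (.set 13 C) <| .seq (.arith .mul 13 13 23) <|
    .seq (.arith .mul 13 13 6) <| .seq (.arith .mul 7 13 6) <| .seq (.arith .add 11 23 23) <|
    .seq (.arith .add 11 11 11) <| .seq (.arith .add 11 11 11) <| .seq (.set 13 c) <|
    .seq (.arith .add 14 7 9) <| .seq (.arith .mul 13 13 14) <| .seq (.arith .add 13 13 6) <|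
    .seq (.arith .add 13 13 11) <| .seq (.set 14 4) <| .seq (.arith .add 12 13 14) .skip

theorem size_le_self (n : ℕ) : n.size ≤ n := Nat.size_le.2 Nat.lt_two_pow_self

/-- With m = CKn and N = mn + 1, both instances have value at most 2^(cN+n) when q ≤ 2^c. The digit
count in register `12` adds to this exponent the guard 8K + 4 required by `approx_truncate` at
tolerance 1/(8K). -/
theorem paramProg_run (C c : ℕ) {B : BipGraph} {K : ℕ} {reg : ℕ → ℕ} {tape : List ℕ}
    (h3 : reg 3 = 0) (h8 : reg 8 = 2) (h9 : reg 9 = 1)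
    (h0 : reg 0 = wordToNat (unaryCode B.adjList)) (h4 : reg 4 = B.left) (h5 : reg 5 = B.right)
    (h23 : reg 23 = K) :
    Run (paramProg C c) reg tape (C + C * K + C * K * B.order + C * K * B.order * B.order + c +
        c * (C * K * B.order * B.order + 1) + 30) fun reg' _ =>
      HoldsGraph B (C * K * B.order) reg' ∧ reg' 11 = 8 * K ∧
        reg' 12 = c * (C * K * B.order * B.order + 1) + B.order + 8 * K + 4 ∧
        ∀ x, x ≠ 6 → x ≠ 7 → x < 11 ∨ 14 < x → reg' x = reg x := by
  unfold paramProg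
  refine Run.mono (k := 1 + 1 + 5 + 1 + 1 + (1 + c * (C * K * B.order * B.order + 1)) + 1 + (1 + c) +
    3 + (1 + C * K * B.order * B.order) + (1 + C * K * B.order) + (1 + C * K) + (1 + C) + 1) ?_
    (by omega)
  -- Constants and products are charged by their values instead of their bit lengths; this is
  -- wasteful but still polynomial.
  have hset : ∀ (p : Prog) (r : ℕ → ℕ) k Q a v, Run p (Function.update r a v) tape k Q →
      Run (.seq (.set a v) p) r tape (k + (1 + v)) Q := fun p r k Q a v h =>
    (Run.seq_set h).mono (by have := size_le_self v; omega)
  have hmul : ∀ (p : Prog) (r : ℕ → ℕ) k Q a b d v, r b * r d = v →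
      Run p (Function.update r a v) tape k Q →
      Run (.seq (.arith .mul a b d) p) r tape (k + (1 + v)) Q := by
    rintro p r k Q a b d v rfl h
    exact Run.seq_mul (size_le_self _) h
  refine Run.seq_add (hset _ _ _ _ _ _ (hmul _ _ _ _ _ _ _ _ ?_ (hmul _ _ _ _ _ _ _ _ ?_
    (hmul _ _ _ _ _ _ _ _ ?_ (Run.seq_add (Run.seq_add (Run.seq_add (hset _ _ _ _ _ _
    (Run.seq_add (hmul _ _ _ _ _ _ _ _ ?_ (Run.seq_add (Run.seq_add
    (Run.seq_set_small (by norm_num) (Run.seq_add (Run.skip ?_)))))))))))))))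
  · simp [h23]
  · simp [h4, h5, BipGraph.order]
  · simp [h4, h5, BipGraph.order]
  · simp [h9]
  · refine ⟨⟨?_, ?_, ?_, ?_, ?_, ?_, ?_, ?_⟩, ?_, ?_, ?_⟩
    · simp [h3]
    · simp [h8]
    · simp [h9]
    · simp [h0]
    · simp [h4]
    · simp [h5]
    · simp [h4, h5]
    · simp
    · simp [h23]; ring
    · simp [h23, h4, h5]; ring
    · intro x h6 h7 hx
      simp [h6, h7, show x ≠ 11 by omega, show x ≠ 12 by omega, show x ≠ 13 by omega,
        show x ≠ 14 by omega]

/-- Store the code of the hypergraph without hyperedges in register `16`. -/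
def isolatedProg : Prog :=
  .seq (.set 16 1) <| .seq (.set 14 1) <| .seq emitUnary <| .seq (.set 14 0) <| .seq emitUnary <|
    .seq (.arith .add 14 7 9) emitUnary

theorem isolatedProg_run {N : ℕ} {reg : ℕ → ℕ} {tape : List ℕ} (h9 : reg 9 = 1) (h7 : reg 7 = N) :
    Run isolatedProg reg tape (5 * N + 40) fun reg' _ =>
      reg' 16 = wordToNat (UniformHypergraph.isolated N).code ∧
        ∀ x, x ≠ 14 → x ≠ 16 → reg' x = reg x := by
  unfold isolatedProg
  refine Run.mono (k := (7 + (2 + (5 * (N + 1) + 2 + 1) + 5)) + 5 + 5) ?_ (by omega)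
  refine Run.seq_set_small (by norm_num) (Run.seq_set_small (by norm_num)
    (Run.seq (k := 5 * 1 + 2) (k' := 2 + (5 * (N + 1) + 2 + 1) + 5) ?_))
  refine (emitUnary_run (k := 1) (l := []) (by simp [h9]) (by simp)
    (by simp [wordToNat, unaryCode])).imp ?_
  rintro r t ⟨a16, a⟩
  refine Run.seq_set_small (by norm_num) (Run.seq (k := 5 * 0 + 2) (k' := 5 * (N + 1) + 2 + 1) ?_)
  refine (emitUnary_run (k := 0) (l := [1]) (by simp [a, h9]) (by simp) (by simp [a16])).imp ?_
  rintro r' t' ⟨b16, b⟩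
  refine Run.seq_add ?_
  refine (emitUnary_run (k := N + 1) (l := [0, 1]) (by simp [b, a, h9])
    (by simp [b, a, h9, h7]) (by simp [b16])).imp ?_
  rintro r'' t'' ⟨d16, d⟩
  refine ⟨by rw [d16, UniformHypergraph.isolated_code], fun x h14 h16 => ?_⟩
  simp [d x h14 h16, h14, b x h14 h16, a x h14 h16, h16]

/-- The preparation of the oracle calls. -/
def prepProg (C c : ℕ) : Prog :=
  .seq (.set 8 2) <| .seq (.set 9 1) <| .seq readTol <| .seq (.arith .add 23 14 9) <|
    .seq parseProg <| .seq (paramProg C c) <| .seq gadgetProg <| .seq (.arith .add 10 16 3) <|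
      .seq isolatedProg <| .seq (.arith .add 32 16 3) .skip

/-- The state after the preparation of the oracle calls. -/
structure Prepared (C c : ℕ) (B : BipGraph) (K : ℕ) (reg : ℕ → ℕ) : Prop where
  h3 : reg 3 = 0
  h8 : reg 8 = 2
  h9 : reg 9 = 1
  h10 : reg 10 = wordToNat (B.gadget (C * K * B.order)).code
  h11 : reg 11 = 8 * K
  h12 : reg 12 = c * (C * K * B.order * B.order + 1) + B.order + 8 * K + 4
  h32 : reg 32 = wordToNat (UniformHypergraph.isolated (C * K * B.order * B.order)).code
  hz : ∀ x, 33 ≤ x → reg x = 0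

/-- An upper bound for the number of steps of the preparation. -/
def prepSteps (C c K n : ℕ) : ℕ :=
  8 * K + (5 * n + 21) + (C + C * K + C * K * n + C * K * n * n + c + c * (C * K * n * n + 1) + 30) +
    (C * K * n * n * ((C * K * n * n + 1) * (17 * (n * n) + 5 * (C * K * n * n) + 40 + 1) + 1 + 3 +
      1) + 15 * (C * K * n * n) + 40) + (5 * (C * K * n * n) + 40) + 50

/-- K is b + 1 for the b of `readTol_run`. Registers from 33 on stay untouched, so the private
registers of the subroutines, which start at 50, still hold 0. -/
theorem prepProg_run (C c : ℕ) (B : BipGraph) {ε : ℚ} (hε : 0 < ε) :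
    ∃ K : ℕ, 1 ≤ K ∧ 1 / (K : ℚ) < ε ∧ K ≤ 2 * ⌈ε⁻¹⌉₊ + 1 ∧
      Run (prepProg C c) (MState.initial B.code ε).reg (MState.initial B.code ε).tape
        (prepSteps C c K B.order) fun reg' _ => Prepared C c B K reg' := by
  set reg := (MState.initial B.code ε).reg with hreg
  have r0 : reg 0 = wordToNat B.code := by simp [hreg, MState.initial]
  have rz : ∀ x, x ≠ 0 → reg x = 0 := fun x hx => by simp [hreg, MState.initial, hx]
  obtain ⟨b, hb1, hb2, hb⟩ := readTol_run (reg := Function.update (Function.update reg 8 2) 9 1) hε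
    (by simp) (by simp)
  refine ⟨b + 1, by omega, by push_cast; exact hb1, by omega, ?_⟩
  set K := b + 1 with hK
  set m := C * K * B.order with hm
  unfold prepProg
  have hlr : B.left * B.right ≤ B.order * B.order :=
    Nat.mul_le_mul (Nat.le_add_right _ _) (Nat.le_add_left _ _)
  refine Run.mono (k := ((8 * b + 20) + ((5 * B.order + 21) + ((C + C * K + C * K * B.order +
    C * K * B.order * B.order + c + c * (C * K * B.order * B.order + 1) + 30) + ((m * B.order *
    ((m * B.order + 1) * (17 * (B.left * B.right) + 5 * (m * B.order) + 40 + 1) +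
        1 + 3 + 1) + 15 * (m * B.order) + 40) + ((5 * (m * B.order) + 40) + 2 + 1))) + 1)) + 5 + 5)
    ?_ ?_
  swap
  · have h1 : m * B.order * ((m * B.order + 1) * (17 * (B.left * B.right) + 5 * (m * B.order) + 40
        + 1) + 1 + 3 + 1) ≤ m * B.order * ((m * B.order + 1) * (17 * (B.order * B.order) +
        5 * (m * B.order) + 40 + 1) + 1 + 3 + 1) := by gcongr
    unfold prepSteps
    rw [← hm]
    generalize m * B.order * ((m * B.order + 1) * (17 * (B.left * B.right) + 5 * (m * B.order) + 40
        + 1) + 1 + 3 + 1) = A1 at *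
    generalize m * B.order * ((m * B.order + 1) * (17 * (B.order * B.order) +
        5 * (m * B.order) + 40 + 1) + 1 + 3 + 1) = A2 at *
    omega
  refine Run.seq_set_small (by norm_num) (Run.seq_set_small (by norm_num) (Run.seq ?_))
  refine hb.imp ?_
  rintro r t ⟨a14, a⟩
  have a0 : r 0 = wordToNat B.code := by simp [a, r0]
  have a3 : r 3 = 0 := by simp [a, rz]
  have a8 : r 8 = 2 := by simp [a]
  have a9 : r 9 = 1 := by simp [a]
  have az : ∀ x, 33 ≤ x → r x = 0 := fun x hx => by
    rw [a x (by omega), Function.update_of_ne (by omega), Function.update_of_ne (by omega),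
      rz x (by omega)]
  refine Run.seq_add (Run.seq ?_)
  refine (parseProg_run (B := B) (by simpa using a3) (by simpa using a8) (by simpa using a9)
    (by simpa using a0)).imp ?_
  rintro r1 t1 ⟨b0, b4, b5, b'⟩
  have b23 : r1 23 = K := by simp [b', a14, a9, hK]
  have bz : ∀ x, x ≠ 0 → x ≠ 4 → x ≠ 5 → x < 13 ∨ 15 < x → x ≠ 23 → r1 x = r x :=
    fun x h1 h2 h3 h4 h5 => by rw [b' x h1 h2 h3 h4, Function.update_of_ne h5]
  refine Run.seq ?_
  refine (paramProg_run C c (B := B) (K := K) (by simp [bz, a3]) (by simp [bz, a8])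
    (by simp [bz, a9]) b0 b4 b5 b23).imp ?_
  rintro r2 t2 ⟨d, d11, d12, d'⟩
  refine Run.seq ?_
  refine (gadgetProg_run d).imp ?_
  rintro r3 t3 ⟨e16, e⟩
  refine Run.seq_add (Run.seq (k := 5 * (m * B.order) + 40) (k' := 2) ?_)
  refine (isolatedProg_run (N := m * B.order) (by simp [e, d.h9]) (by simp [e, d.h7, hm])).imp ?_
  rintro r4 t4 ⟨f16, f⟩
  have ff : ∀ x, x < 10 ∨ 10 < x → x < 13 ∨ 22 < x → r4 x = r2 x := fun x h1 h2 => by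
    rw [f x (by omega) (by omega), Function.update_of_ne (by omega), e x h2]
  have f3 : r4 3 = 0 := by simp [ff, d.h3]
  refine Run.seq_add (Run.skip ⟨?_, ?_, ?_, ?_, ?_, ?_, ?_, ?_⟩)
  · simp [f3]
  · simp [ff, d.h8]
  · simp [ff, d.h9]
  · simp [f, e16, e, d.h3]
  · simp [ff, d11]
  · simp [ff, d12]
  · simp [f16, f3, hm]
  · intro x hx
    rw [Function.update_of_ne (by omega), ff x (by omega) (by omega), d' x (by omega) (by omega)
      (by omega), bz x (by omega) (by omega) (by omega) (by omega) (by omega), az x hx]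

/-! ### Approximation -/

theorem Approx.mono {ε ε' : ℚ} {v : ℝ} {z : ℚ} (h : Approx ε v z) (hv : 0 ≤ v) (hε : ε ≤ ε') :
    Approx ε' v z := by
  have hε' : (ε : ℝ) ≤ ε' := by exact_mod_cast hε
  refine ⟨le_trans ?_ h.1, h.2.trans ?_⟩
  · gcongr
  · gcongr

/-- From e^x ≥ 1 + x and (1 + x)(1 - x/2) ≥ 1 on [0, 1]. -/
theorem exp_neg_le_one_sub_half {x : ℝ} (h0 : 0 ≤ x) (h1 : x ≤ 1) :
    Real.exp (-x) ≤ 1 - x / 2 := by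
  rw [Real.exp_neg]
  have h6 := Real.add_one_le_exp x
  rw [inv_le_comm₀ (Real.exp_pos _) (by linarith)]
  refine le_trans ?_ h6
  rw [inv_le_comm₀ (by linarith) (by linarith), ← one_div, div_le_iff₀ (by linarith)]
  nlinarith

theorem exp_half_le_two : Real.exp (1 / 2) ≤ 2 := by
  have h1 := Real.exp_one_lt_d9
  have h2 : Real.exp (1 / 2) * Real.exp (1 / 2) = Real.exp 1 := by rw [← Real.exp_add]; norm_num
  nlinarith [Real.exp_pos (1 / 2)]

/-- The leading digits of numerator and denominator of a good approximation are a good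
approximation. -/
theorem approx_truncate {v : ℝ} {z : ℚ} {K D V : ℕ} (hK : 2 ≤ K) (hD : V + 4 + K ≤ D)
    (h1 : 1 ≤ v) (hV : v ≤ 2 ^ V) (hz : Approx (1 / K) v z) (t : ℕ)
    (ht : t = max z.num.natAbs.size z.den.size - D) :
    0 < z.den / 2 ^ t ∧ Approx (2 / K) v
      (((z.num.natAbs / 2 ^ t : ℕ) : ℚ) / ((z.den / 2 ^ t : ℕ) : ℚ)) := by
  have hK' : (2 : ℝ) ≤ K := by exact_mod_cast hK
  have hzpos : 0 < z := by
    have : (0 : ℝ) < z := lt_of_lt_of_le (by positivity) hz.1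
    exact_mod_cast this
  have hnum : 0 < z.num := Rat.num_pos.2 hzpos
  have hden := z.den_pos
  have hz1 : z = (z.num.natAbs : ℚ) / z.den := by
    conv_lhs => rw [← Rat.num_div_den z]
    congr 1
    rw [Nat.cast_natAbs, abs_of_pos hnum]
  have hsum : (2 / K : ℚ) = 1 / K + 1 / K := by ring
  -- For t = 0 no digit is lost, and only the tolerance is relaxed.
  rcases Nat.eq_zero_or_pos t with h0 | h0
  · rw [h0, pow_zero, Nat.div_one, Nat.div_one, ← hz1]
    exact ⟨hden, hz.mono (by linarith) (by rw [hsum]; simp)⟩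
  set l := max z.num.natAbs.size z.den.size with hl
  have hu0 : 0 < z.num.natAbs := by omega
  generalize hu : z.num.natAbs = u at *
  generalize hw : z.den = w at *
  have hu0' : (0 : ℝ) < u := by exact_mod_cast hu0
  have hw0' : (0 : ℝ) < w := by exact_mod_cast hden
  have hzr : (z : ℝ) = u / w := by rw [hz1]; push_cast; rfl
  have hcast : ((1 / K : ℚ) : ℝ) = 1 / K := by push_cast; rfl
  have hcast2 : ((2 / K : ℚ) : ℝ) = 2 / K := by push_cast; rfl
  obtain ⟨hz2, hz3⟩ := hz
  rw [hcast, hzr] at hz2 hz3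
  have hKh : (1 : ℝ) / K ≤ 1 / 2 := one_div_le_one_div_of_le (by norm_num) hK'
  have hK0 : (0 : ℝ) < 1 / K := by positivity
  -- numerator and denominator are comparable
  have c1 : (w : ℝ) ≤ 2 * u := by
    have h2 : (1 : ℝ) / 2 ≤ Real.exp (-(1 / K)) := by
      rw [Real.exp_neg, ← one_div]
      exact one_div_le_one_div_of_le (Real.exp_pos _)
        ((Real.exp_le_exp.2 hKh).trans exp_half_le_two)
    have h3 : (1 : ℝ) / 2 ≤ u / w := le_trans (by nlinarith) hz2
    rw [div_le_div_iff₀ (by norm_num) hw0'] at h3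
    linarith
  have c2 : (u : ℝ) ≤ 2 * 2 ^ V * w := by
    rw [← div_le_iff₀ hw0']
    refine hz3.trans ?_
    have := (Real.exp_le_exp.2 hKh).trans exp_half_le_two
    gcongr
  have c1' : w ≤ 2 * u := by exact_mod_cast c1
  have c2' : u ≤ 2 * 2 ^ V * w := by exact_mod_cast c2
  -- The longer of the two numbers has l bits; as u and w differ by a factor of at most 2 · 2^V, the
  -- shorter one is still at least 2^(l-2-V).
  have hmax : 2 ^ (l - 1) ≤ u ∨ 2 ^ (l - 1) ≤ w := by
    rcases max_choice u.size w.size with h | h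
    · left; exact Nat.lt_size.1 (by omega)
    · right; exact Nat.lt_size.1 (by omega)
  have e1 : 2 ^ (l - 1) = 2 * 2 ^ V * 2 ^ (l - 2 - V) := by
    rw [← pow_succ', ← pow_add]; congr 1; omega
  have hV1 : 1 ≤ 2 ^ V := Nat.one_le_two_pow
  have low : 2 ^ (l - 2 - V) ≤ u ∧ 2 ^ (l - 2 - V) ≤ w := by
    rw [e1] at hmax
    have hx : 2 ^ (l - 2 - V) ≤ 2 ^ V * 2 ^ (l - 2 - V) := Nat.le_mul_of_pos_left _ (by positivity)
    rcases hmax with h | h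
    · refine ⟨by nlinarith, ?_⟩
      have : 2 * 2 ^ V * 2 ^ (l - 2 - V) ≤ 2 * 2 ^ V * w := h.trans c2'
      exact Nat.le_of_mul_le_mul_left this (by positivity)
    · constructor <;> nlinarith
  set M := 2 ^ t with hM
  have hM0 : 0 < M := by positivity
  -- Here t = l - D and D ≥ V + 4 + K, so K + 2 + t ≤ l - 2 - V; moreover 4K ≤ 2^(K+2).
  have e2 : 4 * K * M ≤ 2 ^ (l - 2 - V) := by
    have : 2 ^ (K + 2) * M ≤ 2 ^ (l - 2 - V) := by
      rw [hM, ← pow_add]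
      exact Nat.pow_le_pow_right (by norm_num) (by omega)
    refine le_trans ?_ this
    have := Nat.lt_two_pow_self (n := K)
    refine Nat.mul_le_mul_right _ ?_
    rw [pow_add]
    omega
  have hM0' : (0 : ℝ) < M := by exact_mod_cast hM0
  -- Cutting t digits loses less than M = 2^t, a relative error below 1/(4K). The weaker 1/(2K)
  -- suffices, since 1 - 1/(2K) ≥ e^{-1/K}.
  have bound : ∀ a : ℕ, 4 * K * M ≤ a → ((a / M : ℕ) : ℝ) * M ≤ a ∧
      (a : ℝ) * (1 - 1 / K / 2) ≤ ((a / M : ℕ) : ℝ) * M := by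
    intro a ha
    have h2 : (a / M) * M ≤ a := Nat.div_mul_le_self a M
    have h3 : a < (a / M + 1) * M := (Nat.div_lt_iff_lt_mul hM0).1 (Nat.lt_succ_self _)
    have h2' : ((a / M : ℕ) : ℝ) * M ≤ a := by exact_mod_cast h2
    have h3' : (a : ℝ) < (((a / M : ℕ) : ℝ) + 1) * M := by exact_mod_cast h3
    have ha' : (4 : ℝ) * K * M ≤ a := by exact_mod_cast ha
    refine ⟨h2', ?_⟩
    have h4 : (M : ℝ) ≤ a * (1 / K / 2) := by
      rw [← sub_nonneg]
      have : (a : ℝ) * (1 / K / 2) - M = (a - 2 * K * M) / (2 * K) := by field_simp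
      rw [this]
      refine div_nonneg ?_ (by positivity)
      nlinarith
    nlinarith
  obtain ⟨bu1, bu2⟩ := bound u (e2.trans low.1)
  obtain ⟨bw1, bw2⟩ := bound w (e2.trans low.2)
  set X := u / M
  set Y := w / M
  have hexp := exp_neg_le_one_sub_half hK0.le (by linarith)
  set e := Real.exp (-(1 / K : ℝ)) with he
  have he0 : 0 < e := Real.exp_pos _
  have bu3 : u * e ≤ X * M := (mul_le_mul_of_nonneg_left hexp hu0'.le).trans bu2
  have bw3 : w * e ≤ Y * M := (mul_le_mul_of_nonneg_left hexp hw0'.le).trans bw2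
  have hY : (0 : ℝ) < Y := by
    have : (0 : ℝ) < Y * M := lt_of_lt_of_le (by positivity) bw3
    exact pos_of_mul_pos_left this hM0'.le
  refine ⟨by exact_mod_cast hY, ?_⟩
  have hE : Real.exp (1 / K : ℝ) = e⁻¹ := by rw [he, Real.exp_neg, inv_inv]
  have e3 : Real.exp (-(2 / K : ℝ)) = e * e := by rw [he, ← Real.exp_add]; congr 1; ring
  have e4 : Real.exp (2 / K : ℝ) = e⁻¹ * e⁻¹ := by rw [← hE, ← Real.exp_add]; congr 1; ring
  rw [hE] at hz3
  rw [le_div_iff₀ hw0'] at hz2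
  rw [div_le_iff₀ hw0'] at hz3
  unfold Approx
  rw [hcast2, e3, e4]
  push_cast
  constructor
  · rw [le_div_iff₀ hY]
    refine le_of_mul_le_mul_right ?_ hM0'
    calc e * e * v * Y * M = e * (e * v * (Y * M)) := by ring
      _ ≤ e * (e * v * w) := by gcongr
      _ ≤ e * u := by gcongr
      _ ≤ X * M := by linarith
  · rw [div_le_iff₀ hY]
    refine le_of_mul_le_mul_right ?_ hM0'
    calc (X : ℝ) * M ≤ u := bu1
      _ ≤ e⁻¹ * v * w := hz3
      _ = e⁻¹ * e⁻¹ * v * (w * e) := by field_simp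
      _ ≤ e⁻¹ * e⁻¹ * v * (Y * M) := by gcongr
      _ = e⁻¹ * e⁻¹ * v * Y * M := by ring

/-! ### Calling the oracle -/

/-- Replace a zero in register `14` by a one. -/
def fixDenom : Prog := .ite 14 .skip (.seq (.set 14 1) .skip)

theorem fixDenom_run {reg : ℕ → ℕ} {tape : List ℕ} :
    Run fixDenom reg tape 7 fun reg' _ => reg' = Function.update reg 14 (max (reg 14) 1) := by
  unfold fixDenom
  refine Run.ite (k := 6) ?_ ?_
  · intro h
    refine (Run.skip ?_).mono (by norm_num)
    rw [max_eq_left (by omega), Function.update_eq_self]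
  · intro h
    refine Run.seq_set_small (k := 1) (by norm_num) (Run.skip ?_)
    rw [h]; rfl

/-- Read the leading digits of the answer of the oracle, as many as register `12` tells. -/
def readAnswer : Prog :=
  .seq (.set 13 0) <| .seq (.set 14 0) <| .seq (.read 15) <| .seq (.arith .add 16 12 3) <|
    .seq (.loop 16 <| .seq (.read 15) <| .seq (.arith .div 17 15 8) <| .seq (.arith .sub 18 17 9) <|
      .seq (.arith .sub 16 16 9) <|
      .ite 18 .skip <| .seq (.arith .mod 15 15 8) <| .seq (.arith .add 13 13 13) <|
        .seq (.arith .add 13 13 17) <| .seq (.arith .add 14 14 14) <|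
        .seq (.arith .add 14 14 15) .skip) fixDenom

/-- Both tracks are cut at the same place, so the quotient survives. If the answer has fewer than D
symbols, the empty tape yields 4; then 4/2 - 1 is non-zero and the prefixes are kept, whereas for a
genuine symbol, at most 3, the truncated difference is 0. -/
theorem readAnswer_run {reg : ℕ → ℕ} {z : ℚ} {D t : ℕ} (h3 : reg 3 = 0) (h8 : reg 8 = 2)
    (h9 : reg 9 = 1) (h12 : reg 12 = D) (ht : t = max z.num.natAbs.size z.den.size - D) :
    Run readAnswer reg (ratTape z) (12 * D + 30) fun reg' _ =>
      reg' 13 = z.num.natAbs / 2 ^ t ∧ reg' 14 = max (z.den / 2 ^ t) 1 ∧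
        ∀ x, x < 13 ∨ 18 < x → reg' x = reg x := by
  rw [ratTape_eq]
  set l := max z.num.natAbs.size z.den.size with hl
  have hu : z.num.natAbs < 2 ^ l :=
    (Nat.lt_size_self _).trans_le (Nat.pow_le_pow_right (by norm_num) (le_max_left _ _))
  have hv : z.den < 2 ^ l :=
    (Nat.lt_size_self _).trans_le (Nat.pow_le_pow_right (by norm_num) (le_max_right _ _))
  generalize z.num.natAbs = u at *
  generalize z.den = v at *
  unfold readAnswer
  refine Run.mono (k := ((D * (11 + 1) + 1) + 7) + 12) ?_ (by omega)
  refine Run.seq_set_small (by norm_num) (Run.seq_set_small (by norm_num) (Run.seq_read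
    (Run.seq_add (Run.seq (k := D * (11 + 1) + 1) (k' := 7) ?_))))
  refine Run.loop (n := D) (k := 11) (fun j r tp => r 8 = 2 ∧ r 9 = 1 ∧ r 16 = j ∧
      r 13 = u / 2 ^ (l - (D - j)) ∧ r 14 = v / 2 ^ (l - (D - j)) ∧
      tp = (pairDigits u v l).drop (D - j) ∧ ∀ x, x < 13 ∨ 18 < x → r x = reg x) ?_ ?_ ?_
  · rintro j r tp hj ⟨i8, i9, i16, i13, i14, itp, i⟩
    refine ⟨by omega, ?_⟩
    by_cases hc : D - (j + 1) < l
    · rw [pairDigits_drop hc, show D - (j + 1) + 1 = D - j by omega] at itp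
      subst itp
      have ha := Nat.mod_lt (u / 2 ^ (l - (D - j))) (show 0 < 2 by norm_num)
      have hb := Nat.mod_lt (v / 2 ^ (l - (D - j))) (show 0 < 2 by norm_num)
      have e1 := div_two_pow_step u (l - (D - j))
      have e2 := div_two_pow_step v (l - (D - j))
      rw [show l - (D - j) + 1 = l - (D - (j + 1)) by omega, ← i13] at e1
      rw [show l - (D - j) + 1 = l - (D - (j + 1)) by omega, ← i14] at e2
      generalize u / 2 ^ (l - (D - j)) = A at *
      generalize v / 2 ^ (l - (D - j)) = B at *
      have e3 : (2 * (A % 2) + B % 2) / 2 = A % 2 := by omega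
      have e4 : (2 * (A % 2) + B % 2) % 2 = B % 2 := by omega
      refine Run.seq_read (Run.seq_div (Run.seq_sub (Run.seq_sub (Run.ite ?_ ?_))))
      · intro h
        exfalso
        simp only [List.headD_cons] at h
        simp [i8, i9, e3] at h
        omega
      · intro _
        refine Run.seq_mod (Run.seq_add (Run.seq_add (Run.seq_add (Run.seq_add (Run.skip ?_)))))
        simp only [List.headD_cons, List.tail_cons]
        refine ⟨by simpa using i8, by simpa using i9, by simp [i9, i16], ?_, ?_, trivial, ?_⟩
        · simp [i8, e3]; omega
        · simp [i8, e4]; omega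
        · intro x hx
          rw [← i x hx]
          simp [show x ≠ 13 by omega, show x ≠ 14 by omega, show x ≠ 15 by omega,
            show x ≠ 16 by omega, show x ≠ 17 by omega, show x ≠ 18 by omega]
    · have h0 : (pairDigits u v l).drop (D - (j + 1)) = [] :=
        List.drop_eq_nil_of_le (by rw [length_pairDigits]; omega)
      have h1 : (pairDigits u v l).drop (D - j) = [] :=
        List.drop_eq_nil_of_le (by rw [length_pairDigits]; omega)
      rw [h0] at itp
      subst itp
      refine Run.seq_read (Run.seq_div (Run.seq_sub (Run.seq_sub (Run.ite (k := 6) ?_ ?_))))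
      · intro _
        refine (Run.skip ?_).mono (by norm_num)
        refine ⟨by simpa using i8, by simpa using i9, by simp [i9, i16], ?_, ?_, by simp [h1], ?_⟩
        · simp [i13, show l - (D - j) = l - (D - (j + 1)) by omega]
        · simp [i14, show l - (D - j) = l - (D - (j + 1)) by omega]
        · intro x hx
          rw [← i x hx]
          simp [show x ≠ 15 by omega,
            show x ≠ 16 by omega, show x ≠ 17 by omega, show x ≠ 18 by omega]
      · intro h
        simp [i8, i9] at h
  · rintro r tp ⟨-, -, i16, i13, i14, -, i⟩
    refine ⟨i16, fixDenom_run.imp ?_⟩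
    rintro r' t' rfl
    rw [Nat.sub_zero, ← ht] at i13 i14
    refine ⟨by simp [i13], by simp [i14], fun x hx => ?_⟩
    rw [Function.update_of_ne (by omega), i x hx]
  · refine ⟨by simpa using h8, by simpa using h9, by simp [h12, h3], ?_, ?_, by simp, ?_⟩
    · simp [Nat.div_eq_of_lt hu]
    · simp [Nat.div_eq_of_lt hv]
    · intro x hx
      simp [show x ≠ 13 by omega, show x ≠ 14 by omega, show x ≠ 15 by omega,
        show x ≠ 16 by omega]

/-- The programs `call i` approximate the value of the instance of `g` in register `10` with the
tolerance whose inverse is in register `11`. The result is the quotient of registers `13` and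
`14`; the program `call i` owns the registers `50 + 10 * r + i`. -/
def CallSpec (g : CountingProblem) (O : Oracle) (good : Prop) (call : ℕ → Prog)
    (T : Polynomial ℕ) : Prop :=
  ∀ i, i < 10 → ∀ (s : MState) (J : g.Inst) (K D V S : ℕ), s.reg 3 = 0 → s.reg 8 = 2 →
    s.reg 9 = 1 → s.reg 10 = wordToNat (g.code J) → s.reg 11 = K → 2 ≤ K → s.reg 12 = D →
    V + 4 + K ≤ D → 1 ≤ g.value J → g.value J ≤ 2 ^ V → (∀ r, s.reg (50 + 10 * r + i) = 0) →
    3 ≤ S → Bdd S s.reg s.tape →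
    Spec O good (call i) s (T.eval (S + K + D))
      (fun s' => (∀ x, x < 13 ∨ 20 ≤ x ∧ x < 50 ∨ 50 ≤ x ∧ (x - 50) % 10 ≠ i → s'.reg x = s.reg x) ∧
        0 < s'.reg 14 ∧ Bdd (S + T.eval (S + K + D)) s'.reg s'.tape ∧
        ∀ c ∈ s'.queries, c ∈ s.queries ∨ c = (g.code J, 1 / (K : ℚ)))
      (fun s' => Approx (2 / K) (g.value J) ((s'.reg 13 : ℚ) / (s'.reg 14 : ℚ))) (3 / 4)

/-- Call the oracle and read its answer. -/
def oracleCall : Prog := .seq (.oracle 10 9 11) readAnswer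

/-- The answer may be arbitrarily long, but only a bounded number of its symbols is read, so the
time bound holds for every oracle. The remaining tape consists of symbols of two bits and does not
count towards `Bdd`. -/
theorem CallSpec.oracle (g : CountingProblem) :
    ∃ T, ∀ O : Oracle, CallSpec g O (O.IsRAS g) (fun _ => oracleCall) T := by
  refine ⟨3 * Polynomial.X + 1 + (12 * Polynomial.X + 30) * (1 + 2 * (Polynomial.X +
    (12 * Polynomial.X + 30))), fun O => ?_⟩
  intro i _ s J K D V S h3 h8 h9 h10 h11 hK h12 hD hv1 hvV _ hS hB
  set T := Polynomial.eval (S + K + D) (3 * Polynomial.X + 1 + (12 * Polynomial.X + 30) *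
    (1 + 2 * (Polynomial.X + (12 * Polynomial.X + 30))) : Polynomial ℕ) with hT
  have hT' : T = 3 * (S + K + D) + 1 + (12 * (S + K + D) + 30) * (1 + 2 * ((S + K + D) +
      (12 * (S + K + D) + 30))) := by
    rw [hT]; simp
  have hT2 : (3 * S + 1) + (12 * D + 30) * (1 + 2 * (S + (12 * D + 30))) ≤ T := by
    rw [hT']
    gcongr <;> omega
  set st : ℚ → MState := fun z => ({ s with tape := ratTape z, queries :=
    (natToWord (s.reg 10), (s.reg 9 : ℚ) / (s.reg 11 : ℚ)) :: s.queries } : MState).tick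
      (1 + (s.reg 10).size + (s.reg 9).size + (s.reg 11).size) with hst
  have hquery : (natToWord (s.reg 10), (s.reg 9 : ℚ) / (s.reg 11 : ℚ)) = (g.code J, 1 / (K : ℚ)) := by
    rw [h10, natToWord_wordToNat, h9, h11]
    simp
  have h1 : Spec O (O.IsRAS g) (.oracle 10 9 11) s (3 * S + 1) (fun s' => ∃ z, s' = st z)
      (fun s' => ∃ z, s' = st z ∧ Approx (1 / K) (g.value J) z) (3 / 4) := by
    intro fuel _
    have he : (Prog.oracle 10 9 11).eval O fuel s = (O (g.code J) (1 / (K : ℚ))).map fun z =>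
        some (st z) := by
      rw [Prog.eval, ← (Prod.mk.inj hquery).1, ← (Prod.mk.inj hquery).2]
    rw [he]
    constructor
    · intro o ho
      rw [PMF.mem_support_map_iff] at ho
      obtain ⟨z, -, rfl⟩ := ho
      refine ⟨st z, rfl, ?_, z, rfl⟩
      have b1 := hB.1 10
      have b2 := hB.1 9
      have b3 := hB.1 11
      simp only [hst, MState.tick]
      omega
    · intro hO
      rw [PMF.toOuterMeasure_map_apply]
      have h2 := hO J (1 / K) (by positivity)
      refine le_trans ?_ (h2.trans (PMF.toOuterMeasure_mono _ ?_))
      · push_cast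
        exact le_rfl
      · rintro z ⟨hz, -⟩
        exact ⟨st z, rfl, z, rfl, hz⟩
  have hB' : ∀ z, Bdd S (st z).reg (st z).tape := fun z =>
    ⟨hB.1, fun x hx => (size_le_two_of_mem_ratTape hx).trans (by omega)⟩
  have h2 : ∀ z, Run readAnswer (st z).reg (st z).tape (12 * D + 30) _ := fun z =>
    readAnswer_run (reg := s.reg) (z := z) h3 h8 h9 h12 rfl
  -- Good and bad answers are treated together: `c = 1` after a good one, `c = 0` otherwise.
  have h4 : ∀ (c : ℝ≥0) (hc : c ≤ 1) z, (c ≠ 0 → Approx (1 / K) (g.value J) z) →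
      Spec O (O.IsRAS g) readAnswer (st z) ((12 * D + 30) * (1 + 2 * (S + (12 * D + 30))))
        (fun s' => (∀ x, x < 13 ∨ 20 ≤ x ∧ x < 50 ∨ 50 ≤ x ∧ (x - 50) % 10 ≠ i → s'.reg x = s.reg x) ∧
        0 < s'.reg 14 ∧ Bdd (S + T) s'.reg s'.tape ∧
        ∀ c ∈ s'.queries, c ∈ s.queries ∨ c = (g.code J, 1 / (K : ℚ)))
      (fun s' => Approx (2 / K) (g.value J) ((s'.reg 13 : ℚ) / (s'.reg 14 : ℚ))) c := by
    intro c hc z hz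
    refine Spec.of_run (h2 z) hS (hB' z) ?_ hc ?_
    · rintro s' hq hb ⟨-, b, d⟩
      refine ⟨fun x hx => d x (by omega), by omega, hb.mono ?_, fun q hq' => ?_⟩
      · have : 12 * D + 30 ≤ (12 * D + 30) * (1 + 2 * (S + (12 * D + 30))) :=
          Nat.le_mul_of_pos_right _ (by omega)
        omega
      · rw [hq] at hq'
        rcases List.mem_cons.1 hq' with h | h
        · right; rw [h, hquery]
        · left; exact h
    · rintro s' - ⟨a, b, -⟩ hc0
      obtain ⟨e1, e2⟩ := approx_truncate hK hD hv1 hvV (hz hc0) _ rfl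
      rw [a, b, max_eq_left (Nat.succ_le_of_lt e1)]
      exact e2
  have h5 := h1.seq (p' := readAnswer) (cb := 0) (cg := 1)
    (by rintro s' ⟨z, rfl⟩; exact h4 0 (by norm_num) z (fun h => absurd rfl h))
    (by rintro s' - ⟨z, rfl, hz⟩; exact h4 1 le_rfl z (fun _ => hz)) (by norm_num)
  exact h5.mono hT2 (fun _ h => h) (fun _ _ h => h) (by simp)

/-! ### Calling an approximation scheme -/

/-- Write the rational number `1 / K` onto the tape, where `K` is in register `11`. -/
def writeTol : Prog :=
  .seq .clear <| .seq (.arith .mod 15 11 8) <| .seq (.arith .add 15 15 8) <| .seq (.write 15) <|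
    .seq (.arith .div 16 11 8) <|
    .seq (.loop 16 <| .seq (.arith .mod 15 16 8) <| .seq (.write 15) <|
      .seq (.arith .div 16 16 8) .skip) (.write 3)

/-- 1/K is in lowest terms, so the numerator track is a single 1 above the last digit of K. Pushing
starts at this least significant symbol, `K % 2 + 2`, and ends with the sign. -/
theorem writeTol_run {reg : ℕ → ℕ} {tape : List ℕ} {K : ℕ} (hK : 1 ≤ K) (h3 : reg 3 = 0)
    (h8 : reg 8 = 2) (h11 : reg 11 = K) :
    Run writeTol reg tape (5 * K + 10) fun reg' tape' => tape' = ratTape (1 / K) ∧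
      ∀ x, x < 15 ∨ 16 < x → reg' x = reg x := by
  set l := K.size with hl
  have hl0 : 0 < l := Nat.size_pos.2 hK
  have hlK : l ≤ K := size_le_self K
  have hrat : ratTape (1 / K) = 0 :: pairDigits 1 K l := by
    rw [ratTape_eq, one_div, Rat.inv_natCast_num_of_pos hK, Rat.inv_natCast_den_of_pos hK,
      if_neg (by rw [not_lt]; positivity)]
    congr 2
    simp
    omega
  have hpow : K / 2 ^ l = 0 := Nat.div_eq_of_lt (Nat.lt_size_self K)
  unfold writeTol
  refine Run.mono (k := (((l - 1) * (4 + 1) + 1) + 1) + 5) ?_ (by omega)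
  refine Run.seq_clear (Run.seq_mod (Run.seq_add (Run.seq_write (Run.seq_div
    (Run.seq (k := (l - 1) * (4 + 1) + 1) (k' := 1) ?_)))))
  refine Run.loop (n := l - 1) (k := 4) (fun j r tp => r 3 = 0 ∧ r 8 = 2 ∧
    r 16 = K / 2 ^ (l - j) ∧ tp = (pairDigits 1 K l).drop j ∧
    ∀ x, x < 15 ∨ 16 < x → r x = reg x) ?_ ?_ ?_
  · rintro j r tp hj ⟨i3, i8, i16, itp, i⟩
    refine ⟨?_, ?_⟩
    · rw [i16]
      have h1 : 2 ^ (l - (j + 1)) ≤ K := Nat.lt_size.1 (by omega)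
      exact (Nat.div_pos h1 (by positivity)).ne'
    · refine Run.seq_mod (Run.seq_write (Run.seq_div (Run.skip ⟨?_, ?_, ?_, ?_, ?_⟩)))
      · simpa using i3
      · simpa using i8
      · simp [i16, i8]
        rw [Nat.div_div_eq_div_mul, ← pow_succ]
        congr 2; omega
      · rw [pairDigits_drop (by omega : j < l), ← itp]
        simp [i16, i8]
        rw [Nat.div_eq_of_lt (Nat.one_lt_two_pow (by omega))]
        rfl
      · intro x hx
        rw [← i x hx]
        simp [show x ≠ 15 by omega, show x ≠ 16 by omega]
  · rintro r tp ⟨i3, -, i16, itp, i⟩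
    refine ⟨?_, Run.write ⟨?_, i⟩⟩
    · rw [i16, Nat.sub_zero, hpow]
    · rw [i3, itp, hrat, List.drop_zero]
  · refine ⟨by simpa using h3, by simpa using h8, ?_, ?_, ?_⟩
    · simp [h11, h8]
      rw [show l - (l - 1) = 1 by omega, pow_one]
    · rw [pairDigits_drop (by omega : l - 1 < l), show l - 1 + 1 = l by omega,
        List.drop_eq_nil_of_le (by rw [length_pairDigits])]
      simp [h11, h8]
      omega
    · intro x hx
      simp [show x ≠ 15 by omega, show x ≠ 16 by omega]

theorem Prog.OracleFree.queries_eq {p : Prog} (hp : p.OracleFree) {O : Oracle} {fuel : ℕ}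
    {s s' : MState} (h : some s' ∈ (p.eval O fuel s).support) : s'.queries = s.queries := by
  refine Prog.eval_rel (Rel := fun s s' => s'.queries = s.queries)
    (fun _ _ _ h h' => h'.trans h) (fun _ _ => rfl) p ?_ O fuel s s' h
  clear h
  induction p with
  | seq p p' ih ih' => exact ⟨ih hp.1, ih' hp.2⟩
  | ite r p p' ih ih' => exact ⟨ih hp.1, ih' hp.2⟩
  | loop r p ih => exact ih hp
  | oracle w n d => exact hp.elim
  | flip r =>
    intro O fuel s s' h
    simp only [Prog.eval, PMF.support_map, Set.mem_image] at h
    obtain ⟨b, -, h⟩ := h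
    simp only [Option.some.injEq] at h
    rw [← h]
    rfl
  | _ =>
    intro O fuel s s' h
    simp only [Prog.eval, PMF.support_pure, Set.mem_singleton_iff, Option.some.injEq] at h
    rw [h]
    rfl

theorem Polynomial.eval_mono_nat (P : Polynomial ℕ) {a b : ℕ} (h : a ≤ b) :
    P.eval a ≤ P.eval b := by
  rw [Polynomial.eval_eq_sum, Polynomial.eval_eq_sum]
  exact Finset.sum_le_sum fun e _ => Nat.mul_le_mul_left _ (Nat.pow_le_pow_left h _)

/-- The registers of the subroutine `i`. -/
def subReg (i r : ℕ) : ℕ := 50 + 10 * r + i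

theorem subReg_injective (i : ℕ) : Function.Injective (subReg i) := by
  intro r r' h
  unfold subReg at h
  omega

/-- Call the program `A` on the word in register `10` with the tolerance whose inverse is in
register `11`. -/
def schemeCall (A : Prog) (i : ℕ) : Prog :=
  .seq (.seq (.arith .add (subReg i 0) 10 3) writeTol) <| .seq (A.rename (subReg i)) <|
    .seq (.arith .sub 13 (subReg i 0) (subReg i 1)) <| .seq (.arith .add 14 (subReg i 2) 3) fixDenom

/-- An approximation of a positive number is positive. Hence neither truncated subtraction nor
replacing a zero denominator by 1 changes a correct output. -/
theorem approx_nat_quotient {ε : ℚ} {v : ℝ} (hv : 0 < v) {a b c : ℕ}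
    (h : Approx ε v (((a : ℚ) - (b : ℚ)) / (c : ℚ))) :
    Approx ε v (((a - b : ℕ) : ℚ) / ((max c 1 : ℕ) : ℚ)) := by
  have h1 : (0 : ℝ) < ((((a : ℚ) - (b : ℚ)) / (c : ℚ) : ℚ) : ℝ) :=
    lt_of_lt_of_le (by positivity) h.1
  have h2 : (0 : ℚ) < ((a : ℚ) - (b : ℚ)) / (c : ℚ) := by exact_mod_cast h1
  have hc : 0 < c := by
    rcases Nat.eq_zero_or_pos c with h0 | h0
    · rw [h0] at h2; simp at h2
    · exact h0
  have hc' : (0 : ℚ) < c := by exact_mod_cast hc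
  have hab : (b : ℚ) < a := by
    have := (div_pos_iff_of_pos_right hc').1 h2
    linarith
  have hab' : b ≤ a := by
    have : b < a := by exact_mod_cast hab
    omega
  rw [max_eq_left hc, Nat.cast_sub hab']
  exact h

/-- The private registers are zero, so after copying the input the caller's state embeds an initial
state of `A`. The scheme's time bound yields two more facts: additional fuel is harmless
(`Prog.eval_fuel_mono`), and the contents stay polynomially small (`Prog.eval_size`) although
nothing else is known about `A`. -/
theorem CallSpec.scheme {g : CountingProblem} (h : HasFPRAS g) :
    ∃ A T, ∀ O : Oracle, A.OracleFree ∧ CallSpec g O True (schemeCall A) T := by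
  obtain ⟨A, P, hA, hP⟩ := h
  set k₁ : Polynomial ℕ := 5 * Polynomial.X + 11 with hk₁
  refine ⟨A, k₁ * (1 + 2 * (Polynomial.X + k₁)) + (P + 9 * (1 + 2 * (Polynomial.X + k₁ + P + 9))),
    fun O => ⟨hA, ?_⟩⟩
  intro i hi s J K D V S h3 h8 h9 h10 h11 hK h12 hD hv1 hvV hz hS hB
  set T := Polynomial.eval (S + K + D) (k₁ * (1 + 2 * (Polynomial.X + k₁)) +
    (P + 9 * (1 + 2 * (Polynomial.X + k₁ + P + 9)))) with hT
  have hlen : (g.code J).length ≤ S := by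
    have := hB.1 10
    rw [h10, size_wordToNat] at this
    omega
  have hK0 : (0 : ℚ) < K := by exact_mod_cast (by omega : 0 < K)
  have hceil : ⌈(1 / (K : ℚ))⁻¹⌉₊ = K := by
    rw [one_div, inv_inv, Nat.ceil_natCast]
  obtain ⟨hP1, hP2⟩ := hP O J (1 / (K : ℚ)) (by positivity)
  rw [hceil] at hP1 hP2
  set T₀ := P.eval ((g.code J).length + K) with hT₀
  have hmono : T₀ ≤ P.eval (S + K + D) := Polynomial.eval_mono_nat P (by omega)
  set P₀ := P.eval (S + K + D) with hP₀
  set k := 5 * K + 11 with hk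
  have hT' : T = (5 * (S + K + D) + 11) * (1 + 2 * ((S + K + D) + (5 * (S + K + D) + 11))) +
      (P₀ + 9 * (1 + 2 * ((S + K + D) + (5 * (S + K + D) + 11) + P₀ + 9))) := by
    rw [hT, hk₁, hP₀]; simp
  have hT2 : k * (1 + 2 * (S + k)) + (T₀ + 9 * (1 + 2 * (S + k + T₀ + 9))) ≤ T := by
    rw [hT', hk]
    gcongr <;> omega
  have hTk : k + T₀ + 9 ≤ T := by
    refine le_trans ?_ hT2
    have e1 : k ≤ k * (1 + 2 * (S + k)) := Nat.le_mul_of_pos_right _ (by omega)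
    omega
  have hρ : ∀ x, ¬ (50 ≤ x ∧ (x - 50) % 10 = i) → ∀ r, x ≠ subReg i r := by
    intro x hx r he
    apply hx
    unfold subReg at he
    omega
  have hρ' : ∀ x r, x < 50 → subReg i r ≠ x := by
    intro x r hx; unfold subReg; omega
  have hrun : Run (.seq (.arith .add (subReg i 0) 10 3) writeTol) s.reg s.tape k fun reg' tape' =>
      tape' = ratTape (1 / K) ∧ reg' (subReg i 0) = wordToNat (g.code J) ∧
        ∀ x, x < 15 ∨ 16 < x → x ≠ subReg i 0 → reg' x = s.reg x := by
    refine Run.seq_add ?_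
    refine (writeTol_run (K := K) (by omega) ?_ ?_ ?_).imp ?_
    · rw [Function.update_of_ne (hρ' _ _ (by norm_num)).symm, h3]
    · rw [Function.update_of_ne (hρ' _ _ (by norm_num)).symm, h8]
    · rw [Function.update_of_ne (hρ' _ _ (by norm_num)).symm, h11]
    · rintro r t ⟨a1, a2⟩
      refine ⟨a1, ?_, fun x hx hx' => ?_⟩
      · rw [a2 _ (by unfold subReg; omega), Function.update_self, h10, h3, add_zero]
      · rw [a2 x hx, Function.update_of_ne hx']
  refine Spec.mono (Spec.run_seq hrun hS hB ?_) hT2 (fun _ h => h) (fun _ _ h => h) le_rfl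
  rintro s₁ hq₁ hB₁ ⟨ht₁, hw₁, hr₁⟩
  set t₀ := MState.initial (g.code J) (1 / K) with ht₀
  -- Register `0` of the scheme holds the word, the others are 0 by assumption, and the tape holds
  -- `1 / K`.
  have hs₁ : s₁ = s₁.embed (subReg i) t₀ := by
    have e : Function.extend (subReg i) t₀.reg s₁.reg = s₁.reg := by
      funext x
      by_cases hx : ∃ r, subReg i r = x
      · obtain ⟨r, rfl⟩ := hx
        rw [(subReg_injective i).extend_apply]
        by_cases hr : r = 0
        · subst hr
          rw [hw₁]
          simp [ht₀, MState.initial]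
        · rw [hr₁ _ (by unfold subReg; omega) (fun e => hr (subReg_injective i e))]
          have := hz r
          unfold subReg
          rw [this]
          simp [ht₀, MState.initial, hr]
      · rw [Function.extend_apply' _ _ _ hx]
    unfold MState.embed
    rw [e]
    cases s₁
    simp only at ht₁
    simp [ht₀, MState.initial, ht₁]
  have hA1 : Spec O True (A.rename (subReg i)) s₁ T₀
      (fun s' => ∃ t, s' = s₁.embed (subReg i) t ∧ t.queries = [] ∧
        Bdd (S + k + T₀) s'.reg s'.tape)
      (fun s' => ∃ t, s' = s₁.embed (subReg i) t ∧ Approx (1 / K) (g.value J) t.output) (3 / 4) := by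
    intro fuel hf
    have hnone : none ∉ (A.eval O T₀ t₀).support := by
      intro hn
      obtain ⟨s', e, -⟩ := hP1 none hn
      cases e
    have he : (A.rename (subReg i)).eval O fuel s₁ =
        (A.eval O T₀ t₀).map (Option.map (s₁.embed (subReg i))) := by
      conv_lhs => rw [hs₁]
      rw [Prog.eval_rename (subReg_injective i), Prog.eval_fuel_mono O hf A t₀ hnone]
    constructor
    · intro o ho
      have ho' := ho
      rw [he, PMF.mem_support_map_iff] at ho'
      obtain ⟨o', ho1, rfl⟩ := ho'
      obtain ⟨t, rfl, ht⟩ := hP1 o' ho1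
      have htime : (s₁.embed (subReg i) t).time = s₁.time + t.time := rfl
      refine ⟨s₁.embed (subReg i) t, rfl, by omega, t, rfl, ?_, ?_⟩
      · exact hA.queries_eq ho1
      · have h1 := Prog.eval_size _ ho
        exact (h1.2 (S + k) (by omega) hB₁).mono (by omega)
    · intro _
      rw [he, PMF.toOuterMeasure_map_apply]
      refine le_trans ?_ (hP2.trans (PMF.toOuterMeasure_mono _ ?_))
      · push_cast
        exact le_rfl
      · rintro o ⟨⟨t, rfl, ht⟩, -⟩
        exact ⟨s₁.embed (subReg i) t, rfl, t, rfl, ht⟩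
  have hout : ∀ (c : ℝ≥0) (hc : c ≤ 1) t, t.queries = [] →
      Bdd (S + k + T₀) (s₁.embed (subReg i) t).reg (s₁.embed (subReg i) t).tape →
      (c ≠ 0 → Approx (1 / K) (g.value J) t.output) →
      Spec O True (.seq (.arith .sub 13 (subReg i 0) (subReg i 1)) <|
          .seq (.arith .add 14 (subReg i 2) 3) fixDenom)
        (s₁.embed (subReg i) t) (9 * (1 + 2 * (S + k + T₀ + 9)))
        (fun s' => (∀ x, x < 13 ∨ 20 ≤ x ∧ x < 50 ∨ 50 ≤ x ∧ (x - 50) % 10 ≠ i → s'.reg x = s.reg x) ∧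
        0 < s'.reg 14 ∧ Bdd (S + T) s'.reg s'.tape ∧
        ∀ c ∈ s'.queries, c ∈ s.queries ∨ c = (g.code J, 1 / (K : ℚ)))
      (fun s' => Approx (2 / K) (g.value J) ((s'.reg 13 : ℚ) / (s'.reg 14 : ℚ))) c := by
    intro c hc t htq hBt hap
    have hx : ∀ x, ¬ (50 ≤ x ∧ (x - 50) % 10 = i) → x < 15 ∨ 16 < x →
        (s₁.embed (subReg i) t).reg x = s.reg x := by
      intro x hx hx'
      have h1 : ¬ ∃ r, subReg i r = x := fun ⟨r, hr⟩ => hρ x hx r hr.symm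
      rw [← hr₁ x hx' (hρ x hx 0)]
      exact Function.extend_apply' _ _ _ h1
    have hrun2 : Run (.seq (.arith .sub 13 (subReg i 0) (subReg i 1)) <|
          .seq (.arith .add 14 (subReg i 2) 3) fixDenom) (s₁.embed (subReg i) t).reg
          (s₁.embed (subReg i) t).tape 9 fun reg' _ => reg' 13 = t.reg 0 - t.reg 1 ∧
            reg' 14 = max (t.reg 2) 1 ∧ ∀ x, x ≠ 13 → x ≠ 14 →
              reg' x = (s₁.embed (subReg i) t).reg x := by
      refine Run.seq_sub (Run.seq_add (fixDenom_run.imp ?_))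
      rintro r t' rfl
      refine ⟨?_, ?_, fun x h1 h2 => ?_⟩
      · simp [MState.embed_reg (subReg_injective i)]
      · simp [MState.embed_reg (subReg_injective i), hρ', hx 3, h3]
      · simp [h1, h2]
    refine Spec.of_run hrun2 (by omega) hBt ?_ hc ?_
    · rintro s' hq hb ⟨-, b, d⟩
      refine ⟨fun x hx' => ?_, by omega, hb.mono (by omega), fun q hq' => ?_⟩
      · rw [d x (by omega) (by omega), hx x (by omega) (by omega)]
      · rw [hq] at hq'
        change q ∈ t.queries ++ s₁.queries at hq'
        rw [htq, hq₁] at hq'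
        left; simpa using hq'
    · rintro s' - ⟨a, b, -⟩ hc0
      have h1 := hap hc0
      unfold MState.output at h1
      rw [a, b]
      refine (approx_nat_quotient (by linarith) h1).mono (by linarith) ?_
      gcongr
      norm_num
  have h5 := hA1.seq (p' := .seq (.arith .sub 13 (subReg i 0) (subReg i 1)) <|
          .seq (.arith .add 14 (subReg i 2) 3) fixDenom) (cb := 0) (cg := 1)
    (by rintro s' ⟨t, rfl, a, b⟩; exact hout 0 (by norm_num) t a b (fun h => absurd rfl h))
    (by
      rintro s' ⟨t, rfl, a, b⟩ ⟨t', e, hz'⟩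
      refine hout 1 le_rfl t a b (fun _ => ?_)
      have e' : ∀ r, t.reg r = t'.reg r := fun r => by
        rw [← MState.embed_reg (subReg_injective i) s₁ t, e,
          MState.embed_reg (subReg_injective i) s₁ t']
      unfold MState.output at hz' ⊢
      rwa [e', e', e'])
    (by norm_num)
  exact h5.mono le_rfl (fun _ h => h) (fun _ _ h => h) (by simp)

/-! ### The median of five fractions -/

/-- The fractions in the registers `20` to `29`. -/
def fractions (reg : ℕ → ℕ) (i : Fin 5) : ℕ × ℕ := (reg (20 + 2 * i), reg (21 + 2 * i))

/-- Exchange two fractions if they are in the wrong order. -/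
def cswap (a b : Fin 5) (f : Fin 5 → ℕ × ℕ) : Fin 5 → ℕ × ℕ :=
  if (f a).1 * (f b).2 ≤ (f b).1 * (f a).2 then f else f ∘ Equiv.swap a b

def boolSwap (a b : Fin 5) (g : Fin 5 → Bool) (k : Fin 5) : Bool :=
  if k = b then g a || g b else if k = a then g a && g b else g k

/-- A comparator network that moves the median to position `2`. -/
def medianNet : List (Fin 5 × Fin 5) := [(0, 1), (3, 4), (0, 3), (1, 4), (1, 2), (2, 3), (1, 2)]

/-- Only 32 inputs have to be checked. The network sends minimum and maximum to the ends and then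
sorts the three middle positions. -/
theorem medianNet_bool (g : Fin 5 → Bool) :
    (medianNet.foldl (fun g p => boolSwap p.1 p.2 g) g) 2 = true ↔
      3 ≤ (g 0).toNat + (g 1).toNat + (g 2).toNat + (g 3).toNat + (g 4).toNat := by
  have h : ∀ a b c d e : Bool,
      (medianNet.foldl (fun g p => boolSwap p.1 p.2 g) ![a, b, c, d, e]) 2 = true ↔
        3 ≤ a.toNat + b.toNat + c.toNat + d.toNat + e.toNat := by
    decide
  have e : g = ![g 0, g 1, g 2, g 3, g 4] := by
    funext i
    fin_cases i <;> rfl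
  rw [← h, ← e]

theorem forall_cswap {Q : ℕ × ℕ → Prop} (a b : Fin 5) {f : Fin 5 → ℕ × ℕ} (h : ∀ i, Q (f i)) (i) :
    Q (cswap a b f i) := by
  unfold cswap
  split_ifs
  · exact h i
  · exact h _

/-- The zero-one principle: an upward closed test `P` turns the minimum into a conjunction and the
maximum into a disjunction, so it commutes with comparators. Positive denominators are needed for
cross multiplication to compare fractions. -/
theorem comp_cswap {P : ℕ × ℕ → Bool} (hP : ∀ x y : ℕ × ℕ, 0 < x.2 → 0 < y.2 →
    x.1 * y.2 ≤ y.1 * x.2 → P x = true → P y = true) {a b : Fin 5} (hab : a ≠ b)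
    {f : Fin 5 → ℕ × ℕ} (hf : ∀ i, 0 < (f i).2) : P ∘ cswap a b f = boolSwap a b (P ∘ f) := by
  funext k
  unfold cswap boolSwap
  simp only [Function.comp_apply]
  split_ifs with h1 h2 h3 h2 h3
  · subst h2
    have := hP _ _ (hf a) (hf k) h1
    cases h4 : P (f a) <;> simp_all
  · subst h3
    have := hP _ _ (hf k) (hf b) h1
    cases h4 : P (f k) <;> simp_all
  · rfl
  · subst h2
    have := hP _ _ (hf k) (hf a) (not_le.1 h1).le
    rw [Function.comp_apply, Equiv.swap_apply_right]
    cases h4 : P (f k) <;> simp_all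
  · subst h3
    have := hP _ _ (hf b) (hf k) (not_le.1 h1).le
    rw [Function.comp_apply, Equiv.swap_apply_left]
    cases h4 : P (f b) <;> simp_all
  · rw [Function.comp_apply, Equiv.swap_apply_of_ne_of_ne h3 h2]

theorem comp_foldl_cswap {P : ℕ × ℕ → Bool} (hP : ∀ x y : ℕ × ℕ, 0 < x.2 → 0 < y.2 →
    x.1 * y.2 ≤ y.1 * x.2 → P x = true → P y = true) (l : List (Fin 5 × Fin 5))
    (hl : ∀ p ∈ l, p.1 ≠ p.2) {f : Fin 5 → ℕ × ℕ} (hf : ∀ i, 0 < (f i).2) :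
    P ∘ l.foldl (fun f p => cswap p.1 p.2 f) f = l.foldl (fun g p => boolSwap p.1 p.2 g) (P ∘ f) := by
  induction l generalizing f with
  | nil => rfl
  | cons p l ih =>
    rw [List.foldl_cons, List.foldl_cons,
      ih (fun p hp => hl p (by simp [hp])) (forall_cswap (Q := fun x => 0 < x.2) _ _ hf),
      comp_cswap hP (hl p (by simp)) hf]

theorem forall_foldl_cswap {Q : ℕ × ℕ → Prop} (l : List (Fin 5 × Fin 5)) {f : Fin 5 → ℕ × ℕ}
    (h : ∀ i, Q (f i)) (i) : Q (l.foldl (fun f p => cswap p.1 p.2 f) f i) := by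
  induction l generalizing f with
  | nil => exact h i
  | cons p l ih => exact ih (forall_cswap _ _ h)

open Classical in
-- The zero-one principle is applied to the thresholds "at least `lo`" and "above `hi`". Three
-- values in the interval mean that at least three pass the first test and at most two pass the
-- second.
theorem medianNet_mem {lo hi : ℝ} {f : Fin 5 → ℕ × ℕ} (hf : ∀ i, 0 < (f i).2)
    (h : 3 ≤ ∑ i : Fin 5, if lo ≤ ((f i).1 / (f i).2 : ℝ) ∧ ((f i).1 / (f i).2 : ℝ) ≤ hi
      then 1 else 0) :
    lo ≤ ((medianNet.foldl (fun f p => cswap p.1 p.2 f) f 2).1 /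
        (medianNet.foldl (fun f p => cswap p.1 p.2 f) f 2).2 : ℝ) ∧
      ((medianNet.foldl (fun f p => cswap p.1 p.2 f) f 2).1 /
        (medianNet.foldl (fun f p => cswap p.1 p.2 f) f 2).2 : ℝ) ≤ hi := by
  have hle : ∀ x y : ℕ × ℕ, 0 < x.2 → 0 < y.2 → x.1 * y.2 ≤ y.1 * x.2 →
      (x.1 / x.2 : ℝ) ≤ y.1 / y.2 := by
    intro x y hx hy h
    rw [div_le_div_iff₀ (by exact_mod_cast hx) (by exact_mod_cast hy)]
    exact_mod_cast h
  have hne : ∀ p ∈ medianNet, p.1 ≠ p.2 := by decide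
  have hlo := comp_foldl_cswap (P := fun x => decide (lo ≤ (x.1 / x.2 : ℝ)))
    (fun x y hx hy hxy h => decide_eq_true ((of_decide_eq_true h).trans (hle x y hx hy hxy)))
    medianNet hne hf
  have hhi := comp_foldl_cswap (P := fun x => decide (hi < (x.1 / x.2 : ℝ)))
    (fun x y hx hy hxy h => decide_eq_true ((of_decide_eq_true h).trans_le (hle x y hx hy hxy)))
    medianNet hne hf
  have hlo' := medianNet_bool ((fun x : ℕ × ℕ => decide (lo ≤ (x.1 / x.2 : ℝ))) ∘ f)
  have hhi' := medianNet_bool ((fun x : ℕ × ℕ => decide (hi < (x.1 / x.2 : ℝ))) ∘ f)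
  rw [← hlo] at hlo'
  rw [← hhi] at hhi'
  simp only [Function.comp_apply, decide_eq_true_eq] at hlo' hhi'
  rw [Fin.sum_univ_five] at h
  have key : ∀ i, (if lo ≤ ((f i).1 / (f i).2 : ℝ) ∧ ((f i).1 / (f i).2 : ℝ) ≤ hi then 1 else 0) ≤
        (decide (lo ≤ ((f i).1 / (f i).2 : ℝ))).toNat ∧
      (if lo ≤ ((f i).1 / (f i).2 : ℝ) ∧ ((f i).1 / (f i).2 : ℝ) ≤ hi then 1 else 0) +
        (decide (hi < ((f i).1 / (f i).2 : ℝ))).toNat ≤ 1 := by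
    intro i
    by_cases h1 : lo ≤ ((f i).1 / (f i).2 : ℝ) <;> by_cases h2 : ((f i).1 / (f i).2 : ℝ) ≤ hi
    · simp [h1, h2, not_lt.2 h2]
    · simp [h1, h2, not_le.1 h2]
    · simp [h1, h2, not_lt.2 h2]
    · simp [h1, h2, not_le.1 h2]
  have k0 := key 0
  have k1 := key 1
  have k2 := key 2
  have k3 := key 3
  have k4 := key 4
  refine ⟨hlo'.2 (by omega), ?_⟩
  rw [← not_lt, hhi']
  omega

/-- Put two of the fractions into order. -/
def comparator (a b : Fin 5) : Prog :=
  .seq (.arith .mul 15 (20 + 2 * a) (21 + 2 * b)) <|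
    .seq (.arith .mul 16 (20 + 2 * b) (21 + 2 * a)) <| .seq (.arith .sub 15 15 16) <|
    .ite 15 (.seq (.arith .add 16 (20 + 2 * a) 3) <|
      .seq (.arith .add (20 + 2 * a) (20 + 2 * b) 3) <| .seq (.arith .add (20 + 2 * b) 16 3) <|
      .seq (.arith .add 16 (21 + 2 * a) 3) <| .seq (.arith .add (21 + 2 * a) (21 + 2 * b) 3) <|
      .seq (.arith .add (21 + 2 * b) 16 3) .skip) .skip

/-- The difference of the cross products is truncated, so it is non-zero exactly when the fractions
are in the wrong order. -/
theorem comparator_run {a b : Fin 5} (hab : a ≠ b) {reg : ℕ → ℕ} {tape : List ℕ} {Z : ℕ}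
    (h3 : reg 3 = 0) (hZ : ∀ i, ((fractions reg) i).1.size ≤ Z ∧ ((fractions reg) i).2.size ≤ Z) :
    Run (comparator a b) reg tape (4 * Z + 11) fun reg' _ =>
      fractions reg' = cswap a b (fractions reg) ∧
        ∀ x, x < 15 ∨ 16 < x → x < 20 ∨ 30 ≤ x → reg' x = reg x := by
  have hab' : (a : ℕ) ≠ b := fun h => hab (Fin.ext h)
  have ha := a.2
  have hb := b.2
  unfold comparator
  have m1 : (reg (20 + 2 * a) * reg (21 + 2 * b)).size ≤ 2 * Z :=
    (size_mul_le _ _).trans (by have := (hZ a).1; have := (hZ b).2; simp only [fractions] at *; omega)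
  have m2 : (reg (20 + 2 * b) * reg (21 + 2 * a)).size ≤ 2 * Z :=
    (size_mul_le _ _).trans (by have := (hZ b).1; have := (hZ a).2; simp only [fractions] at *; omega)
  refine Run.mono (k := ((((7 + 1) + 1) + (1 + 2 * Z)) + (1 + 2 * Z))) ?_ (by omega)
  refine Run.seq_mul m1 (Run.seq_mul ?_ (Run.seq_sub (Run.ite (k := 7) ?_ ?_)))
  · rwa [Function.update_of_ne (by omega), Function.update_of_ne (by omega)]
  · intro h
    refine Run.seq_add (Run.seq_add (Run.seq_add (Run.seq_add (Run.seq_add (Run.seq_add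
      (Run.skip ⟨?_, ?_⟩))))))
    · have hlt : ¬ (fractions reg a).1 * (fractions reg b).2 ≤
          (fractions reg b).1 * (fractions reg a).2 := by
        intro hle
        apply h
        have e1 : 20 + 2 * (b : ℕ) ≠ 15 := by omega
        have e2 : 21 + 2 * (a : ℕ) ≠ 15 := by omega
        simp only [fractions] at hle
        simp [e1, e2, hle]
      unfold cswap
      rw [if_neg hlt]
      have g15 : ∀ x : ℕ, 20 + x ≠ 15 ∧ 20 + x ≠ 16 ∧ 21 + x ≠ 15 ∧ 21 + x ≠ 16 ∧
        3 ≠ 20 + x ∧ 3 ≠ 21 + x ∧ 16 ≠ 20 + x ∧ 16 ≠ 21 + x := fun x => by omega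
      have g2 : ∀ x y : ℕ, 20 + 2 * x ≠ 21 + 2 * y ∧ 21 + 2 * y ≠ 20 + 2 * x := fun x y => by omega
      funext k
      by_cases hkb : k = b
      · subst hkb
        simp [fractions, g15, g2, h3]
      · by_cases hka : k = a
        · subst hka
          simp [fractions, g15, g2, h3, hab']
        · simp [fractions, g15, g2, h3, Fin.val_inj, hka, hkb, Equiv.swap_apply_of_ne_of_ne hka hkb]
    · intro x h1 h2
      have e1 : x ≠ 15 := by omega
      have e2 : x ≠ 16 := by omega
      have e3 : ∀ i : Fin 5, x ≠ 20 + 2 * i ∧ x ≠ 21 + 2 * i := fun i => by omega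
      simp [e1, e2, e3]
  · intro h
    refine (Run.skip ⟨?_, ?_⟩).mono (by norm_num)
    · have e1 : ∀ x : ℕ, 20 + x ≠ 15 ∧ 20 + x ≠ 16 ∧ 21 + x ≠ 15 ∧ 21 + x ≠ 16 := fun x => by omega
      have hle : (fractions reg a).1 * (fractions reg b).2 ≤
          (fractions reg b).1 * (fractions reg a).2 := by
        simp [e1] at h
        simp only [fractions]
        omega
      unfold cswap
      rw [if_pos hle]
      funext k
      simp [fractions, e1]
    · intro x h1 h2
      simp [show x ≠ 15 by omega, show x ≠ 16 by omega]

def networkProg : List (Fin 5 × Fin 5) → Prog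
  | [] => .skip
  | p :: l => .seq (comparator p.1 p.2) (networkProg l)

theorem networkProg_run (l : List (Fin 5 × Fin 5)) (hl : ∀ p ∈ l, p.1 ≠ p.2) {reg : ℕ → ℕ}
    {tape : List ℕ} {Z : ℕ} (h3 : reg 3 = 0)
    (hZ : ∀ i, ((fractions reg) i).1.size ≤ Z ∧ ((fractions reg) i).2.size ≤ Z) :
    Run (networkProg l) reg tape (l.length * (4 * Z + 11) + 1) fun reg' _ =>
      fractions reg' = l.foldl (fun f p => cswap p.1 p.2 f) (fractions reg) ∧
        ∀ x, x < 15 ∨ 16 < x → x < 20 ∨ 30 ≤ x → reg' x = reg x := by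
  induction l generalizing reg tape with
  | nil =>
    refine (Run.skip ⟨rfl, fun _ _ _ => rfl⟩).mono (by simp)
  | cons p l ih =>
    refine Run.mono (k := (4 * Z + 11) + (l.length * (4 * Z + 11) + 1)) (Run.seq ?_) (by
      rw [List.length_cons, add_mul]; omega)
    refine (comparator_run (hl p (by simp)) h3 hZ).imp ?_
    rintro r t ⟨h1, h2⟩
    refine (ih (fun p hp => hl p (by simp [hp])) ?_ ?_).imp ?_
    · rw [h2 3 (by omega) (by omega), h3]
    · intro i
      rw [h1]
      exact forall_cswap (Q := fun x => x.1.size ≤ Z ∧ x.2.size ≤ Z) _ _ hZ i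
    · rintro r' t' ⟨h4, h5⟩
      refine ⟨by rw [h4, h1, List.foldl_cons], fun x hx hx' => by rw [h5 x hx hx', h2 x hx hx']⟩

/-! ### Five calls -/

/-- The probability that at least `m` out of `n` independent calls succeed. -/
def successTail : ℕ → ℕ → ℝ≥0
  | 0, 0 => 1
  | 0, _ + 1 => 0
  | n + 1, m => successTail n m * (1 / 4) + successTail n (m - 1) * (3 / 4)

theorem successTail_anti (n m : ℕ) : successTail n m ≤ successTail n (m - 1) := by
  induction n generalizing m with
  | zero => cases m with
    | zero => exact le_rfl
    | succ m => simp [successTail]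
  | succ n ih =>
    unfold successTail
    gcongr
    · exact ih m
    · exact ih _

/-- This is the recursion in the shape `cb + (cg - cb) * c₁` of `Spec.seq`; monotonicity makes the
truncated difference a true one. -/
theorem successTail_succ (n m : ℕ) : successTail (n + 1) m =
    successTail n m + (successTail n (m - 1) - successTail n m) * (3 / 4) := by
  obtain ⟨d, hd⟩ := exists_add_of_le (successTail_anti n m)
  rw [successTail, hd, add_tsub_cancel_left]
  rw [← NNReal.coe_inj]
  push_cast
  ring

/-- The tail is 459/512, with square about 0.804. Three calls would give 27/32, whose square is
below 3/4. -/
theorem successTail_five : 3 / 4 ≤ successTail 5 3 * successTail 5 3 := by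
  rw [← NNReal.coe_le_coe]
  norm_num [successTail]

/-- The registers hold the arguments of a call. -/
structure CallArgs (g : CountingProblem) (J : g.Inst) (K D : ℕ) (reg : ℕ → ℕ) : Prop where
  h3 : reg 3 = 0
  h8 : reg 8 = 2
  h9 : reg 9 = 1
  h10 : reg 10 = wordToNat (g.code J)
  h11 : reg 11 = K
  h12 : reg 12 = D

theorem CallArgs.of_eq {g : CountingProblem} {J : g.Inst} {K D : ℕ} {reg reg' : ℕ → ℕ}
    (h : CallArgs g J K D reg) (he : ∀ x, x < 13 → reg' x = reg x) : CallArgs g J K D reg' :=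
  ⟨by rw [he 3 (by omega), h.h3], by rw [he 8 (by omega), h.h8], by rw [he 9 (by omega), h.h9],
    by rw [he 10 (by omega), h.h10], by rw [he 11 (by omega), h.h11], by rw [he 12 (by omega), h.h12]⟩

/-- Perform `j` calls and keep the answers. -/
def callsProg (call : ℕ → Prog) (b : ℕ) : ℕ → Prog
  | 0 => .skip
  | j + 1 => .seq (call (b + j)) <|
    .seq (.seq (.arith .add (20 + 2 * j) 13 3) (.arith .add (21 + 2 * j) 14 3)) (callsProg call b j)

/-- The composition accounts for the contents having grown by the time the remaining calls are made.
-/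
def callsTime (T : Polynomial ℕ) : ℕ → Polynomial ℕ
  | 0 => 2 * Polynomial.X + 3
  | j + 1 => T + (2 * (1 + 2 * (Polynomial.X + T + 2)) +
    (callsTime T j).comp (Polynomial.X + T + 2))

open Classical in
-- After a good first answer `m - 1` good ones among the rest suffice, otherwise `m` are needed;
-- this is the recursion of `successTail`. Each call leaves the private registers of the others at
-- zero, so the induction hypothesis stays applicable.
theorem callsProg_spec {g : CountingProblem} {O : Oracle} {good : Prop} {call : ℕ → Prog}
    {T : Polynomial ℕ} (hcall : CallSpec g O good call T) {J : g.Inst} {K D V : ℕ} (hK : 2 ≤ K)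
    (hD : V + 4 + K ≤ D) (h1 : 1 ≤ g.value J) (hV : g.value J ≤ 2 ^ V) {b : ℕ} (hb : b ≤ 5) (j : ℕ)
    (hj : j ≤ 5) (m : ℕ) {s : MState} {S : ℕ} (hS : 3 ≤ S) (hB : Bdd S s.reg s.tape)
    (ha : CallArgs g J K D s.reg)
    (hz : ∀ x, 50 ≤ x → b ≤ (x - 50) % 10 → (x - 50) % 10 < b + j → s.reg x = 0) :
    Spec O good (callsProg call b j) s ((callsTime T j).eval (S + K + D))
      (fun s' => (∀ x, x < 13 ∨ 20 + 2 * j ≤ x ∧ x < 50 ∨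
          50 ≤ x ∧ ((x - 50) % 10 < b ∨ b + j ≤ (x - 50) % 10) → s'.reg x = s.reg x) ∧
        (∀ i < j, 0 < s'.reg (21 + 2 * i)) ∧
        Bdd (S + (callsTime T j).eval (S + K + D)) s'.reg s'.tape ∧
        ∀ c ∈ s'.queries, c ∈ s.queries ∨ c = (g.code J, 1 / (K : ℚ)))
      (fun s' => m ≤ ∑ i ∈ Finset.range j, if Approx (2 / K) (g.value J)
        ((s'.reg (20 + 2 * i) : ℚ) / (s'.reg (21 + 2 * i) : ℚ)) then 1 else 0)
      (successTail j m) := by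
  induction j generalizing m s S with
  | zero =>
    have h0 : Run Prog.skip s.reg s.tape 1 (fun r _ => r = s.reg) := Run.skip rfl
    refine Spec.mono (Spec.of_run (R := fun s' => s'.reg = s.reg ∧ s'.queries = s.queries ∧
      Bdd (S + 1) s'.reg s'.tape) (G := fun _ => m = 0) (c := successTail 0 m) h0 hS hB
      (fun s' a b c => ⟨c, a, b⟩) ?_ ?_) ?_ ?_ ?_ le_rfl
    · cases m <;> simp [successTail]
    · rintro s' - - hc
      cases m with
      | zero => rfl
      | succ m => exact absurd rfl hc
    · simp [callsTime]; omega
    · rintro s' ⟨e1, e2, e3⟩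
      refine ⟨fun x _ => by rw [e1], by simp, e3.mono (by simp [callsTime]), fun c hc => ?_⟩
      rw [e2] at hc; exact Or.inl hc
    · rintro s' - rfl
      exact Nat.zero_le _
  | succ j ih =>
    have h0 := hcall (b + j) (by omega) s J K D V S ha.h3 ha.h8 ha.h9 ha.h10 ha.h11 hK ha.h12 hD h1
      hV (fun r => hz _ (by omega) (by omega) (by omega)) hS hB
    set t := T.eval (S + K + D) with ht
    have hrest : ∀ m' (s₁ : MState),
        ((∀ x, x < 13 ∨ 20 ≤ x ∧ x < 50 ∨ 50 ≤ x ∧ (x - 50) % 10 ≠ b + j → s₁.reg x = s.reg x) ∧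
        0 < s₁.reg 14 ∧ Bdd (S + t) s₁.reg s₁.tape ∧
        ∀ c ∈ s₁.queries, c ∈ s.queries ∨ c = (g.code J, 1 / (K : ℚ))) →
        (m' < m → m' + 1 = m ∧ Approx (2 / K) (g.value J) ((s₁.reg 13 : ℚ) / (s₁.reg 14 : ℚ))) →
        Spec O good (.seq (.seq (.arith .add (20 + 2 * j) 13 3) (.arith .add (21 + 2 * j) 14 3))
          (callsProg call b j)) s₁ (2 * (1 + 2 * (S + K + D + t + 2)) +
            (callsTime T j).eval (S + K + D + t + 2))
      (fun s' => (∀ x, x < 13 ∨ 20 + 2 * (j + 1) ≤ x ∧ x < 50 ∨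
          50 ≤ x ∧ ((x - 50) % 10 < b ∨ b + (j + 1) ≤ (x - 50) % 10) → s'.reg x = s.reg x) ∧
        (∀ i < j + 1, 0 < s'.reg (21 + 2 * i)) ∧
        Bdd (S + (callsTime T (j + 1)).eval (S + K + D)) s'.reg s'.tape ∧
        ∀ c ∈ s'.queries, c ∈ s.queries ∨ c = (g.code J, 1 / (K : ℚ)))
      (fun s' => m ≤ ∑ i ∈ Finset.range (j + 1), if Approx (2 / K) (g.value J)
        ((s'.reg (20 + 2 * i) : ℚ) / (s'.reg (21 + 2 * i) : ℚ)) then 1 else 0)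
      (successTail j m') := by
      rintro m' s₁ ⟨f1, f2, f3, f4⟩ hm
      have hrun : Run (.seq (.arith .add (20 + 2 * j) 13 3) (.arith .add (21 + 2 * j) 14 3)) s₁.reg
          s₁.tape 2 fun r _ => r (20 + 2 * j) = s₁.reg 13 ∧ r (21 + 2 * j) = s₁.reg 14 ∧
            ∀ x, x ≠ 20 + 2 * j → x ≠ 21 + 2 * j → r x = s₁.reg x := by
        have e3 : s₁.reg 3 = 0 := by rw [f1 3 (by omega), ha.h3]
        refine Run.seq_add (Run.arith (by simp) ⟨?_, ?_, ?_⟩)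
        · rw [Function.update_of_ne (by omega), Function.update_self, e3, add_zero]
        · rw [Function.update_self]
          simp only [ArithOp.apply]
          rw [Function.update_of_ne (by omega), Function.update_of_ne (by omega), e3, add_zero]
        · intro x hx hx'
          rw [Function.update_of_ne hx', Function.update_of_ne hx]
      refine Spec.mono (Spec.run_seq hrun (by omega) f3 (fun s₂ q₂ b₂ h₂ => ?_))
        (t := 2 * (1 + 2 * (S + t + 2)) + (callsTime T j).eval (S + K + D + t + 2)) (by omega)
        (fun _ h => h) (fun _ _ h => h) le_rfl
      obtain ⟨g1, g2, g3⟩ := h₂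
      have hfr : ∀ x, x < 13 ∨ 22 + 2 * j ≤ x ∧ x < 50 ∨ 50 ≤ x ∧ (x - 50) % 10 ≠ b + j →
          s₂.reg x = s.reg x := fun x hx => by
        rw [g3 x (by omega) (by omega), f1 x (by omega)]
      have h5 := ih (by omega) m' (s := s₂) (S := S + t + 2) (by omega) b₂
        (ha.of_eq fun x hx => hfr x (Or.inl hx))
        (fun x hx hx1 hx2 => by rw [hfr x (by omega), hz x hx hx1 (by omega)])
      rw [show S + t + 2 + K + D = S + K + D + t + 2 by ring] at h5
      refine h5.mono le_rfl ?_ ?_ le_rfl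
      · rintro s' ⟨k1, k2, k3, k4⟩
        refine ⟨fun x hx => ?_, fun i hi => ?_, k3.mono ?_, fun c hc => ?_⟩
        · rw [k1 x (by omega), hfr x (by omega)]
        · rcases Nat.lt_succ_iff_lt_or_eq.1 hi with hi | rfl
          · exact k2 i hi
          · rw [k1 _ (by omega), g2]; exact f2
        · simp [callsTime, ← ht]
          omega
        · rcases k4 c hc with h | h
          · rw [q₂] at h; exact f4 c h
          · exact Or.inr h
      · rintro s' ⟨k1, k2, k3, k4⟩ k5
        rw [Finset.sum_range_succ]
        by_cases hmm : m' < m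
        · obtain ⟨hm1, hm2⟩ := hm hmm
          rw [k1 (20 + 2 * j) (by omega), k1 (21 + 2 * j) (by omega), g1, g2, if_pos hm2]
          omega
        · omega
    have h2 := h0.seq (fun s₁ h => hrest m s₁ h (fun h => absurd h (lt_irrefl _)))
      (fun s₁ h hg => hrest (m - 1) s₁ h (fun hm => ⟨by omega, hg⟩)) (successTail_anti j m)
    refine h2.mono ?_ (fun _ h => h) (fun _ _ h => h) (by rw [successTail_succ])
    simp [callsTime, ← ht]

/-- The median of five answers. -/
def medianProg (call : ℕ → Prog) (b : ℕ) : Prog :=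
  .seq (callsProg call b 5) (networkProg medianNet)

/-- Seven comparators on numbers of Z bits take 7 * (4 * Z + 11) + 1 = 28 * Z + 78 steps. -/
def medianTime (T : Polynomial ℕ) : Polynomial ℕ :=
  callsTime T 5 + (28 * (Polynomial.X + callsTime T 5) + 78) *
    (1 + 2 * (Polynomial.X + callsTime T 5 + (28 * (Polynomial.X + callsTime T 5) + 78)))

theorem medianProg_spec {g : CountingProblem} {O : Oracle} {good : Prop} {call : ℕ → Prog}
    {T : Polynomial ℕ} (hcall : CallSpec g O good call T) {J : g.Inst} {K D V : ℕ} (hK : 2 ≤ K)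
    (hD : V + 4 + K ≤ D) (h1 : 1 ≤ g.value J) (hV : g.value J ≤ 2 ^ V) {b : ℕ} (hb : b ≤ 5)
    {s : MState} {S : ℕ} (hS : 3 ≤ S) (hB : Bdd S s.reg s.tape) (ha : CallArgs g J K D s.reg)
    (hz : ∀ x, 50 ≤ x → b ≤ (x - 50) % 10 → (x - 50) % 10 < b + 5 → s.reg x = 0) :
    Spec O good (medianProg call b) s ((medianTime T).eval (S + K + D))
      (fun s' => (∀ x, x < 13 ∨ 30 ≤ x ∧ x < 50 ∨
          50 ≤ x ∧ ((x - 50) % 10 < b ∨ b + 5 ≤ (x - 50) % 10) → s'.reg x = s.reg x) ∧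
        0 < s'.reg 25 ∧ Bdd (S + (medianTime T).eval (S + K + D)) s'.reg s'.tape ∧
        ∀ c ∈ s'.queries, c ∈ s.queries ∨ c = (g.code J, 1 / (K : ℚ)))
      (fun s' => Approx (2 / K) (g.value J) ((s'.reg 24 : ℚ) / (s'.reg 25 : ℚ)))
      (successTail 5 3) := by
  classical
  have h0 := callsProg_spec hcall hK hD h1 hV hb 5 le_rfl 3 hS hB ha hz
  set t := (callsTime T 5).eval (S + K + D) with ht
  set k := 28 * (S + t) + 78 with hk
  have hrest : ∀ (c : ℝ≥0) (hc : c ≤ 1) (s₁ : MState),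
      ((∀ x, x < 13 ∨ 20 + 2 * 5 ≤ x ∧ x < 50 ∨
          50 ≤ x ∧ ((x - 50) % 10 < b ∨ b + 5 ≤ (x - 50) % 10) → s₁.reg x = s.reg x) ∧
        (∀ i < 5, 0 < s₁.reg (21 + 2 * i)) ∧ Bdd (S + t) s₁.reg s₁.tape ∧
        ∀ c ∈ s₁.queries, c ∈ s.queries ∨ c = (g.code J, 1 / (K : ℚ))) →
      (c ≠ 0 → 3 ≤ ∑ i ∈ Finset.range 5, if Approx (2 / K) (g.value J)
        ((s₁.reg (20 + 2 * i) : ℚ) / (s₁.reg (21 + 2 * i) : ℚ)) then 1 else 0) →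
      Spec O good (networkProg medianNet) s₁ (k * (1 + 2 * (S + t + k)))
      (fun s' => (∀ x, x < 13 ∨ 30 ≤ x ∧ x < 50 ∨
          50 ≤ x ∧ ((x - 50) % 10 < b ∨ b + 5 ≤ (x - 50) % 10) → s'.reg x = s.reg x) ∧
        0 < s'.reg 25 ∧ Bdd (S + (medianTime T).eval (S + K + D)) s'.reg s'.tape ∧
        ∀ c ∈ s'.queries, c ∈ s.queries ∨ c = (g.code J, 1 / (K : ℚ)))
      (fun s' => Approx (2 / K) (g.value J) ((s'.reg 24 : ℚ) / (s'.reg 25 : ℚ))) c := by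
    rintro c hc s₁ ⟨f1, f2, f3, f4⟩ hsum
    have hpos : ∀ i, 0 < (fractions s₁.reg i).2 := fun i => f2 i i.2
    have hrun := networkProg_run medianNet (by decide) (reg := s₁.reg) (tape := s₁.tape)
      (Z := S + t) (by rw [f1 3 (by omega), ha.h3]) (fun i => ⟨f3.1 _, f3.1 _⟩)
    refine Spec.of_run (hrun.mono (by simp [medianNet]; omega)) (by omega) f3 ?_ hc ?_
    · rintro s' q' b' ⟨g1, g2⟩
      refine ⟨fun x hx => by rw [g2 x (by omega) (by omega), f1 x (by omega)], ?_, b'.mono ?_,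
        fun c hc => f4 c (by rwa [← q'])⟩
      · have := forall_foldl_cswap (Q := fun x => 0 < x.2) medianNet hpos 2
        rw [← g1] at this
        exact this
      · have e1 : k ≤ k * (1 + 2 * (S + t + k)) := Nat.le_mul_of_pos_right _ (by omega)
        have e2 : k * (1 + 2 * (S + t + k)) ≤ (28 * (S + K + D + t) + 78) *
            (1 + 2 * (S + K + D + t + (28 * (S + K + D + t) + 78))) := by
          rw [hk]; gcongr <;> omega
        simp [medianTime, ← ht]
        omega
    · rintro s' - ⟨g1, -⟩ hc0
      have h2 := hsum hc0
      rw [← Fin.sum_univ_eq_sum_range (fun i => if Approx (2 / K) (g.value J)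
        ((s₁.reg (20 + 2 * i) : ℚ) / (s₁.reg (21 + 2 * i) : ℚ)) then 1 else 0)] at h2
      have h3 := medianNet_mem (lo := Real.exp (-((2 / K : ℚ) : ℝ)) * g.value J)
        (hi := Real.exp ((2 / K : ℚ) : ℝ) * g.value J) hpos (by
          simp only [Approx, Rat.cast_div, Rat.cast_natCast] at h2
          simpa only [fractions, Rat.cast_div, Rat.cast_natCast] using h2)
      rw [← g1] at h3
      simp only [fractions] at h3
      unfold Approx
      push_cast at h3 ⊢
      exact h3
  have h2 := h0.seq (cb := 0) (cg := 1) (fun s₁ h => hrest 0 (by norm_num) s₁ h (fun h => absurd rfl h))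
    (fun s₁ h hg => hrest 1 le_rfl s₁ h (fun _ => hg)) (by norm_num)
  refine h2.mono ?_ (fun _ h => h) (fun _ _ h => h) (by simp)
  have e2 : k * (1 + 2 * (S + t + k)) ≤ (28 * (S + K + D + t) + 78) *
      (1 + 2 * (S + K + D + t + (28 * (S + K + D + t) + 78))) := by
    rw [hk]; gcongr <;> omega
  simp [medianTime, ← ht]
  omega

/-! ### The reduction -/

/-- The errors add up in the exponent: 1/(4K) for each of the two estimates and 1/(2K) for the
gadget, together 1/K < ε. -/
theorem Approx.ratio {A b Q : ℝ} {K : ℕ} {ε : ℚ} {x y x' y' : ℕ} (hK : 1 ≤ K)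
    (hε : 1 / (K : ℚ) < ε) (hb : 0 ≤ b) (hQ : 0 < Q)
    (h1 : Real.exp (-(1 / (2 * K))) * b * Q ≤ A) (h2 : A ≤ b * Q)
    (hx : Approx (2 / ((8 * K : ℕ) : ℚ)) A (x / y)) (hx' : Approx (2 / ((8 * K : ℕ) : ℚ)) Q (x' / y')) :
    Approx ε b (((x * y' : ℕ) - (0 : ℕ) : ℚ) / ((y * x' : ℕ) : ℚ)) := by
  have hK0 : (0 : ℝ) < K := by exact_mod_cast hK
  have hq : (2 / ((8 * K : ℕ) : ℚ)) = 1 / (4 * K) := by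
    push_cast
    rw [div_eq_div_iff (by positivity) (by positivity)]
    ring
  rw [hq] at hx hx'
  have he : (((x * y' : ℕ) - (0 : ℕ) : ℚ) / ((y * x' : ℕ) : ℚ)) = (x / y) / (x' / y') := by
    push_cast
    rw [sub_zero, div_div_div_eq]
  rw [he]
  refine Approx.mono (ε := 1 / K) ?_ hb hε.le
  unfold Approx at *
  push_cast at hx hx' ⊢
  set z : ℝ := x / y
  set z' : ℝ := x' / y'
  set e := Real.exp (1 / (4 * K) : ℝ) with he
  have e0 : 0 < e := Real.exp_pos _
  have e1 : Real.exp (-(1 / (4 * K)) : ℝ) = e⁻¹ := Real.exp_neg _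
  have e2 : Real.exp (-(1 / (2 * K)) : ℝ) = e⁻¹ * e⁻¹ := by
    rw [← e1, ← Real.exp_add]; congr 1; field_simp; norm_num
  have e3 : Real.exp (1 / K : ℝ) = e * e * (e * e) := by
    rw [he, ← Real.exp_add, ← Real.exp_add]; congr 1; field_simp; norm_num
  rw [Real.exp_neg, e3]
  rw [e1] at hx hx'
  rw [e2] at h1
  have hz' : 0 < z' := lt_of_lt_of_le (by positivity) hx'.1
  rw [le_div_iff₀ hz', div_le_iff₀ hz']
  constructor
  · calc (e * e * (e * e))⁻¹ * b * z' ≤ (e * e * (e * e))⁻¹ * b * (e * Q) := by gcongr; exact hx'.2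
      _ = e⁻¹ * (e⁻¹ * e⁻¹ * b * Q) := by field_simp
      _ ≤ e⁻¹ * A := by gcongr
      _ ≤ z := hx.1
  · have h1e : 1 ≤ e := Real.one_le_exp (by positivity)
    calc z ≤ e * A := hx.2
      _ ≤ e * (b * Q) := by gcongr
      _ = e * e * b * (e⁻¹ * Q) := by field_simp
      _ ≤ e * e * b * z' := by gcongr; exact hx'.1
      _ ≤ e * e * (e * e) * b * z' := by
        have h2e : 1 ≤ e * e := one_le_mul_of_one_le_of_one_le h1e h1e
        exact mul_le_mul_of_nonneg_right (mul_le_mul_of_nonneg_right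
          (le_mul_of_one_le_right (by positivity) h2e) hb) hz'.le

/-- Estimate the value of the gadget graph and of a graph without hyperedges, and divide. -/
def reductionProg (call : ℕ → Prog) (C c : ℕ) : Prog :=
  .seq (prepProg C c) <| .seq (medianProg call 0) <|
    .seq (.seq (.arith .add 30 24 3) <| .seq (.arith .add 31 25 3) <| .arith .add 10 32 3) <|
    .seq (medianProg call 5) <|
    .seq (.arith .mul 0 30 25) <| .seq (.set 1 0) <| .arith .mul 2 31 24

/-- `prepSteps` with K and n replaced by their bounds 2L + 1 and L, where L is the size parameter.
-/
def prepTime (C c : ℕ) : Polynomial ℕ :=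
  let K : Polynomial ℕ := 2 * Polynomial.X + 1
  let n : Polynomial ℕ := Polynomial.X
  8 * K + (5 * n + 21) + (C + C * K + C * K * n + C * K * n * n + c + c * (C * K * n * n + 1) + 30) +
    (C * K * n * n * ((C * K * n * n + 1) * (17 * (n * n) + 5 * (C * K * n * n) + 40 + 1) + 1 + 3 +
      1) + 15 * (C * K * n * n) + 40) + (5 * (C * K * n * n) + 40) + 50

def callParams (C c : ℕ) : Polynomial ℕ :=
  8 * (2 * Polynomial.X + 1) + ((c : Polynomial ℕ) *
    ((C : Polynomial ℕ) * (2 * Polynomial.X + 1) * Polynomial.X * Polynomial.X + 1) +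
    Polynomial.X + 8 * (2 * Polynomial.X + 1) + 4)

theorem prepSteps_le {C c K n L : ℕ} (hK : K ≤ 2 * L + 1) (hn : n ≤ L) :
    prepSteps C c K n ≤ (prepTime C c).eval L := by
  have h : (prepTime C c).eval L = prepSteps C c (2 * L + 1) L := by
    simp [prepTime, prepSteps]
  rw [h]
  unfold prepSteps
  gcongr

theorem callParams_le {C c K n L : ℕ} (hK : K ≤ 2 * L + 1) (hn : n ≤ L) :
    8 * K + (c * (C * K * n * n + 1) + n + 8 * K + 4) ≤ (callParams C c).eval L := by
  have h : (callParams C c).eval L = 8 * (2 * L + 1) + (c * (C * (2 * L + 1) * L * L + 1) + L +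
      8 * (2 * L + 1) + 4) := by
    simp [callParams]
  rw [h]
  gcongr

def sizeAfterPrep (C c : ℕ) : Polynomial ℕ := Polynomial.X + 3 + prepTime C c

def firstMedianTime (T : Polynomial ℕ) (C c : ℕ) : Polynomial ℕ :=
  (medianTime T).comp (sizeAfterPrep C c + callParams C c)

def sizeAfterFirst (T : Polynomial ℕ) (C c : ℕ) : Polynomial ℕ :=
  sizeAfterPrep C c + firstMedianTime T C c + 3

def secondMedianTime (T : Polynomial ℕ) (C c : ℕ) : Polynomial ℕ :=
  (medianTime T).comp (sizeAfterFirst T C c + callParams C c)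

def sizeAfterSecond (T : Polynomial ℕ) (C c : ℕ) : Polynomial ℕ :=
  sizeAfterFirst T C c + secondMedianTime T C c

/-- The final summand `callParams` is not needed for the running time; it makes the bound dominate
8K, the inverse of the tolerance in each query. -/
def reductionTime (T : Polynomial ℕ) (C c : ℕ) : Polynomial ℕ :=
  prepTime C c * (1 + 2 * sizeAfterPrep C c) + (firstMedianTime T C c +
    (3 * (1 + 2 * sizeAfterFirst T C c) + (secondMedianTime T C c +
      (4 * sizeAfterSecond T C c + 4) *
        (1 + 2 * (sizeAfterSecond T C c + (4 * sizeAfterSecond T C c + 4)))))) + callParams C c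

/-- The first median uses the private registers with last digit 0 to 4, the second those with last
digit 5 to 9, so that both start on zeros. Both medians are good with probability at least
`successTail 5 3` squared, and then `Approx.ratio` applies. -/
theorem reductionProg_spec {q : ℝ} (hq : 1 < q) {C c : ℕ} (hC : 4 ≤ C * (q - 1)) (hc : q ≤ 2 ^ c)
    {O : Oracle} {good : Prop} {call : ℕ → Prog} {T : Polynomial ℕ}
    (hcall : CallSpec (UniformHyperTutte q (q - 1)) O good call T) (B : BipGraph) {ε : ℚ}
    (hε : 0 < ε) {L : ℕ} (hL : L = B.code.length + ⌈ε⁻¹⌉₊) :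
    Spec O good (reductionProg call C c) (MState.initial B.code ε) ((reductionTime T C c).eval L)
      (fun s' => ∀ d ∈ s'.queries, (∃ J : UniformHypergraph, J.code = d.1) ∧ 0 < d.2 ∧ d.2 < 1 ∧
        d.2⁻¹ ≤ (((reductionTime T C c).eval L : ℕ) : ℚ))
      (fun s' => Approx ε (BIS.value B) s'.output) (3 / 4) := by
  obtain ⟨K, hK, hKε, hKle, hprep⟩ := prepProg_run C c B hε
  set n := B.order with hn
  have hnL : n ≤ L := by have := B.order_le_length_code; omega
  have hKL : K ≤ 2 * L + 1 := by omega
  set N := C * K * n * n + 1 with hN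
  set D := c * N + n + 8 * K + 4 with hD
  set g := UniformHyperTutte q (q - 1) with hg
  set J : UniformHypergraph := B.gadget (C * K * n) with hJ
  set J' : UniformHypergraph := UniformHypergraph.isolated (C * K * n * n) with hJ'
  -- the values of the two instances
  obtain ⟨v1, v2⟩ := B.gadget_tutte_bounds q hq C K hC hK
  have hval : g.value J = (B.gadget (C * K * n)).toMulti.tutte q (fun _ => q - 1) := rfl
  rw [← hn, ← hval, ← hN] at v1 v2
  have hval' : g.value J' = q ^ N := 
    UniformHypergraph.isolated_tutte (C * K * n * n) q (q - 1)
  have hJ1 : 1 ≤ g.value J := one_le_tutte J q hq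
  have hJ1' : 1 ≤ g.value J' := one_le_tutte J' q hq
  have hqN : q ^ N ≤ 2 ^ (c * N) := by rw [pow_mul]; gcongr
  have hbis : 0 ≤ BIS.value B := by unfold BIS; positivity
  have hJV : g.value J ≤ 2 ^ (c * N + n) := by
    refine v2.trans ?_
    rw [pow_add (2 : ℝ), mul_comm]
    exact mul_le_mul hqN (BIS_value_le B) hbis (by positivity)
  have hJV' : g.value J' ≤ 2 ^ (c * N + n) := by
    rw [hval']
    exact hqN.trans (pow_le_pow_right₀ (by norm_num) (by omega))
  -- the resources
  set P := (prepTime C c).eval L with hP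
  set W := (sizeAfterPrep C c).eval L with hW
  set M := (callParams C c).eval L with hM
  set t₁ := (firstMedianTime T C c).eval L with ht₁
  set W₁ := (sizeAfterFirst T C c).eval L with hW₁
  set t₂ := (secondMedianTime T C c).eval L with ht₂
  set W₂ := (sizeAfterSecond T C c).eval L with hW₂
  set R := (reductionTime T C c).eval L with hR
  have eW : W = L + 3 + P := by rw [hW, hP]; simp [sizeAfterPrep]
  have et₁ : t₁ = (medianTime T).eval (W + M) := by rw [ht₁, hW, hM]; simp [firstMedianTime]
  have eW₁ : W₁ = W + t₁ + 3 := by rw [hW₁, hW, ht₁]; simp [sizeAfterFirst]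
  have et₂ : t₂ = (medianTime T).eval (W₁ + M) := by rw [ht₂, hW₁, hM]; simp [secondMedianTime]
  have eW₂ : W₂ = W₁ + t₂ := by rw [hW₂, hW₁, ht₂]; simp [sizeAfterSecond]
  have eR : R = P * (1 + 2 * W) + (t₁ + (3 * (1 + 2 * W₁) + (t₂ + (4 * W₂ + 4) *
      (1 + 2 * (W₂ + (4 * W₂ + 4)))))) + M := by
    rw [hR, hP, hW, ht₁, hW₁, ht₂, hW₂, hM]
    simp [reductionTime]
  have hKD : 8 * K + D ≤ M := callParams_le hKL hnL
  clear_value P W M t₁ W₁ t₂ W₂ R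
  set p := successTail 5 3 with hp
  let Rg : MState → Prop := fun s' => ∀ d ∈ s'.queries, (∃ J : UniformHypergraph, J.code = d.1) ∧
    0 < d.2 ∧ d.2 < 1 ∧ d.2⁻¹ ≤ (R : ℚ)
  let Gd : MState → Prop := fun s' => Approx ε (BIS.value B) s'.output
  have hlegal : ∀ J : UniformHypergraph, (∃ J₁ : UniformHypergraph, J₁.code = J.code) ∧
      (0 : ℚ) < 1 / ((8 * K : ℕ) : ℚ) ∧ 1 / ((8 * K : ℕ) : ℚ) < 1 ∧
        (1 / ((8 * K : ℕ) : ℚ))⁻¹ ≤ (R : ℚ) := by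
    intro J₁
    have h8 : (1 : ℚ) < ((8 * K : ℕ) : ℚ) := by exact_mod_cast (by omega : 1 < 8 * K)
    refine ⟨⟨J₁, rfl⟩, by positivity, ?_, ?_⟩
    · rw [div_lt_one (by positivity)]; exact h8
    · rw [one_div, inv_inv]
      exact_mod_cast (by omega : 8 * K ≤ R)
  -- The program is analysed from its end backwards. The parameter `e` is 0 if an earlier median may
  -- have failed and positive otherwise; correctness of what was computed before is assumed only in
  -- the latter case.
  have hfin : ∀ (e : ℝ≥0) (s : MState), e ≤ 1 → Bdd W₂ s.reg s.tape → Rg s →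
      (e ≠ 0 → Approx (2 / ((8 * K : ℕ) : ℚ)) (g.value J) ((s.reg 30 : ℚ) / (s.reg 31 : ℚ)) ∧
        Approx (2 / ((8 * K : ℕ) : ℚ)) (g.value J') ((s.reg 24 : ℚ) / (s.reg 25 : ℚ))) →
      Spec O good (.seq (.arith .mul 0 30 25) <| .seq (.set 1 0) <| .arith .mul 2 31 24) s
        ((4 * W₂ + 4) * (1 + 2 * (W₂ + (4 * W₂ + 4)))) Rg Gd e := by
    intro e s he hB hs happ
    have m1 : (s.reg 30 * s.reg 25).size ≤ 2 * W₂ :=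
      (size_mul_le _ _).trans (by have := hB.1 30; have := hB.1 25; omega)
    have m2 : (s.reg 31 * s.reg 24).size ≤ 2 * W₂ :=
      (size_mul_le _ _).trans (by have := hB.1 31; have := hB.1 24; omega)
    have hrun : Run (.seq (.arith .mul 0 30 25) <| .seq (.set 1 0) <| .arith .mul 2 31 24) s.reg s.tape
        (4 * W₂ + 4) fun r _ => r 0 = s.reg 30 * s.reg 25 ∧ r 1 = 0 ∧ r 2 = s.reg 31 * s.reg 24 := by
      refine Run.mono (k := ((1 + 2 * W₂) + (1 + (0 : ℕ).size)) + (1 + 2 * W₂)) ?_ (by simp; omega)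
      refine Run.seq_mul m1 (Run.seq_set (Run.mono (Run.mul (by simp)) (by simpa using m2)))
    refine Spec.of_run hrun (by omega) hB (fun s' a _ _ d hd => hs d (by rwa [← a])) he ?_
    rintro s' - ⟨a0, a1, a2⟩ he0
    obtain ⟨b1, b2⟩ := happ he0
    have h := Approx.ratio hK hKε hbis (by positivity) v1 v2 b1
      (by rwa [hval'] at b2)
    simp only [Gd, MState.output, a0, a1, a2]
    exact h
  have hsecond : ∀ (e : ℝ≥0) (s : MState), e ≤ 1 → Bdd W₁ s.reg s.tape → Rg s →
      CallArgs g J' (8 * K) D s.reg → (∀ x, 50 ≤ x → 5 ≤ (x - 50) % 10 → s.reg x = 0) →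
      (e ≠ 0 → Approx (2 / ((8 * K : ℕ) : ℚ)) (g.value J) ((s.reg 30 : ℚ) / (s.reg 31 : ℚ))) →
      Spec O good (.seq (medianProg call 5) <| .seq (.arith .mul 0 30 25) <| .seq (.set 1 0) <|
        .arith .mul 2 31 24) s (t₂ + (4 * W₂ + 4) * (1 + 2 * (W₂ + (4 * W₂ + 4)))) Rg Gd
        (e * p) := by
    intro e s he hB hs ha hz happ
    have h0 := medianProg_spec hcall (K := 8 * K) (D := D) (V := c * N + n) (by omega) (by omega)
      hJ1' hJV' (b := 5) le_rfl (by omega : 3 ≤ W₁) hB ha (fun x h h' _ => hz x h h')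
    have ht : (medianTime T).eval (W₁ + 8 * K + D) ≤ t₂ := by
      rw [et₂]; exact Polynomial.eval_mono_nat _ (by omega)
    have hrest : ∀ (e' : ℝ≥0) (s₁ : MState), e' ≤ 1 →
        ((∀ x, x < 13 ∨ 30 ≤ x ∧ x < 50 ∨ 50 ≤ x ∧ ((x - 50) % 10 < 5 ∨ 5 + 5 ≤ (x - 50) % 10) →
          s₁.reg x = s.reg x) ∧ 0 < s₁.reg 25 ∧
          Bdd (W₁ + (medianTime T).eval (W₁ + 8 * K + D)) s₁.reg s₁.tape ∧
          ∀ d ∈ s₁.queries, d ∈ s.queries ∨ d = (g.code J', 1 / ((8 * K : ℕ) : ℚ))) →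
        (e' ≠ 0 → e ≠ 0 ∧
          Approx (2 / ((8 * K : ℕ) : ℚ)) (g.value J') ((s₁.reg 24 : ℚ) / (s₁.reg 25 : ℚ))) →
        Spec O good (.seq (.arith .mul 0 30 25) <| .seq (.set 1 0) <| .arith .mul 2 31 24) s₁
          ((4 * W₂ + 4) * (1 + 2 * (W₂ + (4 * W₂ + 4)))) Rg Gd e' := by
      rintro e' s₁ he' ⟨f1, -, f3, f4⟩ hap
      refine hfin e' s₁ he' (f3.mono (by omega)) (fun d hd => ?_) (fun h => ⟨?_, (hap h).2⟩)
      · rcases f4 d hd with h | h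
        · exact hs d h
        · rw [h]; exact hlegal J'
      · rw [f1 30 (by omega), f1 31 (by omega)]
        exact happ (hap h).1
    have h2 := h0.seq (cb := 0) (cg := e)
      (fun s₁ h => hrest 0 s₁ (by norm_num) h (fun h => absurd rfl h))
      (fun s₁ h hg => hrest e s₁ he h (fun h0 => ⟨h0, hg⟩)) (by positivity)
    exact h2.mono (by omega) (fun _ h => h) (fun _ _ h => h) (by simp [hp])
  have hmid : ∀ (e : ℝ≥0) (s : MState), e ≤ 1 → Bdd (W + t₁) s.reg s.tape → Rg s →
      CallArgs g J (8 * K) D s.reg → s.reg 32 = wordToNat J'.code →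
      (∀ x, 50 ≤ x → 5 ≤ (x - 50) % 10 → s.reg x = 0) →
      (e ≠ 0 → Approx (2 / ((8 * K : ℕ) : ℚ)) (g.value J) ((s.reg 24 : ℚ) / (s.reg 25 : ℚ))) →
      Spec O good (.seq (.seq (.arith .add 30 24 3) <| .seq (.arith .add 31 25 3) <|
        .arith .add 10 32 3) <| .seq (medianProg call 5) <| .seq (.arith .mul 0 30 25) <|
        .seq (.set 1 0) <| .arith .mul 2 31 24) s (3 * (1 + 2 * W₁) +
          (t₂ + (4 * W₂ + 4) * (1 + 2 * (W₂ + (4 * W₂ + 4))))) Rg Gd (e * p) := by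
    intro e s he hB hs ha h32 hz happ
    have hrun : Run (.seq (.arith .add 30 24 3) <| .seq (.arith .add 31 25 3) <|
        .arith .add 10 32 3) s.reg s.tape 3 fun r _ => r 30 = s.reg 24 ∧ r 31 = s.reg 25 ∧
          r 10 = s.reg 32 ∧ ∀ x, x ≠ 30 → x ≠ 31 → x ≠ 10 → r x = s.reg x := by
      have h3 := ha.h3
      refine Run.seq_add (Run.seq_add (Run.arith (by simp) ⟨?_, ?_, ?_, ?_⟩))
      · simp [h3]
      · simp [h3]
      · simp [h3, ArithOp.apply]
      · intro x h1 h2 h4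
        simp [h1, h2, h4]
    refine Spec.mono (Spec.run_seq hrun (by omega) hB (fun s₁ q₁ b₁ h₁ => ?_))
      (t := 3 * (1 + 2 * (W + t₁ + 3)) + (t₂ + (4 * W₂ + 4) * (1 + 2 * (W₂ + (4 * W₂ + 4)))))
      (by rw [eW₁]) (fun _ h => h) (fun _ _ h => h) le_rfl
    obtain ⟨g1, g2, g3, g4⟩ := h₁
    refine hsecond e s₁ he (b₁.mono (by omega)) (fun d hd => hs d (by rwa [← q₁])) ?_ ?_ ?_
    · refine ⟨?_, ?_, ?_, ?_, ?_, ?_⟩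
      · rw [g4 3 (by omega) (by omega) (by omega), ha.h3]
      · rw [g4 8 (by omega) (by omega) (by omega), ha.h8]
      · rw [g4 9 (by omega) (by omega) (by omega), ha.h9]
      · rw [g3, h32]; rfl
      · rw [g4 11 (by omega) (by omega) (by omega), ha.h11]
      · rw [g4 12 (by omega) (by omega) (by omega), ha.h12]
    · intro x hx hx'
      rw [g4 x (by omega) (by omega) (by omega), hz x hx hx']
    · intro h
      rw [g1, g2]
      exact happ h
  have hfirst : ∀ s : MState, Bdd W s.reg s.tape → s.queries = [] → Prepared C c B K s.reg →
      Spec O good (.seq (medianProg call 0) <| .seq (.seq (.arith .add 30 24 3) <|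
        .seq (.arith .add 31 25 3) <| .arith .add 10 32 3) <| .seq (medianProg call 5) <|
        .seq (.arith .mul 0 30 25) <| .seq (.set 1 0) <| .arith .mul 2 31 24) s
        (t₁ + (3 * (1 + 2 * W₁) + (t₂ + (4 * W₂ + 4) * (1 + 2 * (W₂ + (4 * W₂ + 4)))))) Rg Gd
        (p * p) := by
    intro s hB hq hs
    have ha : CallArgs g J (8 * K) D s.reg := ⟨hs.h3, hs.h8, hs.h9, hs.h10, hs.h11, hs.h12⟩
    have h0 := medianProg_spec hcall (K := 8 * K) (D := D) (V := c * N + n) (by omega) (by omega)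
      hJ1 hJV (b := 0) (by omega) (by omega : 3 ≤ W) hB ha (fun x h _ _ => hs.hz x (by omega))
    have ht : (medianTime T).eval (W + 8 * K + D) ≤ t₁ := by
      rw [et₁]; exact Polynomial.eval_mono_nat _ (by omega)
    have hrest : ∀ (e : ℝ≥0) (s₁ : MState), e ≤ 1 →
        ((∀ x, x < 13 ∨ 30 ≤ x ∧ x < 50 ∨ 50 ≤ x ∧ ((x - 50) % 10 < 0 ∨ 0 + 5 ≤ (x - 50) % 10) →
          s₁.reg x = s.reg x) ∧ 0 < s₁.reg 25 ∧
          Bdd (W + (medianTime T).eval (W + 8 * K + D)) s₁.reg s₁.tape ∧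
          ∀ d ∈ s₁.queries, d ∈ s.queries ∨ d = (g.code J, 1 / ((8 * K : ℕ) : ℚ))) →
        (e ≠ 0 →
          Approx (2 / ((8 * K : ℕ) : ℚ)) (g.value J) ((s₁.reg 24 : ℚ) / (s₁.reg 25 : ℚ))) →
        Spec O good (.seq (.seq (.arith .add 30 24 3) <| .seq (.arith .add 31 25 3) <|
          .arith .add 10 32 3) <| .seq (medianProg call 5) <| .seq (.arith .mul 0 30 25) <|
          .seq (.set 1 0) <| .arith .mul 2 31 24) s₁ (3 * (1 + 2 * W₁) +
            (t₂ + (4 * W₂ + 4) * (1 + 2 * (W₂ + (4 * W₂ + 4))))) Rg Gd (e * p) := by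
      rintro e s₁ he ⟨f1, -, f3, f4⟩ hap
      refine hmid e s₁ he (f3.mono (by omega)) (fun d hd => ?_)
        (ha.of_eq fun x hx => f1 x (Or.inl hx)) ?_ (fun x hx hx' => ?_) hap
      · rcases f4 d hd with h | h
        · rw [hq] at h; simp at h
        · rw [h]; exact hlegal J
      · rw [f1 32 (by omega), hs.h32]
      · rw [f1 x (by omega), hs.hz x (by omega)]
    have h2 := h0.seq (cb := 0) (cg := p)
      (fun s₁ h => (hrest 0 s₁ (by norm_num) h (fun h => absurd rfl h)).mono le_rfl
        (fun _ h => h) (fun _ _ h => h) (by simp))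
      (fun s₁ h hg => (hrest 1 s₁ le_rfl h (fun _ => hg)).mono le_rfl
        (fun _ h => h) (fun _ _ h => h) (by simp)) (by positivity)
    exact h2.mono (by omega) (fun _ h => h) (fun _ _ h => h) (by simp [hp])
  have hB0 : Bdd (L + 3) (MState.initial B.code ε).reg (MState.initial B.code ε).tape := by
    constructor
    · intro r
      by_cases hr : r = 0
      · subst hr
        have : ((MState.initial B.code ε).reg 0).size = B.code.length + 1 := by
          simp [MState.initial, size_wordToNat]
        omega
      · simp [MState.initial, hr]
    · intro x hx
      exact (size_le_two_of_mem_ratTape hx).trans (by omega)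
  refine Spec.mono (Spec.run_seq (hprep.mono (prepSteps_le hKL hnL)) (by omega) hB0
    (fun s₁ q₁ b₁ h₁ => hfirst s₁ (by rw [eW, hP]; exact b₁) q₁ h₁)) ?_ (fun _ h => h)
    (fun _ _ h => h) successTail_five
  rw [eR, eW, hP]
  omega

/-- Constants that fit the number `q`. -/
theorem exists_reduction_constants {q : ℝ} (hq : 1 < q) :
    ∃ C c : ℕ, 4 ≤ C * (q - 1) ∧ q ≤ 2 ^ c := by
  obtain ⟨C, hC⟩ := exists_nat_ge (4 / (q - 1))
  obtain ⟨c, hc⟩ := pow_unbounded_of_one_lt q (by norm_num : (1 : ℝ) < 2)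
  exact ⟨C, c, (div_le_iff₀ (by linarith)).1 hC, hc.le⟩

/-! ### Absence of oracle calls, and the final statements -/

theorem Prog.OracleFree.rename {p : Prog} (h : p.OracleFree) (ρ : ℕ → ℕ) :
    (p.rename ρ).OracleFree := by
  induction p with
  | seq p p' ih ih' => exact ⟨ih h.1, ih' h.2⟩
  | ite r p p' ih ih' => exact ⟨ih h.1, ih' h.2⟩
  | loop r p ih => exact ih h
  | oracle w n d => exact h.elim
  | _ => trivial

theorem schemeCall_oracleFree {A : Prog} (h : A.OracleFree) (i : ℕ) : (schemeCall A i).OracleFree := by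
  have h1 := h.rename (subReg i)
  simp [schemeCall, writeTol, fixDenom, Prog.OracleFree, h1]

theorem callsProg_oracleFree {call : ℕ → Prog} (h : ∀ i, (call i).OracleFree) (b j : ℕ) :
    (callsProg call b j).OracleFree := by
  induction j with
  | zero => trivial
  | succ j ih => exact ⟨h _, ⟨trivial, trivial⟩, ih⟩

theorem networkProg_oracleFree (l : List (Fin 5 × Fin 5)) : (networkProg l).OracleFree := by
  induction l with
  | nil => trivial
  | cons p l ih => exact ⟨by simp [comparator, Prog.OracleFree], ih⟩

theorem medianProg_oracleFree {call : ℕ → Prog} (h : ∀ i, (call i).OracleFree) (b : ℕ) :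
    (medianProg call b).OracleFree :=
  ⟨callsProg_oracleFree h b 5, networkProg_oracleFree _⟩

theorem reductionProg_oracleFree {call : ℕ → Prog} (h : ∀ i, (call i).OracleFree) (C c : ℕ) :
    (reductionProg call C c).OracleFree := by
  refine ⟨?_, medianProg_oracleFree h 0, by simp [Prog.OracleFree], medianProg_oracleFree h 5,
    by simp [Prog.OracleFree]⟩
  simp [prepProg, readTol, parseProg, paramProg, gadgetProg, gadgetRowProg, gadgetEntry, isolatedProg,
    readUnary, emitUnary, lookup, linkProg, Prog.OracleFree]

theorem Spec.goodRuns {O : Oracle} {good : Prop} {p : Prog} {x : List Bool} {ε : ℚ} {v : ℝ} {t : ℕ}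
    {R : MState → Prop}
    (h : Spec O good p (MState.initial x ε) t R (fun s' => Approx ε v s'.output) (3 / 4)) :
    (∀ o ∈ (p.run O t x ε).support, ∃ s, o = some s ∧ s.time ≤ t ∧ R s) ∧
      (good → 3 / 4 ≤ (p.run O t x ε).toOuterMeasure (_root_.goodRuns ε v)) := by
  obtain ⟨h1, h2⟩ := h t le_rfl
  refine ⟨fun o ho => ?_, fun hg => ?_⟩
  · obtain ⟨s', e, a, b⟩ := h1 o ho
    exact ⟨s', e, by simpa [MState.initial] using a, b⟩
  · refine le_trans ?_ (h2 hg)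
    push_cast
    exact le_rfl

theorem BIS_apReducible {q : ℝ} (hq : 1 < q) : APReducible BIS (UniformHyperTutte q (q - 1)) := by
  obtain ⟨C, c, hC, hc⟩ := exists_reduction_constants hq
  obtain ⟨T, hT⟩ := CallSpec.oracle (UniformHyperTutte q (q - 1))
  refine ⟨reductionProg (fun _ => oracleCall) C c, reductionTime T C c, fun O B ε hε _ => ?_⟩
  exact (reductionProg_spec hq hC hc (hT O) B hε rfl).goodRuns

/-- The program of the AP-reduction is reused with each oracle call replaced by a run of the scheme
on its own registers; the success bound then holds unconditionally. -/
theorem BIS_hasFPRAS {q : ℝ} (hq : 1 < q) (h : HasFPRAS (UniformHyperTutte q (q - 1))) :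
    HasFPRAS BIS := by
  obtain ⟨C, c, hC, hc⟩ := exists_reduction_constants hq
  obtain ⟨A, T, hT⟩ := CallSpec.scheme h
  -- An arbitrary oracle is supplied only to extract a fact that does not depend on it.
  have hA : A.OracleFree := (hT fun _ _ => PMF.pure 0).1
  refine ⟨reductionProg (schemeCall A) C c, reductionTime T C c,
    reductionProg_oracleFree (schemeCall_oracleFree hA) C c, fun O B ε hε => ?_⟩
  obtain ⟨h1, h2⟩ := (reductionProg_spec hq hC hc (hT O).2 B hε rfl).goodRuns
  refine ⟨fun o ho => ?_, h2 trivial⟩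
  obtain ⟨s, e, ht, -⟩ := h1 o ho
  exact ⟨s, e, ht⟩

end

theorem mainTheorem5 :
    (∀ q : ℝ, 1 < q → EfficientlyApproximable q →
      APReducible BIS (UniformHyperTutte q (q - 1)) ∧
      (HasFPRAS (UniformHyperTutte q (q - 1)) → HasFPRAS BIS)) ∧
    (HasFPRAS (UniformHyperIsing 1) → HasFPRAS BIS) := by
  refine ⟨fun q hq _ => ⟨BIS_apReducible hq, BIS_hasFPRAS hq⟩, fun h => ?_⟩
  rw [UniformHyperIsing_one] at h
  exact BIS_hasFPRAS (by norm_num) h
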